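/- **Setting.** Let $\mathfrak g\subset M_N(\mathbb C)$ be a simple Lie algebra $\mathfrak{sl}(d,\mathbb C)$, $d\ge 2$ (type A), $\mathfrak{so}(d,\mathbb C)$, $d\geq 3$, $d\ne 4$ (types B, D) or $\mathfrak{sp}(2l,\mathbb C)$, $l\ge1$ (type C), in its defining representation of dimension $N$. Let $\sigma$ be an automorphism of $\mathfrak g$ of finite order $T>1$; if $\mathfrak g=\mathfrak{so}(8,\mathbb C)$, assume that $\sigma$ is the conjugation by an element of $O(8,\mathbb C)$. Let $\omega$ be a primitive $T$-th root of unity, $(T^a)$ a basis of $\mathfrak g$ with dual basis $(T_a)$ with respect to the trace form, $C_{12}=\sum_aT^a\otimes T_a$, and let $\varphi\neq0$ be a rational function with $\varphi(\omega\lambda)=\omega^{-1}\varphi(\lambda)$. Put $$\mathcal R^0_{12}(\lambda,\mu)=\frac1T\sum_{k=0}^{T-1}\frac{\sigma^k_1C_{12}}{\mu-\omega^{-k}\lambda},\qquad \mathcal R_{12}(\lambda,\mu)=\mathcal R^0_{12}(\lambda,\mu)\,\varphi(\mu)^{-1}.$$ Consider a field theory in one space dimension with a local Poisson bracket: the local densities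 form a commutative differential $\mathbb C$-algebra $(\mathcal V,\partial_x)$, and the bracket $\{a(x),b(y)\}=\sum_nc_n(y)\,\partial_y^n\delta(x-y)$ makes it a Poisson vertex algebra. Local charges $\int dx\,a(x)$ are densities modulo total derivatives, i.e. elements of $\mathcal V/\partial_x\mathcal V$, with $\{\int a,\int b\}=\int dx\int dy\,\{a(x),b(y)\}$. Let $\mathcal L(\lambda,x)$ be a Lax matrix, with values in $\mathfrak g\otimes\mathcal V$ for $\lambda$ outside a set of isolated points, such that $\sigma(\mathcal L(\lambda,x))=\mathcal L(\omega\lambda,x)$ and $$\{\mathcal L(\lambda,x)_1,\mathcal L(\mu,y)_2\}=[\mathcal R_{12}(\lambda,\mu),\mathcal L(\lambda,x)_1]\,\delta_{xy}-[\mathcal R_{21}(\mu,\lambda),\mathcal L(\mu,y)_2]\,\delta_{xy}-\big(\mathcal R_{12}(\lambda,\mu)+\mathcal R_{21}(\mu,\lambda)\big)\,\partial_x\delta_{xy}$$ away from the poles of $\mathcal L$, the zeros and poles of $\varphi$, and $\lambda^T=\mu^T$. Suppose that the origin is a regular zero: $\varphi(0)=0$ and $\varphi(\lambda)\mathcal L(\lambda,x)$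 is holomorphic at $\lambda=0$ (near $0$ it takes values in a finite-dimensional subspace of $\mathfrak g\otimes\mathcal V$ and is holomorphic there, up to a removable singularity at $0$). Let $\mathscr T_n(\lambda,x)=\mathrm{Tr}\big(\varphi(\lambda)^n\mathcal L(\lambda,x)^n\big)$. - If $\mathfrak g$ is of type B, C or D, or if $\mathfrak g$ is of type A and $\sigma$ is inner (a conjugation by an element of $SL(d,\mathbb C)$), put $\kappa=1$ and $\mathcal W_n(\lambda,x)=\mathscr T_n(\lambda,x)$. - If $\mathfrak g=\mathfrak{sl}(d,\mathbb C)$ and $\sigma$ is not inner (then $T$ is even), put $\kappa=1+\frac T2$ and let $\mathcal W_n(\lambda,x)$ be the coefficient of $\mu^n$ in $\exp\Big(-\frac{n-1}{d}\sum_{k\ge2}\frac{\mu^k}{k}\mathscr T_k(\lambda,x)\Big)$. Let $r_n\in\{0,\dots,T-1\}$ be the remainder of the Euclidean division of $-n\kappa$ by $T$, and let $\mathcal E_0$ be the set of all $n\ge2$ with $r_n\ne T-1$. **Theorem.** For every $n\ge2$ the density $\mathcal W_n(\lambda,x)$ is holomorphic at $\lambda=0$ (up to a removable singularity). Let $\mathscr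 K^0_n(x)$ be the coefficient of $\lambda^{r_n}$ in its Taylor expansion at $0$ and $\mathcal Q^0_n=\int dx\,\mathscr K^0_n(x)$. Then the charges are in involution: $$\{\mathcal Q^0_n,\mathcal Q^0_m\}=0\qquad\text{for all }n,m\in\mathcal E_0 .$$ Consequently, let a field configuration be given, i.e. a homomorphism of $\mathbb C$-algebras from $\mathcal V$ to the functions on $\mathbb R$ under which $\partial_x$ becomes $\frac{d}{dx}$, and let $c_0(x)$ be the function which represents the density $\int dx'\{\mathscr K^0_n(x'),\mathscr K^0_m(x)\}$. If all densities are represented by functions of period $\ell$ (fields on a circle), then $\int_0^\ell c_0\,dx=0$; if each density is represented by a function which has the same finite limit at $+\infty$ and $-\infty$ (fields decreasing at infinity), then $\lim_{\rho\to\infty}\int_{-\rho}^{\rho}c_0\,dx=0$. -/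

import Mathlib

open scoped TensorProduct Kronecker Polynomial Topology

attribute [local instance] LieRing.ofAssociativeRing

noncomputable section

/-! ## Local Poisson brackets, local charges -/

/-- A differential algebra `𝒱` of local densities `a(x)` (with total derivative `D = ∂_x`), with a
local Poisson bracket, i.e. a Poisson vertex algebra. The polynomial
`br a b = ∑ₙ cₙ Xⁿ` encodes `{a(x), b(y)} = ∑ₙ cₙ(y) ∂_yⁿ δ(x - y)`. -/
class PoissonVertexAlgebra (𝒱 : Type*) [CommRing 𝒱] [Algebra ℂ 𝒱] where
  D : Derivation ℂ 𝒱 𝒱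
  br : 𝒱 →ₗ[ℂ] 𝒱 →ₗ[ℂ] 𝒱[X]
  /-- `{∂_x a(x), b(y)} = ∂_x {a(x), b(y)}`. -/
  br_D_left : ∀ a b, br (D a) b = -(Polynomial.X * br a b)
  /-- `{a(x), ∂_y b(y)} = ∂_y {a(x), b(y)}`. -/
  coeff_zero_br_D_right : ∀ a b, (br a (D b)).coeff 0 = D ((br a b).coeff 0)
  coeff_succ_br_D_right : ∀ a b n,
    (br a (D b)).coeff (n + 1) = D ((br a b).coeff (n + 1)) + (br a b).coeff n
  /-- Leibniz rule. -/
  br_mul_right : ∀ a b c,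
    br a (b * c) = Polynomial.C b * br a c + Polynomial.C c * br a b
  /-- Skew-symmetry `{b_X a} = - {a_{-X-∂} b}`. -/
  coeff_br_skew : ∀ a b k,
    (br b a).coeff k = -∑ n ∈ (br a b).support,
      (((-1 : ℤ) ^ n * (n.choose k : ℤ)) • (D^[n - k]) ((br a b).coeff n))
  /-- Jacobi identity `{a_X {b_Y c}} - {b_Y {a_X c}} = {{a_X b}_{X+Y} c}`,
  coefficient of `X^m Y^n`. -/
  jacobi : ∀ a b c m n,
    (br a ((br b c).coeff n)).coeff m - (br b ((br a c).coeff m)).coeff n =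
      ∑ j ∈ Finset.range (m + 1),
        ((m + n - j).choose n) • (br ((br a b).coeff j) c).coeff (m + n - j)

namespace PoissonVertexAlgebra

variable (𝒱 : Type*) [CommRing 𝒱] [Algebra ℂ 𝒱] [PoissonVertexAlgebra 𝒱]

/-- The space of total `x`-derivatives. -/
def totalDerivatives : Submodule ℂ 𝒱 :=
  LinearMap.range ((D : Derivation ℂ 𝒱 𝒱) : 𝒱 →ₗ[ℂ] 𝒱)

/-- Local charges: densities modulo total derivatives. -/
abbrev Charge : Type _ := 𝒱 ⧸ totalDerivatives 𝒱

variable {𝒱}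

/-- The local charge `∫ dx a(x)` with density `a`. -/
def integral : 𝒱 →ₗ[ℂ] Charge 𝒱 := (totalDerivatives 𝒱).mkQ

/-- The density `∫ dx {a(x), b(y)}`. -/
def integratedBr : 𝒱 →ₗ[ℂ] 𝒱 →ₗ[ℂ] 𝒱 :=
  (br (𝒱 := 𝒱)).compr₂ ((Polynomial.lcoeff 𝒱 0).restrictScalars ℂ)

theorem integratedBr_apply (a b : 𝒱) : integratedBr a b = (br a b).coeff 0 := rfl

/-- The Poisson bracket of local charges,
`{∫ dx a(x), ∫ dy b(y)} = ∫ dx ∫ dy {a(x), b(y)}`. -/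
def chargeBracket : Charge 𝒱 →ₗ[ℂ] Charge 𝒱 →ₗ[ℂ] Charge 𝒱 :=
  (totalDerivatives 𝒱).liftQ
    (LinearMap.flip ((totalDerivatives 𝒱).liftQ
      (LinearMap.flip ((integratedBr (𝒱 := 𝒱)).compr₂ (integral (𝒱 := 𝒱))))
      (by
        rintro _ ⟨b, rfl⟩
        rw [LinearMap.mem_ker]
        ext a
        change integral ((br a (D b)).coeff 0) = 0
        rw [coeff_zero_br_D_right]
        exact (Submodule.Quotient.mk_eq_zero _).2 ⟨_, rfl⟩)))
    (by
      rintro _ ⟨a, rfl⟩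
      rw [LinearMap.mem_ker]
      refine LinearMap.ext fun q => ?_
      obtain ⟨b, rfl⟩ := Submodule.Quotient.mk_surjective _ q
      change integral ((br (D a) b).coeff 0) = 0
      rw [br_D_left]
      simp)

theorem chargeBracket_integral (a b : 𝒱) :
    chargeBracket (integral a) (integral b) = integral (integratedBr a b) := rfl

variable (𝒱)

/-- A field configuration on the line (or on a circle, if periodic): a realisation of all the
densities as functions of `x`, in which `D` is the derivative with respect to `x`. -/
structure FieldConfiguration where
  eval : 𝒱 →ₐ[ℂ] (ℝ → ℂ)
  hasDerivAt_eval : ∀ (a : 𝒱) (x : ℝ), HasDerivAt (eval a) (eval (D a) x) x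

variable {𝒱}

/-- The spatial coordinate lives on a circle of length `ℓ`. -/
def FieldConfiguration.IsPeriodic (u : FieldConfiguration 𝒱) (ℓ : ℝ) : Prop :=
  ∀ a : 𝒱, Function.Periodic (u.eval a) ℓ

/-- The fields decrease to a constant background at infinity. -/
def FieldConfiguration.DecaysAtInfinity (u : FieldConfiguration 𝒱) : Prop :=
  ∀ a : 𝒱, ∃ c : ℂ, Filter.Tendsto (u.eval a) (Filter.cocompact ℝ) (𝓝 c)

end PoissonVertexAlgebra

/-! ## Holomorphic functions with values in a complex vector space -/

section Taylor

variable {M : Type*} [AddCommGroup M] [Module ℂ M]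

/-- `F` is (after removing a possible singularity) holomorphic at `0`, with Taylor expansion
`F z = ∑ᵣ A r z ^ r`. As `M` carries no topology, holomorphic means: near `0` the function takes
values in a finite-dimensional subspace and has holomorphic coordinates there. -/
def HasTaylorAtZero (F : ℂ → M) (A : ℕ → M) : Prop :=
  ∃ (k : ℕ) (g : Fin k → ℂ → ℂ) (v : Fin k → M),
    (∀ i, AnalyticAt ℂ (g i) 0) ∧
    (∀ᶠ z in 𝓝[≠] (0 : ℂ), F z = ∑ i, g i z • v i) ∧
    ∀ r, A r = ∑ i, (iteratedDeriv r (g i) 0 / (r.factorial : ℂ)) • v i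

def HolomorphicAtZero (F : ℂ → M) : Prop := ∃ A, HasTaylorAtZero F A

open Classical in
/-- The coefficient of `z ^ r` in the Taylor expansion of `F` at `0`. -/
def taylorCoeff (F : ℂ → M) (r : ℕ) : M :=
  if h : HolomorphicAtZero F then h.choose r else 0

theorem HasTaylorAtZero.unique {F : ℂ → M} {A B : ℕ → M}
    (hA : HasTaylorAtZero F A) (hB : HasTaylorAtZero F B) : A = B := by
  obtain ⟨k, g, v, hg, hF, hA⟩ := hA
  obtain ⟨l, h, w, hh, hF', hB⟩ := hB
  have key : ∀ ξ : Module.Dual ℂ M,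
      (fun z => ∑ i, ξ (v i) * g i z) =ᶠ[𝓝 0] fun z => ∑ i, ξ (w i) * h i z := by
    intro ξ
    have h1 : AnalyticAt ℂ (fun z => ∑ i, ξ (v i) * g i z) 0 :=
      Finset.analyticAt_fun_sum _ fun i _ => analyticAt_const.mul (hg i)
    have h2 : AnalyticAt ℂ (fun z => ∑ i, ξ (w i) * h i z) 0 :=
      Finset.analyticAt_fun_sum _ fun i _ => analyticAt_const.mul (hh i)
    refine (h1.frequently_eq_iff_eventually_eq h2).1 (Filter.Eventually.frequently ?_)
    filter_upwards [hF, hF'] with z hz hz'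
    have := congrArg ξ (hz.symm.trans hz')
    simpa [mul_comm] using this
  have smooth : ∀ (f : ℂ → ℂ) (r : ℕ), AnalyticAt ℂ f 0 → ContDiffAt ℂ r f 0 :=
    fun f r hf => hf.contDiffAt
  funext r
  rw [← sub_eq_zero, ← Module.forall_dual_apply_eq_zero_iff ℂ]
  intro ξ
  have := (key ξ).iteratedDeriv_eq r
  rw [iteratedDeriv_fun_sum (fun i _ => contDiffAt_const.mul (smooth _ r (hg i))),
    iteratedDeriv_fun_sum (fun i _ => contDiffAt_const.mul (smooth _ r (hh i)))] at this
  simp only [fun i => iteratedDeriv_const_mul (ξ (v i)) (smooth _ r (hg i)),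
    fun i => iteratedDeriv_const_mul (ξ (w i)) (smooth _ r (hh i))] at this
  rw [hA, hB, map_sub, map_sum, map_sum, sub_eq_zero]
  simp only [map_smul, smul_eq_mul, div_mul_eq_mul_div, ← Finset.sum_div]
  simp only [mul_comm (iteratedDeriv _ _ _)]
  rw [this]

theorem HasTaylorAtZero.taylorCoeff_eq {F : ℂ → M} {A : ℕ → M} (hA : HasTaylorAtZero F A)
    (r : ℕ) : taylorCoeff F r = A r := by
  have h : HolomorphicAtZero F := ⟨A, hA⟩
  rw [taylorCoeff, dif_pos h, h.choose_spec.unique hA]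

end Taylor

/-! ## Classical Lie algebras in their defining representations -/

/-- The types `A`: `sl(d, ℂ)`; `B`, `D`: `so(d, ℂ)`; `C`: `sp(2l, ℂ)`. -/
inductive ClassicalType : Type
  | A (d : ℕ)
  | BD (d : ℕ)
  | C (l : ℕ)

namespace ClassicalType

/-- Index set of the basis of the defining representation. -/
abbrev Index : ClassicalType → Type
  | A d => Fin d
  | BD d => Fin d
  | C l => Fin l ⊕ Fin l

instance (t : ClassicalType) : Fintype t.Index :=
  match t with
  | A d => inferInstanceAs (Fintype (Fin d))
  | BD d => inferInstanceAs (Fintype (Fin d))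
  | C l => inferInstanceAs (Fintype (Fin l ⊕ Fin l))

instance (t : ClassicalType) : DecidableEq t.Index :=
  match t with
  | A d => inferInstanceAs (DecidableEq (Fin d))
  | BD d => inferInstanceAs (DecidableEq (Fin d))
  | C l => inferInstanceAs (DecidableEq (Fin l ⊕ Fin l))

/-- The matrix Lie algebra `𝔤`. -/
def alg (t : ClassicalType) : LieSubalgebra ℂ (Matrix t.Index t.Index ℂ) :=
  match t with
  | A d => LieAlgebra.SpecialLinear.sl (Fin d) ℂ
  | BD d => LieAlgebra.Orthogonal.so (Fin d) ℂ
  | C l => LieAlgebra.Symplectic.sp (Fin l) ℂ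

/-- The values of the parameters for which `𝔤` is simple. -/
def IsSimpleType : ClassicalType → Prop
  | A d => 2 ≤ d
  | BD d => 3 ≤ d ∧ d ≠ 4
  | C l => 1 ≤ l

/-- In type `A`, an automorphism is inner if it is the conjugation by an element of `SL(d, ℂ)`. -/
def IsInner {d : ℕ} (σ : (A d).alg ≃ₗ⁅ℂ⁆ (A d).alg) : Prop :=
  ∃ Q : Matrix.SpecialLinearGroup (Fin d) ℂ, ∀ X : (A d).alg,
    (σ X : Matrix (Fin d) (Fin d) ℂ) = Q.1 * (X : Matrix (Fin d) (Fin d) ℂ) * (Q⁻¹).1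

/-- The case "type `A` and `σ` not inner". -/
def IsTwisted : (t : ClassicalType) → (t.alg ≃ₗ⁅ℂ⁆ t.alg) → Prop
  | A _, σ => ¬ IsInner σ
  | BD _, _ => False
  | C _, _ => False

/-- `σ` is not one of the special automorphisms of `D₄ = so(8, ℂ)`, i.e. of those
which are not given by conjugation with an element of `O(8, ℂ)`. -/
def NotSpecialD4 : (t : ClassicalType) → (t.alg ≃ₗ⁅ℂ⁆ t.alg) → Prop
  | A _, _ => True
  | BD d, σ => d = 8 → ∃ Q : Matrix (Fin d) (Fin d) ℂ, Q * Q.transpose = 1 ∧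
      ∀ X : (BD d).alg,
        (σ X : Matrix (Fin d) (Fin d) ℂ) = Q * (X : Matrix (Fin d) (Fin d) ℂ) * Q.transpose
  | C _, _ => True

/-- The matrix, with entries in `𝒱`, of a `𝔤`-valued field. -/
def toMatrix (t : ClassicalType) (𝒱 : Type*) [CommRing 𝒱] [Algebra ℂ 𝒱] :
    𝒱 ⊗[ℂ] t.alg →ₗ[ℂ] Matrix t.Index t.Index 𝒱 :=
  TensorProduct.lift <| LinearMap.mk₂ ℂ
    (fun (a : 𝒱) (X : t.alg) =>
      a • (X : Matrix t.Index t.Index ℂ).map (algebraMap ℂ 𝒱))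
    (fun a b X => add_smul a b _)
    (fun c a X => smul_assoc c a _)
    (fun a X Y => by ext i j; simp [mul_add])
    (fun c a X => by
      ext i j
      have h : ((c • X : t.alg) : Matrix t.Index t.Index ℂ) i j =
        c * (X : Matrix t.Index t.Index ℂ) i j := rfl
      simp only [Matrix.smul_apply, Matrix.map_apply, h, smul_eq_mul, map_mul,
        Algebra.smul_def c (_ : 𝒱)]
      ring)

end ClassicalType

/-! ## Models with twist function -/

/-- Value of a rational function (it is `0` at a pole). -/
def RatFunc.valueAt (φ : RatFunc ℂ) (z : ℂ) : ℂ := φ.eval (RingHom.id ℂ) z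

/-- A non-ultralocal field theory, with `ℤ_T`-equivariant Lax matrix `L(λ, x)` in
the classical Lie algebra of type `t`, whose Poisson bracket is an `r/s`-system with twist function
`φ`. Matrices indexed by pairs represent elements of `End(V ⊗ V)`: if `Mᵢⱼ`, `Nₖₗ` are the entries
of `M` and `N`, then `M ⊗ₖ N` has the entry `Mᵢⱼ Nₖₗ` at `((i, k), (j, l))`. -/
structure TwistModel (t : ClassicalType) (𝒱 : Type*) [CommRing 𝒱] [Algebra ℂ 𝒱]
    [PoissonVertexAlgebra 𝒱] where
  T : ℕ
  T_pos : 0 < T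
  σ : t.alg ≃ₗ⁅ℂ⁆ t.alg
  order_σ : orderOf ((σ : t.alg →ₗ[ℂ] t.alg) : Module.End ℂ t.alg) = T
  ω : ℂ
  isPrimitiveRoot : IsPrimitiveRoot ω T
  /-- A basis of `𝔤`, and its dual basis for the trace form. -/
  basisUp : Module.Basis (Fin (Module.finrank ℂ t.alg)) ℂ t.alg
  basisDown : Fin (Module.finrank ℂ t.alg) → t.alg
  trace_basis : ∀ a b, Matrix.trace
    ((basisUp a : Matrix t.Index t.Index ℂ) * (basisDown b : Matrix t.Index t.Index ℂ)) =
      if a = b then 1 else 0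
  /-- The twist function. -/
  φ : RatFunc ℂ
  φ_ne_zero : φ ≠ 0
  φ_equivariant : ∀ z, φ.valueAt (ω * z) = ω⁻¹ * φ.valueAt z
  /-- The Lax matrix, defined away from a set of isolated points. -/
  L : ℂ → 𝒱 ⊗[ℂ] t.alg
  poles : Set ℂ
  isolated_poles : ∀ z, ∀ᶠ w in 𝓝[≠] z, w ∉ poles
  L_equivariant : ∀ z, z ∉ poles → ω * z ∉ poles →
    (LinearMap.lTensor 𝒱 (σ : t.alg →ₗ[ℂ] t.alg)) (L z) = L (ω * z)
  /-- The Maillet bracket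
  `{L₁(z, x), L₂(w, y)} = ([R₁₂(z, w), L₁(z, x)] - [R₂₁(w, z), L₂(w, y)]) δ(x - y)
    - (R₁₂(z, w) + R₂₁(w, z)) ∂_x δ(x - y)`, where `∂_x δ(x - y) = - ∂_y δ(x - y)`,
  `R₁₂(z, w) = R⁰₁₂(z, w) φ(w)⁻¹` and
  `R⁰₁₂(z, w) = T⁻¹ ∑ₖ σ₁ᵏ C₁₂ / (w - ω⁻ᵏ z)`, `C₁₂ = ∑ₐ Tᵃ ⊗ Tₐ`. -/
  maillet :
    let R0 : ℂ → ℂ → Matrix (t.Index × t.Index) (t.Index × t.Index) ℂ := fun z w =>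
      (T : ℂ)⁻¹ • ∑ k ∈ Finset.range T, (w - (ω ^ k)⁻¹ * z)⁻¹ •
        ∑ a, ((σ^[k] (basisUp a) : t.alg) : Matrix t.Index t.Index ℂ) ⊗ₖ
          (basisDown a : Matrix t.Index t.Index ℂ)
    let R12 : ℂ → ℂ → Matrix (t.Index × t.Index) (t.Index × t.Index) ℂ := fun z w =>
      (φ.valueAt w)⁻¹ • R0 z w
    let R21 : ℂ → ℂ → Matrix (t.Index × t.Index) (t.Index × t.Index) ℂ := fun w z =>
      (R12 w z).submatrix Prod.swap Prod.swap
    ∀ z w, z ∉ poles → w ∉ poles → φ.valueAt z ≠ 0 → φ.valueAt w ≠ 0 → z ^ T ≠ w ^ T →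
      let L1 : Matrix (t.Index × t.Index) (t.Index × t.Index) 𝒱 := t.toMatrix 𝒱 (L z) ⊗ₖ 1
      let L2 : Matrix (t.Index × t.Index) (t.Index × t.Index) 𝒱 := 1 ⊗ₖ t.toMatrix 𝒱 (L w)
      let R : Matrix (t.Index × t.Index) (t.Index × t.Index) 𝒱 :=
        (R12 z w).map (algebraMap ℂ 𝒱)
      let R' : Matrix (t.Index × t.Index) (t.Index × t.Index) 𝒱 :=
        (R21 w z).map (algebraMap ℂ 𝒱)
      ∀ i j k l,
        PoissonVertexAlgebra.br (t.toMatrix 𝒱 (L z) i j) (t.toMatrix 𝒱 (L w) k l) =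
          Polynomial.C (((R * L1 - L1 * R) - (R' * L2 - L2 * R')) (i, k) (j, l)) +
            Polynomial.C ((R + R') (i, k) (j, l)) * Polynomial.X

namespace TwistModel

variable {t : ClassicalType} {𝒱 : Type*} [CommRing 𝒱] [Algebra ℂ 𝒱] [PoissonVertexAlgebra 𝒱]
  (m : TwistModel t 𝒱)

/-- The origin is a regular zero: `φ(0) = 0` and `φ(λ) L(λ, x)` is holomorphic at `λ = 0`. -/
def HasRegularZeroAtOrigin : Prop :=
  m.φ.num.IsRoot 0 ∧ HolomorphicAtZero fun z => m.φ.valueAt z • m.L z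

/-- `𝒯ₙ(λ, x) = Tr (φ(λ)ⁿ L(λ, x)ⁿ)`. -/
def traceDensity (n : ℕ) (z : ℂ) : 𝒱 :=
  Matrix.trace (m.φ.valueAt z ^ n • t.toMatrix 𝒱 (m.L z) ^ n)

/-- The coefficient of `μⁿ` in `exp (- (n - 1) / d * ∑_{k ≥ 2} μᵏ / k * 𝒯ₖ(λ, x))`, with `d` the
dimension of the defining representation. -/
def generatedDensity (n : ℕ) (z : ℂ) : 𝒱 :=
  PowerSeries.coeff n (PowerSeries.subst
    (PowerSeries.mk fun k => if 2 ≤ k then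
      (-(((n : ℂ) - 1) / (Fintype.card t.Index : ℂ)) / (k : ℂ)) • m.traceDensity k z else 0)
    (PowerSeries.exp ℂ) : PowerSeries 𝒱)

open Classical in
/-- The density `𝒲ₙ(λ, x)`. -/
def W (n : ℕ) (z : ℂ) : 𝒱 :=
  if t.IsTwisted m.σ then m.generatedDensity n z else m.traceDensity n z

open Classical in
/-- `κ = 1 + T / 2` if `𝔤` is of type `A` and `σ` is not inner (then `T` is even), and `κ = 1`
otherwise. -/
def kappa : ℕ := if t.IsTwisted m.σ then 1 + m.T / 2 else 1

/-- `rₙ`, the remainder of the Euclidean division of `- n κ` by `T`. -/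
def r (n : ℕ) : ℕ := ((-((n : ℤ) * (m.kappa : ℤ))) % (m.T : ℤ)).toNat

/-- The density `𝒦⁰ₙ(x)`: the coefficient of `λ ^ rₙ` in `𝒲ₙ(λ, x)`. -/
def K0 (n : ℕ) : 𝒱 := taylorCoeff (m.W n) (m.r n)

/-- The local charge `𝒬⁰ₙ = ∫ dx 𝒦⁰ₙ(x)`. -/
def Q0 (n : ℕ) : PoissonVertexAlgebra.Charge 𝒱 := PoissonVertexAlgebra.integral (m.K0 n)

/-- The degrees `n ≥ 2` with `rₙ ≠ T - 1`, in particular all those for which moreover `n - 1` is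
an exponent of the untwisted affine algebra of `𝔤`. -/
def E0 : Set ℕ := {n | 2 ≤ n ∧ m.r n ≠ m.T - 1}

end TwistModel

end

noncomputable section

/-! ## Traces of powers of the adjoint representation -/

section AdjointTraces

variable {ι : Type*} [Fintype ι] [DecidableEq ι]

/-! Let S = φL, and call gradient of 𝒲ₙ a matrix Gₙ commuting with S such that δ𝒲ₙ = Tr(Gₙ δS) for
every derivation δ. The Leibniz rule and skew-symmetry reduce the bracket of two densities to the
Maillet bracket contracted with gradients. The commutator terms vanish by cyclicity of the trace,
and the ∂ₓδ term leaves the contraction of R₁₂ + R₂₁ with ∂ₓGₙ and Gₖ. Equivariance of Gₙ trades the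
power σʲ on the Casimir for the rotated point ω⁻ʲλ. The two kernels then combine into a weighted sum
over j of (φ(ω⁻ʲλ) - φ(μ)) / (μ - ω⁻ʲλ) · ⟨∂ₓGₙ(ω⁻ʲλ), Gₖ(μ)⟩, in which the pole on the diagonal is
removable (`integratedBr_W`).

Extract the coefficient of λ^{rₙ} μ^{rₖ}. Since T divides nκ + rₙ, all j contribute equally, and the
result is a double sum of terms -φ_{a+b+1} ⟨∂ₓ(Gₙ)_{rₙ-b}, (Gₖ)_{rₖ-a}⟩. Equivariance of φ kills φ_s
unless s ≡ -1 mod T, and rₙ, rₖ ≤ T - 2 leave only s = T - 1. What survives is -φ_{T-1} times a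
single Taylor coefficient, of order rₙ + rₖ + 2 - T ≤ rₙ, of the diagonal contraction ⟨∂ₓGₙ(λ),
Gₖ(λ)⟩ (`integratedBr_K0_mem`). It therefore suffices that its coefficients up to order rₙ are total
derivatives.

In types B, C, D, Tr Sⁿ vanishes for odd n. For even n, Gₙ = n Sⁿ⁻¹ is 𝔤-valued and the contraction
is a multiple of ∂ₓ Tr Sⁿ⁺ᵏ⁻². In type A powers of S are not traceless, which adds a correction
proportional to ∂ₓTr Sⁿ⁻¹ · Tr Sᵏ⁻¹. If σ is inner, equivariance confines Tr Sⁿ⁻¹ to degrees ≡ rₙ +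
1 mod T, so the correction starts beyond order rₙ. If σ is not inner these degrees are shifted by
T/2 and the argument is lost. The exponential with exponent (n - 1)/d repairs this: its gradient is
traceless, and an antisymmetric convolution identity makes Tr(∂ₓGₙ Gₖ) proportional to ∂ₓTr(Gₙ Gₖ).

Equivariance of the gradients requires σ to respect the trace form, and odd powers in types B, C, D,
or to be X ↦ PXP⁻¹ or X ↦ -PXᵀP⁻¹ in type A. Apart from so(8), where a conjugation is given, this
comes from the invariance of Tr ad(X)ᵐ for m = 2, 4, 6. -/

theorem trace_eq_sum_single (f : Module.End ℂ (Matrix ι ι ℂ)) :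
    LinearMap.trace ℂ _ f = ∑ i, ∑ j, f (Matrix.single i j 1) i j := by
  rw [LinearMap.trace_eq_matrix_trace ℂ (Matrix.stdBasis ℂ ι ι), Matrix.trace,
    Fintype.sum_prod_type]
  refine Finset.sum_congr rfl fun i _ => Finset.sum_congr rfl fun j _ => ?_
  rw [Matrix.diag_apply, LinearMap.toMatrix_apply, Matrix.stdBasis_eq_single]
  simp [Matrix.stdBasis]

/-- The endomorphism `Y ↦ A Y B`. -/
def leftRight (A B : Matrix ι ι ℂ) : Module.End ℂ (Matrix ι ι ℂ) :=
  LinearMap.mulLeft ℂ A ∘ₗ LinearMap.mulRight ℂ B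

@[simp] theorem leftRight_apply (A B Y : Matrix ι ι ℂ) : leftRight A B Y = A * (Y * B) := rfl

theorem trace_leftRight (A B : Matrix ι ι ℂ) :
    LinearMap.trace ℂ _ (leftRight A B) = A.trace * B.trace := by
  rw [trace_eq_sum_single, Matrix.trace, Matrix.trace, Finset.sum_mul_sum]
  refine Finset.sum_congr rfl fun i _ => Finset.sum_congr rfl fun j _ => ?_
  rw [leftRight_apply, ← Matrix.mul_assoc, Matrix.mul_apply, Finset.sum_eq_single j]
  · simp
  · intro k _ hk; simp [Matrix.mul_single_apply_of_ne _ _ _ _ _ hk]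
  · simp

theorem trace_leftRight_comp_transpose (A B : Matrix ι ι ℂ) :
    LinearMap.trace ℂ _ (leftRight A B ∘ₗ Matrix.transposeLinearEquiv ι ι ℂ ℂ) =
      (A * B.transpose).trace := by
  rw [trace_eq_sum_single, Matrix.trace]
  refine Finset.sum_congr rfl fun i _ => ?_
  rw [Matrix.diag_apply, Matrix.mul_apply]
  refine Finset.sum_congr rfl fun j _ => ?_
  simp only [LinearMap.comp_apply, LinearEquiv.coe_coe, Matrix.transposeLinearEquiv_apply,
    leftRight_apply]
  rw [← Matrix.mul_assoc, Matrix.mul_apply, Finset.sum_eq_single i]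
  · simp
  · intro k _ hk; simp [Matrix.mul_single_apply_of_ne _ _ _ _ _ hk]
  · simp

theorem trace_smulRight_trace (C : Matrix ι ι ℂ) :
    LinearMap.trace ℂ _ ((Matrix.traceLinearMap ι ℂ ℂ).smulRight C) = C.trace := by
  rw [trace_eq_sum_single, Matrix.trace]
  refine Finset.sum_congr rfl fun i _ => ?_
  rw [Finset.sum_eq_single i]
  · simp
  · intro j _ hj
    simp [Matrix.trace_single_eq_of_ne i j _ hj.symm]
  · simp

/-- The commutator with `X` on all matrices. -/
def matrixAd (X : Matrix ι ι ℂ) : Module.End ℂ (Matrix ι ι ℂ) :=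
  LinearMap.mulLeft ℂ X - LinearMap.mulRight ℂ X

@[simp] theorem matrixAd_apply (X Y : Matrix ι ι ℂ) : matrixAd X Y = X * Y - Y * X := rfl

theorem matrixAd_pow_two (X : Matrix ι ι ℂ) : matrixAd X ^ 2 =
    leftRight (X ^ 2) 1 - (2 : ℂ) • leftRight X X + leftRight 1 (X ^ 2) := by
  refine LinearMap.ext fun Y => ?_
  simp only [pow_succ, pow_zero, Module.End.mul_apply, Module.End.one_apply, matrixAd_apply,
    LinearMap.add_apply, LinearMap.sub_apply, LinearMap.smul_apply, leftRight_apply,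
    ofNat_smul_eq_nsmul]
  noncomm_ring

theorem matrixAd_pow_four (X : Matrix ι ι ℂ) : matrixAd X ^ 4 =
    leftRight (X ^ 4) 1 - (4 : ℂ) • leftRight (X ^ 3) X + (6 : ℂ) • leftRight (X ^ 2) (X ^ 2)
      - (4 : ℂ) • leftRight X (X ^ 3) + leftRight 1 (X ^ 4) := by
  refine LinearMap.ext fun Y => ?_
  simp only [pow_succ, pow_zero, Module.End.mul_apply, Module.End.one_apply, matrixAd_apply,
    LinearMap.add_apply, LinearMap.sub_apply, LinearMap.smul_apply, leftRight_apply,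
    ofNat_smul_eq_nsmul]
  noncomm_ring

theorem matrixAd_pow_six (X : Matrix ι ι ℂ) : matrixAd X ^ 6 =
    leftRight (X ^ 6) 1 - (6 : ℂ) • leftRight (X ^ 5) X + (15 : ℂ) • leftRight (X ^ 4) (X ^ 2)
      - (20 : ℂ) • leftRight (X ^ 3) (X ^ 3) + (15 : ℂ) • leftRight (X ^ 2) (X ^ 4)
      - (6 : ℂ) • leftRight X (X ^ 5) + leftRight 1 (X ^ 6) := by
  refine LinearMap.ext fun Y => ?_
  simp only [pow_succ, pow_zero, Module.End.mul_apply, Module.End.one_apply, matrixAd_apply,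
    LinearMap.add_apply, LinearMap.sub_apply, LinearMap.smul_apply, leftRight_apply,
    ofNat_smul_eq_nsmul]
  noncomm_ring

variable {g : LieSubalgebra ℂ (Matrix ι ι ℂ)}

/-- Cyclicity of the trace moves the inclusion past the projection `p`. On all matrices the
commutator expands into maps Y ↦ AYB, whose traces are explicit. -/
theorem trace_ad_pow_eq (p : Matrix ι ι ℂ →ₗ[ℂ] g) (hp : ∀ X : g, p X = X) (X : g) (n : ℕ) :
    LinearMap.trace ℂ g (LieAlgebra.ad ℂ g X ^ n) =
      LinearMap.trace ℂ _ ((matrixAd (X : Matrix ι ι ℂ) ^ n) ∘ₗ (g.incl : g →ₗ[ℂ] Matrix ι ι ℂ) ∘ₗ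
          p) := by
  have h : ∀ Y : g, (((LieAlgebra.ad ℂ g X ^ n) Y : g) : Matrix ι ι ℂ) =
      (matrixAd (X : Matrix ι ι ℂ) ^ n) Y := by
    intro Y
    induction n with
    | zero => simp
    | succ n ih =>
      rw [pow_succ', pow_succ', Module.End.mul_apply, Module.End.mul_apply, ← ih]
      rfl
  have e : (matrixAd (X : Matrix ι ι ℂ) ^ n) ∘ₗ (g.incl : g →ₗ[ℂ] Matrix ι ι ℂ) ∘ₗ p =
      ((g.incl : g →ₗ[ℂ] Matrix ι ι ℂ) ∘ₗ (LieAlgebra.ad ℂ g X ^ n)) ∘ₗ p := by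
    refine LinearMap.ext fun Y => (h (p Y)).symm
  rw [e, LinearMap.trace_comp_comm']
  congr 1
  refine LinearMap.ext fun Y => ?_
  exact (hp _).symm

/-- The operators ad(σX) and ad X are conjugate by σ. This is the source of invariants for an
abstract automorphism. -/
theorem trace_ad_pow_map (σ : g ≃ₗ⁅ℂ⁆ g) (X : g) (n : ℕ) :
    LinearMap.trace ℂ g (LieAlgebra.ad ℂ g (σ X) ^ n) =
      LinearMap.trace ℂ g (LieAlgebra.ad ℂ g X ^ n) := by
  rw [← LieAlgebra.conj_ad_apply σ X,
      ← LinearMap.trace_conj' (LieAlgebra.ad ℂ g X ^ n) σ.toLinearEquiv]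
  congr 1
  exact (map_pow (LinearEquiv.conjAlgEquiv ℂ σ.toLinearEquiv) _ n).symm

end AdjointTraces

/-! ## Automorphisms and the trace form -/

section TraceForm

variable {ι : Type*} [Fintype ι] [DecidableEq ι]

/-- `σ` preserves the trace form. -/
def PreservesTraceForm {g : LieSubalgebra ℂ (Matrix ι ι ℂ)} (σ : g → g) : Prop :=
  ∀ X Y : g, ((σ X : Matrix ι ι ℂ) * (σ Y : Matrix ι ι ℂ)).trace =
    ((X : Matrix ι ι ℂ) * (Y : Matrix ι ι ℂ)).trace

/-- `σ` preserves the cubes which belong to the Lie algebra. -/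
def PreservesCubes {g : LieSubalgebra ℂ (Matrix ι ι ℂ)} (σ : g → g) : Prop :=
  ∀ X Y : g, (Y : Matrix ι ι ℂ) = (X : Matrix ι ι ℂ) ^ 3 →
    (σ Y : Matrix ι ι ℂ) = (σ X : Matrix ι ι ℂ) ^ 3

variable {g : LieSubalgebra ℂ (Matrix ι ι ℂ)}

theorem preservesTraceForm_of_trace_sq (σ : g ≃ₗ⁅ℂ⁆ g)
    (h : ∀ X : g, ((σ X : Matrix ι ι ℂ) ^ 2).trace = ((X : Matrix ι ι ℂ) ^ 2).trace) :
    PreservesTraceForm σ := by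
  have key : ∀ A B : Matrix ι ι ℂ, ((A + B) ^ 2).trace = (A ^ 2).trace + (B ^ 2).trace
      + 2 * (A * B).trace := by
    intro A B
    have : (A + B) ^ 2 = A ^ 2 + B ^ 2 + A * B + B * A := by noncomm_ring
    rw [this, Matrix.trace_add, Matrix.trace_add, Matrix.trace_add, Matrix.trace_mul_comm B A]
    ring
  intro X Y
  have h1 := h (X + Y)
  rw [map_add, AddMemClass.coe_add, AddMemClass.coe_add, key, key, h, h] at h1
  linear_combination h1 / 2

/-- Polarisation: Tr(X³Y) is, up to a factor, the coefficient linear in s of Tr(X + sY)⁴. -/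
theorem trace_cube_mul_of_trace_pow_four (σ : g ≃ₗ⁅ℂ⁆ g)
    (h : ∀ X : g, ((σ X : Matrix ι ι ℂ) ^ 4).trace = ((X : Matrix ι ι ℂ) ^ 4).trace)
    (X Y : g) : ((σ X : Matrix ι ι ℂ) ^ 3 * (σ Y : Matrix ι ι ℂ)).trace =
      ((X : Matrix ι ι ℂ) ^ 3 * (Y : Matrix ι ι ℂ)).trace := by
  have key : ∀ (A B : Matrix ι ι ℂ) (s : ℂ), ((A + s • B) ^ 4).trace - ((A - s • B) ^ 4).trace =
      8 * s * (A ^ 3 * B).trace + 8 * s ^ 3 * (B ^ 3 * A).trace := by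
    intro A B s
    have e : (A + s • B) ^ 4 - (A - s • B) ^ 4 =
        (2 * s) • (A ^ 3 * B + A ^ 2 * B * A + A * (B * A ^ 2) + B * A ^ 3) +
        (2 * s ^ 3) • (B ^ 3 * A + B ^ 2 * A * B + B * (A * B ^ 2) + A * B ^ 3) := by
      simp only [pow_succ, pow_zero, one_mul, mul_add, add_mul, mul_sub, sub_mul, smul_mul_assoc,
        mul_smul_comm, smul_smul, smul_add, smul_sub, mul_assoc]
      module
    have cyc : ∀ A B : Matrix ι ι ℂ, (A ^ 2 * B * A).trace = (A ^ 3 * B).trace ∧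
        (A * (B * A ^ 2)).trace = (A ^ 3 * B).trace ∧ (B * A ^ 3).trace = (A ^ 3 * B).trace := by
      intro A B
      refine ⟨?_, ?_, Matrix.trace_mul_comm _ _⟩
      · rw [Matrix.trace_mul_comm, ← mul_assoc, ← pow_succ']
      · rw [← mul_assoc, Matrix.trace_mul_comm, ← mul_assoc, ← pow_succ]
    rw [← Matrix.trace_sub, e]
    simp only [Matrix.trace_add, Matrix.trace_smul, smul_eq_mul, (cyc A B).1, (cyc A B).2.1,
      (cyc A B).2.2, (cyc B A).1, (cyc B A).2.1, (cyc B A).2.2]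
    ring
  have h' : ∀ s : ℂ, 8 * s * ((σ X : Matrix ι ι ℂ) ^ 3 * (σ Y : Matrix ι ι ℂ)).trace +
      8 * s ^ 3 * ((σ Y : Matrix ι ι ℂ) ^ 3 * (σ X : Matrix ι ι ℂ)).trace =
      8 * s * ((X : Matrix ι ι ℂ) ^ 3 * (Y : Matrix ι ι ℂ)).trace +
      8 * s ^ 3 * ((Y : Matrix ι ι ℂ) ^ 3 * (X : Matrix ι ι ℂ)).trace := by
    intro s
    have h1 := h (X + s • Y)
    have h2 := h (X - s • Y)
    simp only [map_add, map_sub, map_smul, AddMemClass.coe_add, AddSubgroupClass.coe_sub,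
      SetLike.val_smul] at h1 h2
    rw [← key, ← key, h1, h2]
  -- The values s = 1, 2 separate s from s³: 8/6 - 16/48 = 1 and 8/6 - 64/48 = 0.
  linear_combination h' 1 / 6 - h' 2 / 48

/-- Both (σX)³ and σ(X³) have the same trace pairing with every σW, namely Tr(X³W), and the form is
nondegenerate. -/
theorem preservesCubes_of_trace_pow_four (σ : g ≃ₗ⁅ℂ⁆ g)
    (nondeg : ∀ Z : g, (∀ Y : g, ((Z : Matrix ι ι ℂ) * (Y : Matrix ι ι ℂ)).trace = 0) → Z = 0)
    (cube : ∀ X : g, (X : Matrix ι ι ℂ) ^ 3 ∈ g)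
    (h2 : PreservesTraceForm σ)
    (h : ∀ X : g, ((σ X : Matrix ι ι ℂ) ^ 4).trace = ((X : Matrix ι ι ℂ) ^ 4).trace) :
    PreservesCubes σ := by
  intro X Y hY
  have : (⟨_, cube (σ X)⟩ - σ Y : g) = 0 := by
    refine nondeg _ fun W => ?_
    obtain ⟨W, rfl⟩ : ∃ V, σ V = W := σ.surjective W
    have h3 := trace_cube_mul_of_trace_pow_four σ h X W
    rw [AddSubgroupClass.coe_sub, sub_mul, Matrix.trace_sub, h2, h3, hY, sub_self]
  exact (congrArg Subtype.val (sub_eq_zero.1 this)).symm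

end TraceForm

/-! ### Orthogonal and symplectic Lie algebras: trace form and cubes -/

section SkewAdjoint

variable {ι : Type*} [Fintype ι] [DecidableEq ι]

/-- `J` is the matrix of a nondegenerate symmetric (`ε = 1`) or skew-symmetric (`ε = -1`) form,
with inverse `K`. -/
structure IsFormMatrix (J K : Matrix ι ι ℂ) (ε : ℂ) : Prop where
  mul_inv : J * K = 1
  inv_mul : K * J = 1
  transpose_eq : J.transpose = ε • J
  transpose_inv : K.transpose = ε • K
  sq_eq : ε * ε = 1

variable {J K : Matrix ι ι ℂ} {ε : ℂ}

theorem mem_skewAdjoint_iff {X : Matrix ι ι ℂ} :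
    X ∈ skewAdjointMatricesLieSubalgebra J ↔ X.transpose * J = -(J * X) := by
  rw [mem_skewAdjointMatricesLieSubalgebra, mem_skewAdjointMatricesSubmodule, Matrix.IsSkewAdjoint,
    Matrix.IsAdjointPair, mul_neg]

theorem transpose_pow_mul_of_mem {X : Matrix ι ι ℂ}
    (hX : X ∈ skewAdjointMatricesLieSubalgebra J) (k : ℕ) :
    (X ^ k).transpose * J = (-1 : ℂ) ^ k • (J * X ^ k) := by
  rw [mem_skewAdjoint_iff] at hX
  induction k with
  | zero => simp
  | succ k ih =>
    rw [pow_succ, Matrix.transpose_mul, mul_assoc, ih, mul_smul_comm, ← mul_assoc, hX, pow_succ,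
      neg_mul, mul_smul, neg_one_smul, mul_assoc]
    congr 3
    rw [← pow_succ', pow_succ]

theorem odd_pow_mem_skewAdjoint {X : Matrix ι ι ℂ}
    (hX : X ∈ skewAdjointMatricesLieSubalgebra J) {k : ℕ} (hk : Odd k) :
    X ^ k ∈ skewAdjointMatricesLieSubalgebra J := by
  rw [mem_skewAdjoint_iff, transpose_pow_mul_of_mem hX, hk.neg_one_pow, neg_one_smul]

namespace IsFormMatrix

variable (hJ : IsFormMatrix J K ε)
include hJ

/-- The map Y ↦ K Yᵀ J is an anti-automorphism of the matrix algebra acting as -1 on the Lie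
algebra, hence as (-1)ᵏ on k-th powers. -/
theorem inv_mul_transpose_mul {X : Matrix ι ι ℂ}
    (hX : X ∈ skewAdjointMatricesLieSubalgebra J) (k : ℕ) :
    K * (X ^ k).transpose * J = (-1 : ℂ) ^ k • X ^ k := by
  rw [mul_assoc, transpose_pow_mul_of_mem hX, mul_smul_comm, ← mul_assoc, hJ.inv_mul, one_mul]

theorem trace_odd_pow {X : Matrix ι ι ℂ} (hX : X ∈ skewAdjointMatricesLieSubalgebra J) {k : ℕ}
    (hk : Odd k) : (X ^ k).trace = 0 := by
  have h := congrArg Matrix.trace (hJ.inv_mul_transpose_mul hX k)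
  rw [Matrix.trace_mul_comm, ← mul_assoc, hJ.mul_inv, one_mul, Matrix.trace_transpose,
    Matrix.trace_smul, hk.neg_one_pow, smul_eq_mul] at h
  linear_combination h / 2

omit hJ in
theorem _root_.half_sub_mem_skewAdjoint (hJ : IsFormMatrix J K ε) (Y : Matrix ι ι ℂ) :
    (1 / 2 : ℂ) • (Y - K * Y.transpose * J) ∈ skewAdjointMatricesLieSubalgebra J := by
  rw [mem_skewAdjoint_iff]
  simp only [Matrix.transpose_smul, Matrix.transpose_sub, Matrix.transpose_mul,
    Matrix.transpose_transpose, hJ.transpose_eq, hJ.transpose_inv, smul_mul_assoc, mul_smul_comm,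
    smul_smul, hJ.sq_eq, one_smul, sub_mul, mul_sub, ← mul_assoc, hJ.mul_inv, one_mul]
  rw [mul_assoc (J * Y), hJ.inv_mul, mul_one, ← smul_neg, neg_sub]

/-- The orthogonal projection onto the skew-adjoint matrices. -/
def proj : Matrix ι ι ℂ →ₗ[ℂ] skewAdjointMatricesLieSubalgebra J where
  toFun Y := ⟨_, half_sub_mem_skewAdjoint hJ Y⟩
  map_add' X Y := by
    refine Subtype.ext ?_
    change (1 / 2 : ℂ) • _ = (1 / 2 : ℂ) • _ + (1 / 2 : ℂ) • _
    rw [Matrix.transpose_add, ← smul_add, mul_add, add_mul]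
    abel_nf
  map_smul' c X := by
    refine Subtype.ext ?_
    change (1 / 2 : ℂ) • _ = c • (1 / 2 : ℂ) • _
    rw [Matrix.transpose_smul, mul_smul_comm, smul_mul_assoc, ← smul_sub, smul_comm]

theorem coe_proj (Y : Matrix ι ι ℂ) :
    (hJ.proj Y : Matrix ι ι ℂ) = (1 / 2 : ℂ) • (Y - K * Y.transpose * J) := rfl

theorem proj_coe (X : skewAdjointMatricesLieSubalgebra J) : hJ.proj X = X := by
  refine Subtype.ext ?_
  have := hJ.inv_mul_transpose_mul X.2 1
  rw [pow_one, pow_one, neg_one_smul] at this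
  rw [coe_proj, this]
  module

/-- The projection is half of the identity minus Y ↦ K Yᵀ J. The identity yields a product of
traces, the transposition a single trace. -/
theorem trace_leftRight_comp_proj (A : Matrix ι ι ℂ) {X : Matrix ι ι ℂ}
    (hX : X ∈ skewAdjointMatricesLieSubalgebra J) (k : ℕ) :
    LinearMap.trace ℂ _ ((leftRight A (X ^ k)) ∘ₗ
      ((skewAdjointMatricesLieSubalgebra J).incl : _ →ₗ[ℂ] Matrix ι ι ℂ) ∘ₗ hJ.proj) =
      (A.trace * (X ^ k).trace - ε * (-1) ^ k * (A * X ^ k).trace) / 2 := by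
  have e : (leftRight A (X ^ k)) ∘ₗ
      ((skewAdjointMatricesLieSubalgebra J).incl : _ →ₗ[ℂ] Matrix ι ι ℂ) ∘ₗ hJ.proj =
      (1 / 2 : ℂ) • (leftRight A (X ^ k) - leftRight (A * K) (J * X ^ k) ∘ₗ
        Matrix.transposeLinearEquiv ι ι ℂ ℂ) := by
    refine LinearMap.ext fun Y => ?_
    change A * ((1 / 2 : ℂ) • (Y - K * Y.transpose * J) * X ^ k) =
      (1 / 2 : ℂ) • (A * (Y * X ^ k) - A * K * (Y.transpose * (J * X ^ k)))
    rw [smul_mul_assoc, mul_smul_comm, sub_mul, mul_sub]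
    simp only [mul_assoc]
  rw [e, map_smul, map_sub, trace_leftRight, trace_leftRight_comp_transpose, Matrix.transpose_mul,
    hJ.transpose_eq, mul_smul_comm, mul_smul_comm, mul_assoc, ← mul_assoc K,
    hJ.inv_mul_transpose_mul hX, mul_smul_comm, Matrix.trace_smul, Matrix.trace_smul, smul_eq_mul,
    smul_eq_mul, smul_eq_mul]
  ring

theorem trace_ad_pow_two (X : skewAdjointMatricesLieSubalgebra J) :
    LinearMap.trace ℂ _ (LieAlgebra.ad ℂ _ X ^ 2) =
      ((Fintype.card ι : ℂ) - 2 * ε) * ((X : Matrix ι ι ℂ) ^ 2).trace := by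
  have h1 := hJ.trace_odd_pow X.2 (k := 1) (by decide)
  have h := fun A k => hJ.trace_leftRight_comp_proj A X.2 k
  have h' := h 1 2
  have h'' := h ((X : Matrix ι ι ℂ) ^ 2) 0
  have h''' := h (X : Matrix ι ι ℂ) 1
  simp only [pow_one, pow_zero, one_mul, mul_one, Matrix.trace_one, ← pow_two] at h' h'' h''' h1
  rw [trace_ad_pow_eq hJ.proj hJ.proj_coe, matrixAd_pow_two]
  simp only [LinearMap.add_comp, LinearMap.sub_comp, LinearMap.smul_comp, map_add, map_sub,
    map_smul, smul_eq_mul]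
  rw [h', h'', h''', h1]
  ring

/-- Together with the invariance of Tr X², this makes Tr X⁴ invariant unless N = 8ε, which among the
classical types happens only for so(8). -/
theorem trace_ad_pow_four (X : skewAdjointMatricesLieSubalgebra J) :
    LinearMap.trace ℂ _ (LieAlgebra.ad ℂ _ X ^ 4) =
      ((Fintype.card ι : ℂ) - 8 * ε) * ((X : Matrix ι ι ℂ) ^ 4).trace +
        3 * ((X : Matrix ι ι ℂ) ^ 2).trace ^ 2 := by
  have h1 := hJ.trace_odd_pow X.2 (k := 1) (by decide)
  have h := fun A k => hJ.trace_leftRight_comp_proj A X.2 k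
  have e0 := h 1 4
  have e1 := h (X : Matrix ι ι ℂ) 3
  have e2 := h ((X : Matrix ι ι ℂ) ^ 2) 2
  have e3 := h ((X : Matrix ι ι ℂ) ^ 3) 1
  have e4 := h ((X : Matrix ι ι ℂ) ^ 4) 0
  rw [← pow_add] at e2
  rw [← pow_succ'] at e1
  simp only [pow_one, pow_zero, one_mul, mul_one, Matrix.trace_one, ← pow_succ] at e0 e1 e2 e3 e4 h1
  rw [trace_ad_pow_eq hJ.proj hJ.proj_coe, matrixAd_pow_four]
  simp only [LinearMap.add_comp, LinearMap.sub_comp, LinearMap.smul_comp, map_add, map_sub,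
    map_smul, smul_eq_mul]
  rw [e0, e1, e2, e3, e4, h1]
  norm_num
  ring

theorem trace_mul_proj (Z : skewAdjointMatricesLieSubalgebra J) (Y : Matrix ι ι ℂ) :
    ((Z : Matrix ι ι ℂ) * (hJ.proj Y : Matrix ι ι ℂ)).trace = ((Z : Matrix ι ι ℂ) * Y).trace := by
  have e : ((Z : Matrix ι ι ℂ) * (K * Y.transpose * J)).trace =
      -((Z : Matrix ι ι ℂ) * Y).trace := by
    have hZ := mem_skewAdjoint_iff.1 Z.2
    rw [← mul_assoc, Matrix.trace_mul_comm, ← mul_assoc, ← neg_eq_iff_eq_neg.2 hZ, neg_mul,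
      ← mul_assoc, mul_assoc _ J K, hJ.mul_inv, mul_one, ← Matrix.transpose_mul, Matrix.trace_neg,
      Matrix.trace_transpose, Matrix.trace_mul_comm]
  rw [coe_proj, mul_smul_comm, mul_sub, Matrix.trace_smul, Matrix.trace_sub, e, smul_eq_mul]
  ring

theorem trace_form_nondegenerate (Z : skewAdjointMatricesLieSubalgebra J)
    (h : ∀ Y : skewAdjointMatricesLieSubalgebra J,
      ((Z : Matrix ι ι ℂ) * (Y : Matrix ι ι ℂ)).trace = 0) : Z = 0 := by
  refine Subtype.ext ?_
  rw [Matrix.ext_iff_trace_mul_right]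
  intro Y
  rw [← hJ.trace_mul_proj, h]
  simp

theorem preservesTraceForm (hN : (Fintype.card ι : ℂ) ≠ 2 * ε)
    (σ : skewAdjointMatricesLieSubalgebra J ≃ₗ⁅ℂ⁆ skewAdjointMatricesLieSubalgebra J) :
    PreservesTraceForm σ := by
  refine preservesTraceForm_of_trace_sq σ fun X => ?_
  have := trace_ad_pow_map σ X 2
  rw [hJ.trace_ad_pow_two, hJ.trace_ad_pow_two] at this
  exact mul_left_cancel₀ (sub_ne_zero.2 hN) this

theorem preservesCubes (hN : (Fintype.card ι : ℂ) ≠ 2 * ε) (hN' : (Fintype.card ι : ℂ) ≠ 8 * ε)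
    (σ : skewAdjointMatricesLieSubalgebra J ≃ₗ⁅ℂ⁆ skewAdjointMatricesLieSubalgebra J) :
    PreservesCubes σ := by
  refine preservesCubes_of_trace_pow_four σ hJ.trace_form_nondegenerate
    (fun X => odd_pow_mem_skewAdjoint X.2 (by decide)) (hJ.preservesTraceForm hN σ) fun X => ?_
  have h2 := hJ.preservesTraceForm hN σ X X
  rw [← pow_two, ← pow_two] at h2
  have := trace_ad_pow_map σ X 4
  rw [hJ.trace_ad_pow_four, hJ.trace_ad_pow_four, h2] at this
  exact mul_left_cancel₀ (sub_ne_zero.2 hN') (add_right_cancel this)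

end IsFormMatrix

theorem isFormMatrix_one : IsFormMatrix (1 : Matrix ι ι ℂ) 1 1 :=
  ⟨by simp, by simp, by simp, by simp, by simp⟩

theorem isFormMatrix_J : IsFormMatrix (Matrix.J ι ℂ) (-Matrix.J ι ℂ) (-1) :=
  ⟨by simp [Matrix.J_squared], by simp [Matrix.J_squared], by simp [Matrix.J_transpose],
    by simp [Matrix.J_transpose], by simp⟩

end SkewAdjoint

/-- Outside type `A`, the automorphisms which are not special preserve the trace form and
the cubes. -/
theorem ClassicalType.preserves_of_skewAdjoint (t : ClassicalType) (ht : t.IsSimpleType)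
    (σ : t.alg ≃ₗ⁅ℂ⁆ t.alg) (hσ : t.NotSpecialD4 σ) (hA : ∀ d, t ≠ .A d) :
    PreservesTraceForm σ ∧ PreservesCubes σ := by
  match t with
  | .A d => exact absurd rfl (hA d)
  | .BD d =>
    obtain ⟨h3, h4⟩ := ht
    have h2 : (Fintype.card (Fin d) : ℂ) ≠ 2 * 1 := by
      rw [Fintype.card_fin]; norm_cast; omega
    -- In dimension 8 the coefficient of Tr X⁴ in Tr ad(X)⁴ vanishes, so cubes are handled by the
    -- given orthogonal conjugation.
    by_cases h8 : d = 8
    · obtain ⟨Q, hQ, h⟩ := hσ h8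
      refine ⟨isFormMatrix_one.preservesTraceForm h2 σ, fun X Y hY => ?_⟩
      have hQ' : Q.transpose * Q = 1 := mul_eq_one_comm.1 hQ
      rw [h, h, hY]
      have : ∀ A B : Matrix (Fin d) (Fin d) ℂ, Q * A * Q.transpose * (Q * B * Q.transpose) =
          Q * (A * B) * Q.transpose := by
        intro A B
        rw [mul_assoc (Q * A), ← mul_assoc Q.transpose, ← mul_assoc Q.transpose, hQ', one_mul]
        simp only [mul_assoc]
      rw [pow_three, pow_three]
      change _ = (Q * _ * Q.transpose) * ((Q * _ * Q.transpose) * (Q * _ * Q.transpose))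
      rw [this, this]
    · have h8' : (Fintype.card (Fin d) : ℂ) ≠ 8 * 1 := by
        rw [Fintype.card_fin]; exact_mod_cast h8
      exact ⟨isFormMatrix_one.preservesTraceForm h2 σ, isFormMatrix_one.preservesCubes h2 h8' σ⟩
  | .C l =>
    have h2 : (Fintype.card (Fin l ⊕ Fin l) : ℂ) ≠ 2 * -1 := by
      intro h
      have h' : ((Fintype.card (Fin l ⊕ Fin l) + 2 : ℕ) : ℂ) = 0 := by push_cast [h]; norm_num
      exact absurd (Nat.cast_eq_zero.1 h') (by omega)
    have h8 : (Fintype.card (Fin l ⊕ Fin l) : ℂ) ≠ 8 * -1 := by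
      intro h
      have h' : ((Fintype.card (Fin l ⊕ Fin l) + 8 : ℕ) : ℂ) = 0 := by push_cast [h]; norm_num
      exact absurd (Nat.cast_eq_zero.1 h') (by omega)
    exact ⟨isFormMatrix_J.preservesTraceForm h2 σ, isFormMatrix_J.preservesCubes h2 h8 σ⟩

/-! ## Automorphisms in type `A` -/

namespace SpecialLinearAut

open LieAlgebra.SpecialLinear

variable {ι : Type*} [Fintype ι] [DecidableEq ι]

theorem mem_sl_iff {X : Matrix ι ι ℂ} : X ∈ sl ι ℂ ↔ X.trace = 0 := Iff.rfl

theorem trace_coe (X : sl ι ℂ) : (X : Matrix ι ι ℂ).trace = 0 := X.2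

variable [Nonempty ι]

omit [DecidableEq ι] in
theorem card_ne_zero' : (Fintype.card ι : ℂ) ≠ 0 := Nat.cast_ne_zero.2 Fintype.card_ne_zero

theorem sub_trace_mem (Y : Matrix ι ι ℂ) :
    Y - (Y.trace / (Fintype.card ι : ℂ)) • (1 : Matrix ι ι ℂ) ∈ sl ι ℂ := by
  rw [mem_sl_iff, Matrix.trace_sub, Matrix.trace_smul, Matrix.trace_one, smul_eq_mul,
    div_mul_cancel₀ _ card_ne_zero', sub_self]

/-- The traceless part of a matrix. -/
def proj : Matrix ι ι ℂ →ₗ[ℂ] sl ι ℂ where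
  toFun Y := ⟨_, sub_trace_mem Y⟩
  map_add' X Y := by
    refine Subtype.ext ?_
    change _ - _ = (_ - _) + (_ - _)
    rw [Matrix.trace_add]
    module
  map_smul' c X := by
    refine Subtype.ext ?_
    change _ - _ = c • (_ - _)
    rw [Matrix.trace_smul, smul_eq_mul]
    module

theorem coe_proj (Y : Matrix ι ι ℂ) :
    (proj Y : Matrix ι ι ℂ) = Y - (Y.trace / (Fintype.card ι : ℂ)) • (1 : Matrix ι ι ℂ) := rfl

theorem proj_coe (X : sl ι ℂ) : proj (X : Matrix ι ι ℂ) = X := by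
  refine Subtype.ext ?_
  rw [coe_proj, trace_coe, zero_div, zero_smul, sub_zero]

theorem trace_leftRight_comp_proj (A B : Matrix ι ι ℂ) :
    LinearMap.trace ℂ _ ((leftRight A B) ∘ₗ ((sl ι ℂ).incl : _ →ₗ[ℂ] Matrix ι ι ℂ) ∘ₗ proj) =
      A.trace * B.trace - (A * B).trace / (Fintype.card ι : ℂ) := by
  have e : (leftRight A B) ∘ₗ ((sl ι ℂ).incl : _ →ₗ[ℂ] Matrix ι ι ℂ) ∘ₗ proj =
      leftRight A B - (1 / (Fintype.card ι : ℂ)) •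
        (Matrix.traceLinearMap ι ℂ ℂ).smulRight (A * B) := by
    refine LinearMap.ext fun Y => ?_
    change A * ((Y - (Y.trace / (Fintype.card ι : ℂ)) • (1 : Matrix ι ι ℂ)) * B) =
      A * (Y * B) - (1 / (Fintype.card ι : ℂ)) • (Y.trace • (A * B))
    rw [sub_mul, mul_sub, smul_mul_assoc, one_mul, mul_smul_comm, smul_smul, one_div_mul_eq_div]
  rw [e, map_sub, map_smul, trace_leftRight, trace_smulRight_trace, smul_eq_mul,
    one_div_mul_eq_div]

theorem trace_ad_pow_two (X : sl ι ℂ) : LinearMap.trace ℂ _ (LieAlgebra.ad ℂ _ X ^ 2) =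
    2 * (Fintype.card ι : ℂ) * ((X : Matrix ι ι ℂ) ^ 2).trace := by
  rw [trace_ad_pow_eq proj proj_coe, matrixAd_pow_two]
  simp only [LinearMap.add_comp, LinearMap.sub_comp, LinearMap.smul_comp, map_add, map_sub,
    map_smul, smul_eq_mul, trace_leftRight_comp_proj, trace_coe, ← pow_two, one_mul, mul_one,
    Matrix.trace_one]
  ring

theorem trace_ad_pow_four (X : sl ι ℂ) : LinearMap.trace ℂ _ (LieAlgebra.ad ℂ _ X ^ 4) =
    2 * (Fintype.card ι : ℂ) * ((X : Matrix ι ι ℂ) ^ 4).trace +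
      6 * ((X : Matrix ι ι ℂ) ^ 2).trace ^ 2 := by
  rw [trace_ad_pow_eq proj proj_coe, matrixAd_pow_four]
  simp only [LinearMap.add_comp, LinearMap.sub_comp, LinearMap.smul_comp, map_add, map_sub,
    map_smul, smul_eq_mul, trace_leftRight_comp_proj, trace_coe, ← pow_succ, ← pow_succ',
    ← pow_add, one_mul, mul_one, Matrix.trace_one, Nat.reduceAdd]
  ring

/-- Here Tr X³ enters, and only through its square. The sign left open distinguishes conjugations
from conjugations composed with X ↦ -Xᵀ. -/
theorem trace_ad_pow_six (X : sl ι ℂ) : LinearMap.trace ℂ _ (LieAlgebra.ad ℂ _ X ^ 6) =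
    2 * (Fintype.card ι : ℂ) * ((X : Matrix ι ι ℂ) ^ 6).trace +
      30 * ((X : Matrix ι ι ℂ) ^ 2).trace * ((X : Matrix ι ι ℂ) ^ 4).trace -
      20 * ((X : Matrix ι ι ℂ) ^ 3).trace ^ 2 := by
  rw [trace_ad_pow_eq proj proj_coe, matrixAd_pow_six]
  simp only [LinearMap.add_comp, LinearMap.sub_comp, LinearMap.smul_comp, map_add, map_sub,
    map_smul, smul_eq_mul, trace_leftRight_comp_proj, trace_coe, ← pow_succ, ← pow_succ',
    ← pow_add, one_mul, mul_one, Matrix.trace_one, Nat.reduceAdd]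
  ring

variable (σ : sl ι ℂ ≃ₗ⁅ℂ⁆ sl ι ℂ)

theorem preservesTraceForm : PreservesTraceForm σ := by
  refine preservesTraceForm_of_trace_sq σ fun X => ?_
  have := trace_ad_pow_map σ X 2
  rw [trace_ad_pow_two, trace_ad_pow_two] at this
  exact mul_left_cancel₀ (mul_ne_zero two_ne_zero card_ne_zero') this

theorem trace_pow_four_map (X : sl ι ℂ) :
    ((σ X : Matrix ι ι ℂ) ^ 4).trace = ((X : Matrix ι ι ℂ) ^ 4).trace := by
  have h2 := preservesTraceForm σ X X
  rw [← pow_two, ← pow_two] at h2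
  have := trace_ad_pow_map σ X 4
  rw [trace_ad_pow_four, trace_ad_pow_four, h2] at this
  exact mul_left_cancel₀ (mul_ne_zero two_ne_zero card_ne_zero') (add_right_cancel this)

theorem eq_of_trace_mul_eq {A B : Matrix ι ι ℂ} (htr : A.trace = B.trace)
    (h : ∀ Y : sl ι ℂ, (A * (Y : Matrix ι ι ℂ)).trace = (B * (Y : Matrix ι ι ℂ)).trace) :
    A = B := by
  rw [Matrix.ext_iff_trace_mul_right]
  intro Y
  have := h (proj Y)
  rw [coe_proj, mul_sub, mul_sub, mul_smul_comm, mul_smul_comm, mul_one, mul_one,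
    Matrix.trace_sub, Matrix.trace_sub, Matrix.trace_smul, Matrix.trace_smul, htr] at this
  exact sub_left_injective this

/-- Cubes need not be traceless, so σ acts on their traceless part. Both sides have the same trace
and the same pairing with `sl`. -/
theorem cube_map (X : sl ι ℂ) : (σ X : Matrix ι ι ℂ) ^ 3 =
    (σ (proj ((X : Matrix ι ι ℂ) ^ 3)) : Matrix ι ι ℂ) +
      (((σ X : Matrix ι ι ℂ) ^ 3).trace / (Fintype.card ι : ℂ)) • (1 : Matrix ι ι ℂ) := by
  refine eq_of_trace_mul_eq ?_ fun Y => ?_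
  · rw [Matrix.trace_add, trace_coe, Matrix.trace_smul, Matrix.trace_one, smul_eq_mul,
      div_mul_cancel₀ _ card_ne_zero', zero_add]
  · obtain ⟨Y, rfl⟩ : ∃ Z, σ Z = Y := σ.surjective Y
    rw [trace_cube_mul_of_trace_pow_four σ (trace_pow_four_map σ), add_mul, Matrix.trace_add,
      preservesTraceForm σ, coe_proj, sub_mul, smul_mul_assoc, smul_mul_assoc, one_mul, one_mul,
      Matrix.trace_sub, Matrix.trace_smul, Matrix.trace_smul, trace_coe, trace_coe, smul_zero,
      smul_zero, sub_zero, add_zero]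

/-- Squaring the decomposition of the cube writes Tr X⁶ as an invariant plus (Tr X³)²/N. Inserted in
Tr ad(X)⁶, this isolates (Tr X³)². -/
theorem sq_trace_cube_map (X : sl ι ℂ) :
    ((σ X : Matrix ι ι ℂ) ^ 3).trace ^ 2 = ((X : Matrix ι ι ℂ) ^ 3).trace ^ 2 := by
  have hN := card_ne_zero' (ι := ι)
  set N := (Fintype.card ι : ℂ) with hNdef
  have key : ∀ (Z : sl ι ℂ) (c : ℂ),
      (((Z : Matrix ι ι ℂ) + (c / N) • (1 : Matrix ι ι ℂ)) ^ 2).trace =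
        ((Z : Matrix ι ι ℂ) * (Z : Matrix ι ι ℂ)).trace + c ^ 2 / N := by
    intro Z c
    have : ((Z : Matrix ι ι ℂ) + (c / N) • (1 : Matrix ι ι ℂ)) ^ 2 =
        (Z : Matrix ι ι ℂ) * (Z : Matrix ι ι ℂ) + (2 * (c / N)) • (Z : Matrix ι ι ℂ) +
          ((c / N) ^ 2) • (1 : Matrix ι ι ℂ) := by
      simp only [pow_two, mul_add, add_mul, smul_mul_assoc, mul_smul_comm, one_mul, mul_one,
        smul_add, smul_smul]
      module
    rw [this, Matrix.trace_add, Matrix.trace_add, Matrix.trace_smul, Matrix.trace_smul, trace_coe,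
      Matrix.trace_one, smul_eq_mul, smul_eq_mul, ← hNdef]
    field_simp
    ring
  have h1 : ((σ X : Matrix ι ι ℂ) ^ 6).trace =
      ((proj ((X : Matrix ι ι ℂ) ^ 3) : Matrix ι ι ℂ) *
        (proj ((X : Matrix ι ι ℂ) ^ 3) : Matrix ι ι ℂ)).trace +
        ((σ X : Matrix ι ι ℂ) ^ 3).trace ^ 2 / N := by
    have := key (σ (proj ((X : Matrix ι ι ℂ) ^ 3))) ((σ X : Matrix ι ι ℂ) ^ 3).trace
    rwa [← cube_map, ← pow_mul, preservesTraceForm σ] at this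
  have h2 : ((X : Matrix ι ι ℂ) ^ 6).trace =
      ((proj ((X : Matrix ι ι ℂ) ^ 3) : Matrix ι ι ℂ) *
        (proj ((X : Matrix ι ι ℂ) ^ 3) : Matrix ι ι ℂ)).trace +
        ((X : Matrix ι ι ℂ) ^ 3).trace ^ 2 / N := by
    have := key (proj ((X : Matrix ι ι ℂ) ^ 3)) ((X : Matrix ι ι ℂ) ^ 3).trace
    rwa [hNdef, ← sub_eq_iff_eq_add.1 (coe_proj ((X : Matrix ι ι ℂ) ^ 3)).symm, ← pow_mul]
      at this
  have h3 := preservesTraceForm σ X X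
  rw [← pow_two, ← pow_two] at h3
  have h4 := trace_ad_pow_map σ X 6
  rw [trace_ad_pow_six, trace_ad_pow_six, h3, trace_pow_four_map, h1, h2, ← hNdef] at h4
  field_simp at h4
  -- The total coefficient of (Tr X³)² is 2N · (1/N) - 20 = -18.
  linear_combination -h4 / 18

omit [Nonempty ι] in
theorem trace_add_smul_cube (A B : Matrix ι ι ℂ) (s : ℂ) : ((A + s • B) ^ 3).trace =
    (A ^ 3).trace + 3 * (A ^ 2 * B).trace * s + 3 * (B ^ 2 * A).trace * s ^ 2 +
      (B ^ 3).trace * s ^ 3 := by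
  have e : (A + s • B) ^ 3 = A ^ 3 + s • (A ^ 2 * B + A * (B * A) + B * A ^ 2) +
      s ^ 2 • (B ^ 2 * A + B * (A * B) + A * B ^ 2) + s ^ 3 • B ^ 3 := by
    simp only [pow_succ, pow_zero, one_mul, mul_add, add_mul, smul_mul_assoc,
      mul_smul_comm, smul_smul, smul_add, mul_assoc]
    module
  have cyc : ∀ A B : Matrix ι ι ℂ, (A * (B * A)).trace = (A ^ 2 * B).trace ∧
      (B * A ^ 2).trace = (A ^ 2 * B).trace := by
    intro A B
    refine ⟨?_, Matrix.trace_mul_comm _ _⟩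
    rw [← mul_assoc, Matrix.trace_mul_comm, ← mul_assoc, ← pow_two]
  rw [e]
  simp only [Matrix.trace_add, Matrix.trace_smul, smul_eq_mul, (cyc A B).1, (cyc A B).2,
    (cyc B A).1, (cyc B A).2]
  ring

/-- The sign cannot depend on X: along a line X + sY the two cubic polynomials in s have equal
squares, and ℂ[s] is a domain. -/
theorem trace_cube_map_dichotomy :
    (∀ X, ((σ X : Matrix ι ι ℂ) ^ 3).trace = ((X : Matrix ι ι ℂ) ^ 3).trace) ∨
    (∀ X, ((σ X : Matrix ι ι ℂ) ^ 3).trace = -((X : Matrix ι ι ℂ) ^ 3).trace) := by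
  by_contra! h
  obtain ⟨⟨X, hX⟩, Y, hY⟩ := h
  have c0 : ∀ a b c d : ℂ, (Polynomial.C a + Polynomial.C b * Polynomial.X +
      Polynomial.C c * Polynomial.X ^ 2 + Polynomial.C d * Polynomial.X ^ 3).coeff 0 = a := by
    intro a b c d
    simp
  have c3 : ∀ a b c d : ℂ, (Polynomial.C a + Polynomial.C b * Polynomial.X +
      Polynomial.C c * Polynomial.X ^ 2 + Polynomial.C d * Polynomial.X ^ 3).coeff 3 = d := by
    intro a b c d
    simp
  let f : Matrix ι ι ℂ → Matrix ι ι ℂ → ℂ[X] := fun A B =>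
    Polynomial.C (A ^ 3).trace + Polynomial.C (3 * (A ^ 2 * B).trace) * Polynomial.X +
      Polynomial.C (3 * (B ^ 2 * A).trace) * Polynomial.X ^ 2 +
        Polynomial.C (B ^ 3).trace * Polynomial.X ^ 3
  have f0 : ∀ A B, (f A B).coeff 0 = (A ^ 3).trace := fun A B => c0 _ _ _ _
  have f3 : ∀ A B, (f A B).coeff 3 = (B ^ 3).trace := fun A B => c3 _ _ _ _
  have hf : ∀ A B s, (f A B).eval s = ((A + s • B) ^ 3).trace := by
    intro A B s
    rw [trace_add_smul_cube]
    simp [f]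
  -- Here X violates the sign +1 and Y the sign -1. The constant and leading coefficients detect X
  -- and Y respectively.
  have hprod : (f (σ X) (σ Y) - f X Y) * (f (σ X) (σ Y) + f X Y) = 0 := by
    refine Polynomial.funext fun s => ?_
    have := sq_trace_cube_map σ (X + s • Y)
    simp only [map_add, map_smul, AddMemClass.coe_add, SetLike.val_smul] at this
    simp only [Polynomial.eval_mul, Polynomial.eval_sub, Polynomial.eval_add, hf,
      Polynomial.eval_zero]
    linear_combination this
  rcases mul_eq_zero.1 hprod with h | h
  · have := congrArg (Polynomial.coeff · 0) h
    simp only [Polynomial.coeff_sub, f0, Polynomial.coeff_zero] at this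
    exact hX (sub_eq_zero.1 this)
  · have := congrArg (Polynomial.coeff · 3) h
    simp only [Polynomial.coeff_add, f3, Polynomial.coeff_zero] at this
    exact hY (eq_neg_of_add_eq_zero_left this)

/-- Split XY into symmetric and antisymmetric parts: Tr((XY + YX)Z) polarises the cube and gets the
factor ε, while Tr([X, Y]Z) is invariant. -/
theorem trace_mul_mul_eq (ε : ℂ)
    (h : ∀ X, ((σ X : Matrix ι ι ℂ) ^ 3).trace = ε * ((X : Matrix ι ι ℂ) ^ 3).trace)
    (X Y Z : sl ι ℂ) :
    ((σ X : Matrix ι ι ℂ) * (σ Y : Matrix ι ι ℂ) * (σ Z : Matrix ι ι ℂ)).trace =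
      (1 + ε) / 2 * ((X : Matrix ι ι ℂ) * (Y : Matrix ι ι ℂ) * (Z : Matrix ι ι ℂ)).trace -
      (1 - ε) / 2 * ((Z : Matrix ι ι ℂ) * (Y : Matrix ι ι ℂ) * (X : Matrix ι ι ℂ)).trace := by
  have h2 : ∀ X Y : sl ι ℂ, ((σ X : Matrix ι ι ℂ) ^ 2 * (σ Y : Matrix ι ι ℂ)).trace =
      ε * ((X : Matrix ι ι ℂ) ^ 2 * (Y : Matrix ι ι ℂ)).trace := by
    intro X Y
    have h1 := h (X + (1 : ℂ) • Y)
    have h2 := h (X + (-1 : ℂ) • Y)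
    simp only [map_add, map_smul, AddMemClass.coe_add, SetLike.val_smul, trace_add_smul_cube, h]
      at h1 h2
    linear_combination h1 / 6 - h2 / 6
  have e : ∀ A B : Matrix ι ι ℂ, (A + B) ^ 2 = A ^ 2 + B ^ 2 + A * B + B * A := by
    intro A B; noncomm_ring
  have h3 := h2 (X + Y) Z
  simp only [map_add, AddMemClass.coe_add, e, add_mul, Matrix.trace_add, h2] at h3
  have h4 := preservesTraceForm σ ⁅X, Y⁆ Z
  rw [LieEquiv.map_lie, sl_bracket, sl_bracket, sub_mul, sub_mul, Matrix.trace_sub,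
    Matrix.trace_sub] at h4
  have h5 : ((Z : Matrix ι ι ℂ) * (Y : Matrix ι ι ℂ) * (X : Matrix ι ι ℂ)).trace =
      ((Y : Matrix ι ι ℂ) * (X : Matrix ι ι ℂ) * (Z : Matrix ι ι ℂ)).trace := by
    rw [mul_assoc, Matrix.trace_mul_comm]
  rw [h5]
  linear_combination h3 / 2 + h4 / 2

/-- Linear automorphisms of `sl` preserving `Tr (XY)` and `Tr (XYZ)` are conjugations. -/
theorem exists_conj (f : sl ι ℂ ≃ₗ[ℂ] sl ι ℂ) (hf : PreservesTraceForm f)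
    (hf' : ∀ X Y Z : sl ι ℂ,
      ((f X : Matrix ι ι ℂ) * (f Y : Matrix ι ι ℂ) * (f Z : Matrix ι ι ℂ)).trace =
        ((X : Matrix ι ι ℂ) * (Y : Matrix ι ι ℂ) * (Z : Matrix ι ι ℂ)).trace) :
    ∃ P Q : Matrix ι ι ℂ, P * Q = 1 ∧ ∀ X : sl ι ℂ, (f X : Matrix ι ι ℂ) = P * X * Q := by
  have hN := card_ne_zero' (ι := ι)
  set N := (Fintype.card ι : ℂ) with hNdef
  -- The unital extension of `f` to all matrices.
  let F : Matrix ι ι ℂ →ₗ[ℂ] Matrix ι ι ℂ :=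
    ((sl ι ℂ).incl : _ →ₗ[ℂ] Matrix ι ι ℂ) ∘ₗ f.toLinearMap ∘ₗ proj +
      (1 / N) • (Matrix.traceLinearMap ι ℂ ℂ).smulRight 1
  have hF : ∀ A, F A = (f (proj A) : Matrix ι ι ℂ) + (A.trace / N) • (1 : Matrix ι ι ℂ) := by
    intro A
    change _ + (1 / N) • (A.trace • (1 : Matrix ι ι ℂ)) = _
    rw [smul_smul, one_div_mul_eq_div]
    rfl
  have dec : ∀ A : Matrix ι ι ℂ, A = (proj A : Matrix ι ι ℂ) + (A.trace / N) • (1 : Matrix ι ι ℂ) :=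
    fun A => by rw [coe_proj, sub_add_cancel]
  have hFc : ∀ X : sl ι ℂ, F X = f X := by
    intro X
    rw [hF, proj_coe, trace_coe, zero_div, zero_smul, add_zero]
  have hF1 : F 1 = 1 := by
    have : proj (1 : Matrix ι ι ℂ) = 0 := by
      refine Subtype.ext ?_
      rw [coe_proj, Matrix.trace_one, div_self hN, one_smul, sub_self]
      rfl
    rw [hF, this, map_zero, Matrix.trace_one, div_self hN, one_smul]
    exact zero_add _
  have hsurj : Function.Surjective F := by
    intro B
    refine ⟨(f.symm (proj B) : Matrix ι ι ℂ) + (B.trace / N) • (1 : Matrix ι ι ℂ), ?_⟩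
    rw [map_add, map_smul, hF1, hFc, LinearEquiv.apply_symm_apply]
    exact (dec B).symm
  have h2 : ∀ A B, (F A * F B).trace = (A * B).trace := by
    intro A B
    rw [hF, hF]
    conv_rhs => rw [dec A, dec B]
    simp only [mul_add, add_mul, smul_mul_assoc, mul_smul_comm, mul_one, one_mul,
      Matrix.trace_add, Matrix.trace_smul, trace_coe, hf _ _]
  have h3 : ∀ A B C, (F A * F B * F C).trace = (A * B * C).trace := by
    intro A B C
    rw [hF, hF, hF]
    conv_rhs => rw [dec A, dec B, dec C]
    simp only [mul_add, add_mul, smul_mul_assoc, mul_smul_comm, mul_one, one_mul,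
      Matrix.trace_add, Matrix.trace_smul, trace_coe, hf _ _, hf' _ _ _]
  -- Multiplicativity follows by testing against F C, every matrix being of this form, with the
  -- nondegenerate trace form.
  have hmul : ∀ A B, F (A * B) = F A * F B := by
    intro A B
    rw [Matrix.ext_iff_trace_mul_right]
    intro C
    obtain ⟨C, rfl⟩ := hsurj C
    rw [h2, h3]
  let Φ : Matrix ι ι ℂ →ₐ[ℂ] Matrix ι ι ℂ := AlgHom.ofLinearMap F hF1 hmul
  have hbij : Function.Bijective Φ := ⟨LinearMap.injective_iff_surjective.2 hsurj, hsurj⟩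
  let e := AlgEquiv.ofBijective Φ hbij
  -- Skolem–Noether: automorphisms of a full endomorphism algebra are conjugations.
  let τ : Matrix ι ι ℂ ≃ₐ[ℂ] Module.End ℂ (ι → ℂ) := Matrix.toLinAlgEquiv'
  obtain ⟨T, hT⟩ := AlgEquiv.eq_linearEquivConjAlgEquiv ((τ.symm.trans e).trans τ)
  refine ⟨τ.symm T.toLinearMap, τ.symm T.symm.toLinearMap, ?_, fun X => ?_⟩
  · rw [← map_mul, ← map_one τ.symm]
    congr 1
    exact LinearMap.ext fun v => T.apply_symm_apply v
  · have h := congrArg (fun E => τ.symm (E (τ X))) hT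
    have h' : τ.symm (τ (e (τ.symm (τ X)))) = (f X : Matrix ι ι ℂ) := by
      rw [AlgEquiv.symm_apply_apply, AlgEquiv.symm_apply_apply]
      exact hFc X
    rw [← h']
    refine h.trans ?_
    rw [← AlgEquiv.symm_apply_apply τ (X : Matrix ι ι ℂ), ← map_mul, ← map_mul]
    rw [AlgEquiv.symm_apply_apply τ (X : Matrix ι ι ℂ)]
    rfl

theorem exists_conj_of_trace_cube
    (h : ∀ X, ((σ X : Matrix ι ι ℂ) ^ 3).trace = ((X : Matrix ι ι ℂ) ^ 3).trace) :
    ∃ P Q : Matrix ι ι ℂ, P * Q = 1 ∧ ∀ X : sl ι ℂ, (σ X : Matrix ι ι ℂ) = P * X * Q := by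
  refine exists_conj σ.toLinearEquiv (preservesTraceForm σ) fun X Y Z => ?_
  have := trace_mul_mul_eq σ 1 (fun X => by rw [h, one_mul]) X Y Z
  norm_num at this
  exact this

omit [Nonempty ι] in
theorem neg_transpose_mem (X : sl ι ℂ) : -(X : Matrix ι ι ℂ).transpose ∈ sl ι ℂ := by
  rw [mem_sl_iff, Matrix.trace_neg, Matrix.trace_transpose, trace_coe, neg_zero]

/-- The linear map `X ↦ - Xᵀ`. -/
def negTransposeHom : sl ι ℂ →ₗ[ℂ] sl ι ℂ where
  toFun X := ⟨_, neg_transpose_mem X⟩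
  map_add' X Y := Subtype.ext (by
    change -((X : Matrix ι ι ℂ) + (Y : Matrix ι ι ℂ)).transpose = -_ + -_
    rw [Matrix.transpose_add, neg_add])
  map_smul' c X := Subtype.ext (by
    change -(c • (X : Matrix ι ι ℂ)).transpose = c • -_
    rw [Matrix.transpose_smul, smul_neg])

omit [Nonempty ι] in
theorem coe_negTransposeHom (X : sl ι ℂ) :
    (negTransposeHom X : Matrix ι ι ℂ) = -(X : Matrix ι ι ℂ).transpose := rfl

/-- The involution `X ↦ - Xᵀ`. -/
def negTranspose : sl ι ℂ ≃ₗ[ℂ] sl ι ℂ :=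
  LinearEquiv.ofInvolutive negTransposeHom fun X => Subtype.ext (by
    rw [coe_negTransposeHom, coe_negTransposeHom, Matrix.transpose_neg, neg_neg,
      Matrix.transpose_transpose])

/-- After composition with X ↦ -Xᵀ the sign becomes +1, since transposition undoes the reversal of
the product XYZ. -/
theorem exists_conj_transpose_of_trace_cube
    (h : ∀ X, ((σ X : Matrix ι ι ℂ) ^ 3).trace = -((X : Matrix ι ι ℂ) ^ 3).trace) :
    ∃ P Q : Matrix ι ι ℂ, P * Q = 1 ∧
      ∀ X : sl ι ℂ, (σ X : Matrix ι ι ℂ) = -(P * (X : Matrix ι ι ℂ).transpose * Q) := by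
  obtain ⟨P, Q, hPQ, hf⟩ := exists_conj (σ.toLinearEquiv.trans negTranspose)
    (fun X Y => by
      refine Eq.trans ?_ (preservesTraceForm σ X Y)
      change (-(σ X : Matrix ι ι ℂ).transpose * -(σ Y : Matrix ι ι ℂ).transpose).trace = _
      rw [neg_mul_neg, ← Matrix.transpose_mul, Matrix.trace_transpose, Matrix.trace_mul_comm])
    (fun X Y Z => by
      change (-(σ X : Matrix ι ι ℂ).transpose * -(σ Y : Matrix ι ι ℂ).transpose *
        -(σ Z : Matrix ι ι ℂ).transpose).trace = _
      have := trace_mul_mul_eq σ (-1) (fun X => by rw [h, neg_one_mul]) Z Y X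
      rw [neg_mul_neg, mul_neg, ← Matrix.transpose_mul, ← Matrix.transpose_mul, Matrix.trace_neg,
        Matrix.trace_transpose, ← mul_assoc, this]
      norm_num)
  refine ⟨Q.transpose, P.transpose, ?_, fun X => ?_⟩
  · rw [← Matrix.transpose_mul, hPQ, Matrix.transpose_one]
  · have h1 : -(σ X : Matrix ι ι ℂ).transpose = P * X * Q := hf X
    rw [← Matrix.transpose_transpose (σ X : Matrix ι ι ℂ), neg_eq_iff_eq_neg.1 h1,
      Matrix.transpose_neg, Matrix.transpose_mul, Matrix.transpose_mul, mul_assoc]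

end SpecialLinearAut

/-! ### Inner and non-inner automorphisms of `sl` -/

namespace ClassicalType

variable {d : ℕ}

theorem isInner_of_conj [NeZero d] (σ : (A d).alg ≃ₗ⁅ℂ⁆ (A d).alg) {P Q : Matrix (Fin d) (Fin d) ℂ}
    (hPQ : P * Q = 1) (h : ∀ X : (A d).alg, (σ X : Matrix (Fin d) (Fin d) ℂ) =
      P * (X : Matrix (Fin d) (Fin d) ℂ) * Q) : IsInner σ := by
  have hdet : P.det * Q.det = 1 := by rw [← Matrix.det_mul, hPQ, Matrix.det_one]
  -- Multiplying P by a d-th root of det Q normalises its determinant to 1 without changing the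
  -- conjugation.
  obtain ⟨c, hc⟩ := IsAlgClosed.exists_pow_nat_eq Q.det (NeZero.pos d)
  have hc0 : c ≠ 0 := by
    rintro rfl
    rw [zero_pow (NeZero.ne d)] at hc
    rw [← hc, mul_zero] at hdet
    exact zero_ne_one hdet
  have h1 : (c • P).det = 1 := by
    rw [Matrix.det_smul, Fintype.card_fin, hc, mul_comm, hdet]
  let S : Matrix.SpecialLinearGroup (Fin d) ℂ := ⟨c • P, h1⟩
  have hS : (S⁻¹).1 = c⁻¹ • Q := by
    have e1 : (S⁻¹).1 * (c • P) = 1 := by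
      have := congrArg Subtype.val (inv_mul_cancel S)
      exact this
    have e2 : (c • P) * (c⁻¹ • Q) = 1 := by
      rw [smul_mul_smul_comm, mul_inv_cancel₀ hc0, hPQ, one_smul]
    rw [← mul_one (S⁻¹).1, ← e2, ← mul_assoc, e1, one_mul]
  refine ⟨S, fun X => ?_⟩
  rw [hS, h]
  change _ = c • P * _ * c⁻¹ • Q
  rw [smul_mul_assoc, smul_mul_assoc, mul_smul_comm, smul_smul, mul_inv_cancel₀ hc0, one_smul]

/-- A non-inner automorphism of `sl` has even order and is of the form `X ↦ - P Xᵀ P⁻¹`. -/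
theorem exists_conj_transpose_of_not_isInner [NeZero d] (σ : (A d).alg ≃ₗ⁅ℂ⁆ (A d).alg)
    (hσ : ¬ IsInner σ) :
    (∃ P Q : Matrix (Fin d) (Fin d) ℂ, P * Q = 1 ∧ ∀ X : (A d).alg,
      (σ X : Matrix (Fin d) (Fin d) ℂ) = -(P * (X : Matrix (Fin d) (Fin d) ℂ).transpose * Q)) ∧
    ∀ T : ℕ, (∀ X, σ^[T] X = X) → Even T := by
  have hpos : ¬ ∀ X : (A d).alg, ((σ X : Matrix (Fin d) (Fin d) ℂ) ^ 3).trace =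
      ((X : Matrix (Fin d) (Fin d) ℂ) ^ 3).trace := by
    intro h
    obtain ⟨P, Q, hPQ, h'⟩ := SpecialLinearAut.exists_conj_of_trace_cube σ h
    exact hσ (isInner_of_conj σ hPQ h')
  have hneg := (SpecialLinearAut.trace_cube_map_dichotomy σ).resolve_left hpos
  refine ⟨SpecialLinearAut.exists_conj_transpose_of_trace_cube σ hneg, fun T hT => ?_⟩
  by_contra hodd
  rw [Nat.not_even_iff_odd] at hodd
  have iter : ∀ (k : ℕ) (X : (A d).alg), ((σ^[k] X : Matrix (Fin d) (Fin d) ℂ) ^ 3).trace =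
      (-1) ^ k * ((X : Matrix (Fin d) (Fin d) ℂ) ^ 3).trace := by
    intro k X
    induction k with
    | zero => simp
    | succ k ih =>
      rw [Function.iterate_succ_apply', pow_succ (-1 : ℂ), mul_comm ((-1 : ℂ) ^ k), mul_assoc,
        ← ih, neg_one_mul]
      exact hneg _
  -- For odd T, the sign -1 and σᵀ = 1 force Tr X³ = 0 for all X, so the sign +1 holds as well.
  refine hpos fun X => ?_
  have h1 := iter T X
  rw [hT, hodd.neg_one_pow] at h1
  have h2 : ((X : Matrix (Fin d) (Fin d) ℂ) ^ 3).trace = 0 := by linear_combination h1 / 2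
  exact (hneg X).trans (by rw [h2, neg_zero])

end ClassicalType

/-! ## Brackets of densities with a matrix gradient -/

/-- By cyclicity Tr([M, N]Q) = 0 whenever N and Q commute. This disposes of the commutator terms of
the Maillet bracket. -/
theorem trace_commutator_mul_eq_zero {𝒱 : Type*} [CommRing 𝒱] {ι : Type*} [Fintype ι]
    [DecidableEq ι]
    (R R' : Matrix (ι × ι) (ι × ι) 𝒱)
    {X Y A B : Matrix ι ι 𝒱} (hX : Commute X A) (hY : Commute Y B) :
    ((R * (X ⊗ₖ (1 : Matrix ι ι 𝒱)) - (X ⊗ₖ (1 : Matrix ι ι 𝒱)) * R -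
      (R' * ((1 : Matrix ι ι 𝒱) ⊗ₖ Y) - ((1 : Matrix ι ι 𝒱) ⊗ₖ Y) * R')) * (A ⊗ₖ B)).trace = 0 := by
  have key : ∀ M N Q : Matrix (ι × ι) (ι × ι) 𝒱,
      N * Q = Q * N → ((M * N - N * M) * Q).trace = 0 := by
    intro M N Q h
    rw [sub_mul, Matrix.trace_sub, Matrix.mul_assoc N, Matrix.trace_mul_comm N, Matrix.mul_assoc,
      Matrix.mul_assoc, h, sub_self]
  rw [sub_mul, Matrix.trace_sub, key, key, sub_zero]
  · rw [← Matrix.mul_kronecker_mul, ← Matrix.mul_kronecker_mul, one_mul, mul_one, hY.eq]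
  · rw [← Matrix.mul_kronecker_mul, ← Matrix.mul_kronecker_mul, one_mul, mul_one, hX.eq]

namespace PoissonVertexAlgebra

variable {𝒱 : Type*} [CommRing 𝒱] [Algebra ℂ 𝒱]

section Gradient

variable {ι : Type*} [Fintype ι]

/-- `W` depends on the entries of `X` only, with gradient `G`. -/
def HasMatrixGradient (W : 𝒱) (X G : Matrix ι ι 𝒱) : Prop :=
  ∀ δ : Derivation ℂ 𝒱 𝒱, δ W = (G * X.map δ).trace

theorem HasMatrixGradient.apply {W : 𝒱} {X G : Matrix ι ι 𝒱} (h : HasMatrixGradient W X G)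
    (δ : Derivation ℂ 𝒱 𝒱) : δ W = ∑ i, ∑ j, G i j * δ (X j i) := h δ

end Gradient

variable [PoissonVertexAlgebra 𝒱]

/-- The coefficient of `Xⁿ` in `br a b`, as a derivation in `b`. -/
def brDer (a : 𝒱) (n : ℕ) : Derivation ℂ 𝒱 𝒱 :=
  Derivation.mk' (((Polynomial.lcoeff 𝒱 n).restrictScalars ℂ) ∘ₗ br a) fun b c => by
    change (br a (b * c)).coeff n = b • (br a c).coeff n + c • (br a b).coeff n
    rw [br_mul_right, Polynomial.coeff_add, Polynomial.coeff_C_mul, Polynomial.coeff_C_mul]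
    rfl

theorem brDer_apply (a b : 𝒱) (n : ℕ) : brDer a n b = (br a b).coeff n := rfl

/-- For brackets of order at most one in ∂, skew-symmetry has two terms. It is needed because
gradients act through the Leibniz rule in the second entry, so the entries must be exchanged once.
-/
theorem coeff_zero_br_of_coeff_eq_zero {a b : 𝒱} (h : ∀ n, 2 ≤ n → (br a b).coeff n = 0) :
    (br b a).coeff 0 = -(br a b).coeff 0 + D ((br a b).coeff 1) := by
  have hsub : (br a b).support ⊆ Finset.range 2 := by
    intro n hn
    rw [Polynomial.mem_support_iff] at hn
    by_contra h2
    exact hn (h n (not_lt.1 fun h => h2 (Finset.mem_range.2 h)))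
  rw [coeff_br_skew, Finset.sum_subset hsub]
  · simp [Finset.sum_range_succ]
    abel
  · intro n _ hn
    rw [Polynomial.notMem_support_iff.1 hn]
    have : ∀ k : ℕ, (D : Derivation ℂ 𝒱 𝒱)^[k] 0 = 0 := fun k =>
      Function.iterate_fixed (map_zero D) k
    rw [this, smul_zero]

variable {ι : Type*} [Fintype ι]

/-- The bracket of two densities whose matrix variables have an ultralocal part `P` and
a constant non-ultralocal part `U`. -/
theorem integratedBr_of_gradients {W₁ W₂ : 𝒱} {X₁ X₂ G₁ G₂ : Matrix ι ι 𝒱}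
    (h₁ : HasMatrixGradient W₁ X₁ G₁) (h₂ : HasMatrixGradient W₂ X₂ G₂)
    (P : Matrix (ι × ι) (ι × ι) 𝒱) (U : Matrix (ι × ι) (ι × ι) ℂ)
    (hbr : ∀ i j k l, br (X₂ i j) (X₁ k l) = Polynomial.C (P (i, k) (j, l)) +
      Polynomial.C (algebraMap ℂ 𝒱 (U (i, k) (j, l))) * Polynomial.X)
    (hP : (P * (G₂ ⊗ₖ G₁)).trace = 0) :
    integratedBr W₁ W₂ =
      ∑ i, ∑ j, ∑ k, ∑ l, U (i, k) (j, l) • (D (G₁ l k) * G₂ j i) := by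
  have e0 : ∀ i j, (br (X₂ i j) W₁).coeff 0 = ∑ k, ∑ l, G₁ l k * P (i, k) (j, l) := by
    intro i j
    rw [← brDer_apply, h₁.apply, Finset.sum_comm]
    simp [brDer_apply, hbr]
  have e1 : ∀ i j, (br (X₂ i j) W₁).coeff 1 = ∑ k, ∑ l, U (i, k) (j, l) • G₁ l k := by
    intro i j
    rw [← brDer_apply, h₁.apply, Finset.sum_comm]
    refine Finset.sum_congr rfl fun k _ => Finset.sum_congr rfl fun l _ => ?_
    rw [brDer_apply, hbr, Polynomial.coeff_add, Polynomial.coeff_C_mul, Polynomial.coeff_X_one,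
      Polynomial.coeff_C_of_ne_zero one_ne_zero, zero_add, mul_one, Algebra.smul_def, mul_comm]
  -- No derivative of δ beyond the first occurs; this is what permits the two-term skew-symmetry.
  have e2 : ∀ i j n, 2 ≤ n → (br (X₂ i j) W₁).coeff n = 0 := by
    intro i j n hn
    rw [← brDer_apply, h₁.apply]
    refine Finset.sum_eq_zero fun k _ => Finset.sum_eq_zero fun l _ => ?_
    obtain ⟨n, rfl⟩ := Nat.exists_eq_add_of_le' hn
    rw [brDer_apply, hbr, Polynomial.coeff_add, Polynomial.coeff_C_succ, Polynomial.coeff_mul_X,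
      Polynomial.coeff_C_succ, add_zero, mul_zero]
  have e3 : ∀ i j, (br W₁ (X₂ i j)).coeff 0 = -(∑ k, ∑ l, G₁ l k * P (i, k) (j, l)) +
      ∑ k, ∑ l, U (i, k) (j, l) • D (G₁ l k) := by
    intro i j
    rw [coeff_zero_br_of_coeff_eq_zero (e2 i j), e0, e1]
    simp [map_sum]
  rw [integratedBr_apply, ← brDer_apply, h₂.apply, Finset.sum_comm]
  simp only [brDer_apply, e3, mul_add, mul_neg, Finset.sum_add_distrib, Finset.sum_neg_distrib]
  have hP' : ∑ i, ∑ j, G₂ j i * ∑ k, ∑ l, G₁ l k * P (i, k) (j, l) = 0 := by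
    rw [← hP, Matrix.trace, Fintype.sum_prod_type]
    simp only [Matrix.diag_apply, Matrix.mul_apply, Fintype.sum_prod_type,
      Matrix.kroneckerMap_apply, Finset.mul_sum]
    refine Finset.sum_congr rfl fun i _ => ?_
    rw [Finset.sum_comm]
    refine Finset.sum_congr rfl fun k _ => Finset.sum_congr rfl fun j _ =>
      Finset.sum_congr rfl fun l _ => by ring
  rw [hP', neg_zero, zero_add]
  simp only [Finset.sum_mul, smul_mul_assoc, mul_comm (G₂ _ _)]

end PoissonVertexAlgebra

/-! ## The two-point function of densities with an equivariant gradient -/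

section Contraction

variable {ι : Type*} [Fintype ι] {𝒱 : Type*} [CommRing 𝒱] [Algebra ℂ 𝒱]

/-- The linear form `M ↦ Tr (M A)` on complex matrices. -/
def traceMul (A : Matrix ι ι 𝒱) : Matrix ι ι ℂ →ₗ[ℂ] 𝒱 where
  toFun M := (M.map (algebraMap ℂ 𝒱) * A).trace
  map_add' M N := by
    rw [Matrix.map_add _ (map_add _), add_mul, Matrix.trace_add]
  map_smul' c M := by
    rw [RingHom.id_apply, ← Matrix.trace_smul, ← smul_mul_assoc]
    congr 2
    ext i j
    simp [Algebra.smul_def]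

theorem traceMul_apply (A : Matrix ι ι 𝒱) (M : Matrix ι ι ℂ) :
    traceMul A M = (M.map (algebraMap ℂ 𝒱) * A).trace := rfl

theorem traceMul_eq_sum (A : Matrix ι ι 𝒱) (M : Matrix ι ι ℂ) :
    traceMul A M = ∑ i, ∑ j, M i j • A j i := by
  simp [traceMul_apply, Matrix.trace, Matrix.mul_apply, Algebra.smul_def]

theorem traceMul_add (A B : Matrix ι ι 𝒱) (M : Matrix ι ι ℂ) :
    traceMul (A + B) M = traceMul A M + traceMul B M := by
  rw [traceMul_apply, mul_add, Matrix.trace_add]; rfl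

theorem traceMul_smul (c : ℂ) (A : Matrix ι ι 𝒱) (M : Matrix ι ι ℂ) :
    traceMul (c • A) M = c • traceMul A M := by
  rw [traceMul_apply, mul_smul_comm, Matrix.trace_smul]; rfl

theorem traceMul_map (δ : Derivation ℂ 𝒱 𝒱) (A : Matrix ι ι 𝒱) (M : Matrix ι ι ℂ) :
    traceMul (A.map δ) M = δ (traceMul A M) := by
  simp [traceMul_eq_sum, map_sum]

/-- The contraction of a complex tensor with two matrices. -/
def tensorContraction (A B : Matrix ι ι 𝒱) : Matrix (ι × ι) (ι × ι) ℂ →ₗ[ℂ] 𝒱 where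
  toFun U := ∑ i, ∑ j, ∑ k, ∑ l, U (i, k) (j, l) • (A l k * B j i)
  map_add' U V := by
    simp only [Matrix.add_apply, add_smul, Finset.sum_add_distrib]
  map_smul' c U := by
    simp only [Matrix.smul_apply, smul_assoc, Finset.smul_sum, RingHom.id_apply]

theorem tensorContraction_apply (A B : Matrix ι ι 𝒱) (U : Matrix (ι × ι) (ι × ι) ℂ) :
    tensorContraction A B U = ∑ i, ∑ j, ∑ k, ∑ l, U (i, k) (j, l) • (A l k * B j i) := rfl

/-- Note the order: the first tensor factor is contracted with B, the second with A. -/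
theorem tensorContraction_kronecker (A B : Matrix ι ι 𝒱) (M N : Matrix ι ι ℂ) :
    tensorContraction A B (M ⊗ₖ N) = traceMul B M * traceMul A N := by
  rw [tensorContraction_apply, traceMul_eq_sum, traceMul_eq_sum, Finset.sum_mul]
  refine Finset.sum_congr rfl fun i _ => ?_
  rw [Finset.sum_mul]
  refine Finset.sum_congr rfl fun j _ => ?_
  simp only [Finset.mul_sum, Matrix.kroneckerMap_apply, smul_mul_smul_comm, mul_comm (A _ _)]

theorem tensorContraction_swap (A B : Matrix ι ι 𝒱) (U : Matrix (ι × ι) (ι × ι) ℂ) :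
    tensorContraction A B (U.submatrix Prod.swap Prod.swap) = tensorContraction B A U := by
  simp only [tensorContraction_apply, Matrix.submatrix_apply, Prod.swap_prod_mk, mul_comm (A _ _)]
  have : ∀ f : ι → ι → ι → ι → 𝒱, ∑ i, ∑ j, ∑ k, ∑ l, f i j k l = ∑ k, ∑ l, ∑ i, ∑ j,
      f i j k l := by
    intro f
    calc ∑ i, ∑ j, ∑ k, ∑ l, f i j k l = ∑ i, ∑ k, ∑ j, ∑ l, f i j k l :=
          Finset.sum_congr rfl fun i _ => Finset.sum_comm
      _ = ∑ k, ∑ i, ∑ j, ∑ l, f i j k l := Finset.sum_comm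
      _ = ∑ k, ∑ i, ∑ l, ∑ j, f i j k l :=
          Finset.sum_congr rfl fun k _ => Finset.sum_congr rfl fun i _ => Finset.sum_comm
      _ = ∑ k, ∑ l, ∑ i, ∑ j, f i j k l :=
          Finset.sum_congr rfl fun k _ => Finset.sum_comm
  rw [this]

end Contraction

namespace TwistModel

open PoissonVertexAlgebra

variable {t : ClassicalType} {𝒱 : Type*} [CommRing 𝒱] [Algebra ℂ 𝒱] [PoissonVertexAlgebra 𝒱]
  (m : TwistModel t 𝒱)

/-- The trace form on `𝔤`. -/
def form (X Y : t.alg) : ℂ :=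
  ((X : Matrix t.Index t.Index ℂ) * (Y : Matrix t.Index t.Index ℂ)).trace

theorem form_comm (X Y : t.alg) : form X Y = form Y X := Matrix.trace_mul_comm _ _

theorem form_sum_left {α : Type*} (s : Finset α) (c : α → ℂ) (X : α → t.alg) (Y : t.alg) :
    form (∑ a ∈ s, c a • X a) Y = ∑ a ∈ s, c a * form (X a) Y := by
  let F : t.alg →ₗ[ℂ] ℂ :=
    Matrix.traceLinearMap t.Index ℂ ℂ ∘ₗ LinearMap.mulRight ℂ (Y : Matrix t.Index t.Index ℂ) ∘ₗ
      (t.alg.incl : t.alg →ₗ[ℂ] Matrix t.Index t.Index ℂ)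
  change F _ = ∑ a ∈ s, c a * F (X a)
  simp [map_sum]

theorem sum_form_basisDown (Y : t.alg) : ∑ b, form Y (m.basisDown b) • m.basisUp b = Y := by
  conv_rhs => rw [← m.basisUp.sum_repr Y]
  refine Finset.sum_congr rfl fun b _ => ?_
  congr 1
  conv_lhs => rw [← m.basisUp.sum_repr Y, form_sum_left]
  rw [Finset.sum_eq_single b]
  · change _ * Matrix.trace _ = _
    rw [m.trace_basis, if_pos rfl, mul_one]
  · intro a _ hab
    change _ * Matrix.trace _ = _
    rw [m.trace_basis, if_neg hab, mul_zero]
  · simp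

/-- The existence of a dual basis alone makes the trace form nondegenerate, without any case
distinction on the type. -/
theorem eq_zero_of_form_basisUp {Z : t.alg} (h : ∀ b, form Z (m.basisUp b) = 0) : Z = 0 := by
  rw [← m.sum_form_basisDown Z]
  refine Finset.sum_eq_zero fun b _ => ?_
  rw [form_comm, ← m.sum_form_basisDown (m.basisDown b), form_sum_left, Finset.sum_eq_zero,
    zero_smul]
  intro c _
  rw [form_comm _ Z, h, mul_zero]

theorem sum_form_basisUp (Y : t.alg) : ∑ b, form Y (m.basisUp b) • m.basisDown b = Y := by
  refine (sub_eq_zero.1 (m.eq_zero_of_form_basisUp fun c => ?_)).symm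
  have h : form (Y - ∑ b, form Y (m.basisUp b) • m.basisDown b) (m.basisUp c) =
      form Y (m.basisUp c) - form (∑ b, form Y (m.basisUp b) • m.basisDown b) (m.basisUp c) := by
    change Matrix.trace (((Y : Matrix t.Index t.Index ℂ) - _) * _) = _
    rw [sub_mul, Matrix.trace_sub]
    rfl
  rw [h, form_sum_left, Finset.sum_eq_single c, form_comm (m.basisDown c)]
  · change _ - _ * Matrix.trace _ = _
    rw [m.trace_basis, if_pos rfl, mul_one, sub_self]
  · intro b _ hb
    rw [form_comm (m.basisDown b)]
    change _ * Matrix.trace _ = _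
    rw [m.trace_basis, if_neg hb.symm, mul_zero]
  · simp

/-- `Tr₁₂ (σ₁ᵏ C₁₂ A₁ B₂)`. -/
def pairing (k : ℕ) (A B : Matrix t.Index t.Index 𝒱) : 𝒱 :=
  ∑ a, traceMul A (m.σ^[k] (m.basisUp a) : t.alg) * traceMul B (m.basisDown a : t.alg)

theorem form_iterate (hσ : PreservesTraceForm m.σ) (k : ℕ) (X Y : t.alg) :
    form (m.σ^[k] X) (m.σ^[k] Y) = form X Y := by
  induction k with
  | zero => rfl
  | succ k ih => rw [Function.iterate_succ_apply', Function.iterate_succ_apply', ← ih]; exact hσ _ _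

theorem iterate_order (X : t.alg) : m.σ^[m.T] X = X := by
  have h : ((m.σ : t.alg →ₗ[ℂ] t.alg) : Module.End ℂ t.alg) ^ m.T = 1 := by
    rw [← m.order_σ]; exact pow_orderOf_eq_one _
  have h' := LinearMap.congr_fun h X
  rw [Module.End.pow_apply] at h'
  exact h'

/-- The Casimir is symmetric and σ₁σ₂-invariant, so σ₁ᵏC₁₂ = σ₂⁻ᵏC₁₂ = σ₂ʲC₁₂. -/
theorem pairing_swap (hσ : PreservesTraceForm m.σ) {j k : ℕ} (hjk : j + k = m.T)
    (A B : Matrix t.Index t.Index 𝒱) : m.pairing k A B = m.pairing j B A := by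
  let f : t.alg →ₗ[ℂ] 𝒱 := traceMul A ∘ₗ (t.alg.incl : t.alg →ₗ[ℂ] Matrix t.Index t.Index ℂ)
  let g : t.alg →ₗ[ℂ] 𝒱 := traceMul B ∘ₗ (t.alg.incl : t.alg →ₗ[ℂ] Matrix t.Index t.Index ℂ)
  let s : t.alg →ₗ[ℂ] t.alg := ((m.σ : t.alg →ₗ[ℂ] t.alg) : Module.End ℂ t.alg) ^ j
  have hs : ∀ X, s X = m.σ^[j] X := fun X => Module.End.pow_apply _ _ _
  change ∑ a, f (m.σ^[k] (m.basisUp a)) * g (m.basisDown a) =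
    ∑ a, g (m.σ^[j] (m.basisUp a)) * f (m.basisDown a)
  have e1 : ∀ a b, form (m.σ^[k] (m.basisUp a)) (m.basisDown b) =
      form (s (m.basisDown b)) (m.basisUp a) := by
    intro a b
    have hb : m.σ^[k] (m.σ^[j] (m.basisDown b)) = m.basisDown b := by
      rw [← Function.iterate_add_apply, add_comm, hjk, iterate_order]
    rw [hs, form_comm, ← m.form_iterate hσ k (m.σ^[j] _), hb]
  calc ∑ a, f (m.σ^[k] (m.basisUp a)) * g (m.basisDown a)
      = ∑ a, ∑ b, form (s (m.basisDown b)) (m.basisUp a) • (f (m.basisUp b) * g (m.basisDown a)) := by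
        refine Finset.sum_congr rfl fun a _ => ?_
        conv_lhs => rw [← m.sum_form_basisDown (m.σ^[k] (m.basisUp a)), map_sum, Finset.sum_mul]
        refine Finset.sum_congr rfl fun b _ => ?_
        rw [map_smul, e1, smul_mul_assoc]
    _ = ∑ b, f (m.basisUp b) * g (s (m.basisDown b)) := by
        rw [Finset.sum_comm]
        refine Finset.sum_congr rfl fun b _ => ?_
        conv_rhs => rw [← m.sum_form_basisUp (s (m.basisDown b)), map_sum, Finset.mul_sum]
        refine Finset.sum_congr rfl fun a _ => ?_
        rw [map_smul, mul_smul_comm]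
    _ = ∑ b, ∑ c, form (m.basisUp c) (m.basisUp b) • (f (m.basisDown c) * g (s (m.basisDown b))) := by
        refine Finset.sum_congr rfl fun b _ => ?_
        conv_lhs => rw [← m.sum_form_basisUp (m.basisUp b), map_sum, Finset.sum_mul]
        refine Finset.sum_congr rfl fun c _ => ?_
        rw [map_smul, smul_mul_assoc, form_comm]
    _ = ∑ c, g (m.σ^[j] (m.basisUp c)) * f (m.basisDown c) := by
        rw [Finset.sum_comm]
        refine Finset.sum_congr rfl fun c _ => ?_
        rw [← hs]
        conv_rhs => rw [← m.sum_form_basisUp (m.basisUp c), map_sum, map_sum, Finset.sum_mul]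
        refine Finset.sum_congr rfl fun b _ => ?_
        rw [map_smul, map_smul, smul_mul_assoc, mul_comm (g _)]

/-- Points which are, with their whole `ℤ_T`-orbit, away from the singularities of the model. -/
structure IsGood (z : ℂ) : Prop where
  ne_zero : z ≠ 0
  φ_ne_zero : m.φ.valueAt z ≠ 0
  notMem_poles : ∀ k : ℕ, m.ω ^ k * z ∉ m.poles

theorem ω_ne_zero : m.ω ≠ 0 := m.isPrimitiveRoot.ne_zero m.T_pos.ne'

theorem φ_pow_mul (k : ℕ) (z : ℂ) :
    m.φ.valueAt (m.ω ^ k * z) = (m.ω ^ k)⁻¹ * m.φ.valueAt z := by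
  induction k with
  | zero => simp
  | succ k ih => rw [pow_succ', mul_assoc, m.φ_equivariant, ih, mul_inv, mul_assoc]

theorem inv_pow_eq_pow {k : ℕ} : ∃ j : ℕ, (m.ω ^ k)⁻¹ = m.ω ^ j := by
  refine ⟨k * (m.T - 1), inv_eq_of_mul_eq_one_right ?_⟩
  have h : k + k * (m.T - 1) = m.T * k := by
    rw [← mul_one_add, Nat.add_sub_cancel' (show 1 ≤ m.T from m.T_pos), mul_comm]
  rw [← pow_add, h, pow_mul,
    m.isPrimitiveRoot.pow_eq_one, one_pow]

variable {m}

theorem IsGood.pow_mul {z : ℂ} (hz : m.IsGood z) (k : ℕ) : m.IsGood (m.ω ^ k * z) where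
  ne_zero := mul_ne_zero (pow_ne_zero _ m.ω_ne_zero) hz.ne_zero
  φ_ne_zero := by
    rw [φ_pow_mul]
    exact mul_ne_zero (inv_ne_zero (pow_ne_zero _ m.ω_ne_zero)) hz.φ_ne_zero
  notMem_poles j := by rw [← mul_assoc, ← pow_add]; exact hz.notMem_poles _

theorem IsGood.inv_pow_mul {z : ℂ} (hz : m.IsGood z) (k : ℕ) : m.IsGood ((m.ω ^ k)⁻¹ * z) := by
  obtain ⟨j, hj⟩ := m.inv_pow_eq_pow (k := k)
  rw [hj]
  exact hz.pow_mul j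

theorem IsGood.notMem {z : ℂ} (hz : m.IsGood z) : z ∉ m.poles := by
  simpa using hz.notMem_poles 0

variable (m)

/-- `G` is the gradient of the density `𝒲ₙ` with respect to `φ L`. -/
structure IsGradient (n : ℕ) (G : ℂ → Matrix t.Index t.Index 𝒱) : Prop where
  gradient : ∀ z, m.IsGood z →
    HasMatrixGradient (m.W n z) (t.toMatrix 𝒱 (m.L z)) (m.φ.valueAt z • G z)
  commute : ∀ z, m.IsGood z → Commute (t.toMatrix 𝒱 (m.L z)) (G z)
  equivariant : ∀ z, m.IsGood z → ∀ Y : t.alg,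
    m.ω ^ (n * m.kappa) • traceMul (G (m.ω * z)) (m.σ Y : t.alg) =
      m.ω • traceMul (G z) (Y : Matrix t.Index t.Index ℂ)
  holomorphic : HolomorphicAtZero G

/-- `Tr₁₂ (C₁₂ ∂_x A₁ B₂)`. -/
def derivPairing : Matrix t.Index t.Index 𝒱 →ₗ[ℂ] Matrix t.Index t.Index 𝒱 →ₗ[ℂ] 𝒱 :=
  LinearMap.mk₂ ℂ (fun A B => m.pairing 0 (A.map (D : Derivation ℂ 𝒱 𝒱)) B)
    (fun A A' B => by
      simp only [pairing, traceMul_map, traceMul_add, map_add, add_mul, Finset.sum_add_distrib])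
    (fun c A B => by
      simp only [pairing, traceMul_map, traceMul_smul, Derivation.map_smul, smul_mul_assoc,
        Finset.smul_sum])
    (fun A B B' => by
      simp only [pairing, traceMul_add, mul_add, Finset.sum_add_distrib])
    (fun c A B => by
      simp only [pairing, traceMul_smul, mul_smul_comm, Finset.smul_sum])

theorem derivPairing_apply (A B : Matrix t.Index t.Index 𝒱) :
    m.derivPairing A B = m.pairing 0 (A.map (D : Derivation ℂ 𝒱 𝒱)) B := rfl

variable {m}

theorem IsGradient.equivariant_iterate {n : ℕ} {G : ℂ → Matrix t.Index t.Index 𝒱}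
    (hG : m.IsGradient n G) {z : ℂ} (hz : m.IsGood z) (j : ℕ) (Y : t.alg) :
    traceMul (G z) (m.σ^[j] Y : t.alg) = (m.ω ^ j * (m.ω⁻¹) ^ (j * (n * m.kappa))) •
      traceMul (G ((m.ω ^ j)⁻¹ * z)) (Y : Matrix t.Index t.Index ℂ) := by
  induction j generalizing z with
  | zero => simp
  | succ j ih =>
    have h := hG.equivariant _ (hz.inv_pow_mul 1) (m.σ^[j] Y)
    rw [pow_one, mul_inv_cancel_left₀ m.ω_ne_zero] at h
    rw [ih (by simpa using hz.inv_pow_mul 1), smul_smul] at h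
    have h0 : m.ω ^ (n * m.kappa) ≠ 0 := pow_ne_zero _ m.ω_ne_zero
    rw [Function.iterate_succ_apply', ← inv_smul_smul₀ h0 (traceMul (G z) _), h, smul_smul,
      ← mul_assoc ((m.ω ^ j)⁻¹), ← mul_inv, ← pow_succ]
    congr 1
    rw [inv_pow, inv_pow, Nat.succ_mul, pow_add _ (j * _), mul_inv]
    ring

/-- A twist of the Casimir by σʲ is traded for a rotation of the spectral parameter: sums over
powers of σ become sums over the orbit of z. -/
theorem IsGradient.pairing_eq {n : ℕ} {G : ℂ → Matrix t.Index t.Index 𝒱}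
    (hG : m.IsGradient n G) {z : ℂ} (hz : m.IsGood z) (j : ℕ) (B : Matrix t.Index t.Index 𝒱) :
    m.pairing j ((G z).map (D : Derivation ℂ 𝒱 𝒱)) B =
      (m.ω ^ j * (m.ω⁻¹) ^ (j * (n * m.kappa))) • m.derivPairing (G ((m.ω ^ j)⁻¹ * z)) B := by
  simp only [derivPairing_apply, pairing, traceMul_map, hG.equivariant_iterate hz,
    Derivation.map_smul, smul_mul_assoc, Finset.smul_sum]
  rfl

variable (m)

/-- The tensor `R⁰₁₂(z, w)`. -/
def R0 (z w : ℂ) : Matrix (t.Index × t.Index) (t.Index × t.Index) ℂ :=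
  (m.T : ℂ)⁻¹ • ∑ k ∈ Finset.range m.T, (w - (m.ω ^ k)⁻¹ * z)⁻¹ •
    ∑ a, ((m.σ^[k] (m.basisUp a) : t.alg) : Matrix t.Index t.Index ℂ) ⊗ₖ
      (m.basisDown a : Matrix t.Index t.Index ℂ)

theorem tensorContraction_R0 (A B : Matrix t.Index t.Index 𝒱) (z w : ℂ) :
    tensorContraction A B (m.R0 z w) = (m.T : ℂ)⁻¹ • ∑ k ∈ Finset.range m.T,
      (w - (m.ω ^ k)⁻¹ * z)⁻¹ • m.pairing k B A := by
  simp only [R0, map_smul, map_sum, tensorContraction_kronecker, pairing]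

/-- The sum of the two kernels, with the poles combined. -/
theorem tensorContraction_R0_add (hσ : PreservesTraceForm m.σ) {n : ℕ}
    {G : ℂ → Matrix t.Index t.Index 𝒱} (hG : m.IsGradient n G) {z w : ℂ} (hz : m.IsGood z)
    (hzw : z ^ m.T ≠ w ^ m.T) (B : Matrix t.Index t.Index 𝒱) :
    m.φ.valueAt w • tensorContraction ((G z).map (D : Derivation ℂ 𝒱 𝒱)) B (m.R0 w z) +
      m.φ.valueAt z • tensorContraction B ((G z).map (D : Derivation ℂ 𝒱 𝒱)) (m.R0 z w) =
    (m.T : ℂ)⁻¹ • ∑ j ∈ Finset.range m.T, (m.ω⁻¹) ^ (j * (n * m.kappa)) •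
      ((m.φ.valueAt ((m.ω ^ j)⁻¹ * z) - m.φ.valueAt w) * (w - (m.ω ^ j)⁻¹ * z)⁻¹) •
        m.derivPairing (G ((m.ω ^ j)⁻¹ * z)) B := by
  set A := (G z).map (D : Derivation ℂ 𝒱 𝒱) with hA
  have hω : ∀ k, m.ω ^ k ≠ 0 := fun k => pow_ne_zero _ m.ω_ne_zero
  -- Reindexing k ↦ T - k, the value T being identified with 0.
  have e1 : ∑ k ∈ Finset.range m.T, (z - (m.ω ^ k)⁻¹ * w)⁻¹ • m.pairing k B A =
      ∑ k ∈ Finset.range m.T, (z - m.ω ^ k * w)⁻¹ • m.pairing k A B := by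
    have h : ∀ k ∈ Finset.range m.T, (z - (m.ω ^ k)⁻¹ * w)⁻¹ • m.pairing k B A =
        (z - m.ω ^ (m.T - 1 - k + 1) * w)⁻¹ • m.pairing (m.T - 1 - k + 1) A B := by
      intro k hk
      have hk' : m.T - 1 - k + 1 + k = m.T := by have := Finset.mem_range.1 hk; omega
      have hinv : (m.ω ^ k)⁻¹ = m.ω ^ (m.T - 1 - k + 1) := by
        refine inv_eq_of_mul_eq_one_left ?_
        rw [← pow_add, hk', m.isPrimitiveRoot.pow_eq_one]
      rw [m.pairing_swap hσ hk', hinv]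
    rw [Finset.sum_congr rfl h,
      Finset.sum_range_reflect (fun k => (z - m.ω ^ (k + 1) * w)⁻¹ • m.pairing (k + 1) A B)]
    have hT : ∀ A B, m.pairing m.T A B = m.pairing 0 A B := by
      intro A B
      simp only [pairing, m.iterate_order, Function.iterate_zero, id]
    have := Finset.sum_range_succ' (fun k => (z - m.ω ^ k * w)⁻¹ • m.pairing k A B) m.T
    rw [Finset.sum_range_succ, m.isPrimitiveRoot.pow_eq_one, hT, pow_zero] at this
    exact (add_right_cancel this).symm
  rw [tensorContraction_R0, tensorContraction_R0, e1, smul_comm (m.φ.valueAt w),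
    smul_comm (m.φ.valueAt z), ← smul_add, Finset.smul_sum, Finset.smul_sum,
    ← Finset.sum_add_distrib]
  congr 1
  refine Finset.sum_congr rfl fun k _ => ?_
  rw [hA, hG.pairing_eq hz, smul_smul, smul_smul, smul_smul, smul_smul, ← add_smul, smul_smul]
  congr 1
  -- The weight of φ matches the factor between the denominators z - ωᵏw and w - ω⁻ᵏz, so the
  -- numerators combine into a difference of values of φ.
  have hφ : m.φ.valueAt z = (m.ω ^ k)⁻¹ * m.φ.valueAt ((m.ω ^ k)⁻¹ * z) := by
    rw [← φ_pow_mul, mul_inv_cancel_left₀ (hω k)]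
  have hne : w - (m.ω ^ k)⁻¹ * z ≠ 0 := by
    intro h
    apply hzw
    rw [sub_eq_zero.1 h, mul_pow, inv_pow, ← pow_mul, mul_comm k, pow_mul,
      m.isPrimitiveRoot.pow_eq_one, one_pow, inv_one, one_mul]
  have hne' : z - m.ω ^ k * w = -(m.ω ^ k) * (w - (m.ω ^ k)⁻¹ * z) := by
    rw [mul_sub, neg_mul, neg_mul, mul_inv_cancel_left₀ (hω k)]
    ring
  rw [hφ, hne', mul_inv, inv_neg]
  field_simp [hω k]
  ring

/-- The two-point function `∫ dx {𝒲ₙ(z, x), 𝒲ₖ(w, y)}`. -/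
theorem integratedBr_W (hσ : PreservesTraceForm m.σ) {n k : ℕ}
    {G G' : ℂ → Matrix t.Index t.Index 𝒱} (hG : m.IsGradient n G) (hG' : m.IsGradient k G')
    {z w : ℂ} (hz : m.IsGood z) (hw : m.IsGood w) (hzw : z ^ m.T ≠ w ^ m.T) :
    integratedBr (m.W n z) (m.W k w) =
    (m.T : ℂ)⁻¹ • ∑ j ∈ Finset.range m.T, (m.ω⁻¹) ^ (j * (n * m.kappa)) •
      ((m.φ.valueAt ((m.ω ^ j)⁻¹ * z) - m.φ.valueAt w) * (w - (m.ω ^ j)⁻¹ * z)⁻¹) •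
        m.derivPairing (G ((m.ω ^ j)⁻¹ * z)) (G' w) := by
  -- The points are exchanged, since `integratedBr_of_gradients` uses the bracket of the second
  -- matrix variable with the first.
  have hm := m.maillet w z hw.notMem hz.notMem hw.φ_ne_zero hz.φ_ne_zero hzw.symm
  let R : Matrix (t.Index × t.Index) (t.Index × t.Index) ℂ := (m.φ.valueAt z)⁻¹ • m.R0 w z
  let R' : Matrix (t.Index × t.Index) (t.Index × t.Index) ℂ :=
    ((m.φ.valueAt w)⁻¹ • m.R0 z w).submatrix Prod.swap Prod.swap
  rw [integratedBr_of_gradients (hG.gradient z hz) (hG'.gradient w hw)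
    (R.map (algebraMap ℂ 𝒱) * (t.toMatrix 𝒱 (m.L w) ⊗ₖ (1 : Matrix t.Index t.Index 𝒱)) -
      (t.toMatrix 𝒱 (m.L w) ⊗ₖ (1 : Matrix t.Index t.Index 𝒱)) * R.map (algebraMap ℂ 𝒱) -
      (R'.map (algebraMap ℂ 𝒱) * ((1 : Matrix t.Index t.Index 𝒱) ⊗ₖ t.toMatrix 𝒱 (m.L z)) -
        ((1 : Matrix t.Index t.Index 𝒱) ⊗ₖ t.toMatrix 𝒱 (m.L z)) * R'.map (algebraMap ℂ 𝒱)))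
    (R + R') (fun i j k l => by rw [Matrix.add_apply, map_add]; exact hm i j k l)
    (trace_commutator_mul_eq_zero _ _ ((hG'.commute w hw).smul_right _)
      ((hG.commute z hz).smul_right _))]
  -- With respect to L the gradients are φG; their two factors φ cancel the inverse twist function
  -- in each kernel and leave one φ over.
  have e : ∀ U : Matrix (t.Index × t.Index) (t.Index × t.Index) ℂ,
      ∑ i, ∑ j, ∑ k, ∑ l, U (i, k) (j, l) • (D ((m.φ.valueAt z • G z) l k) *
        (m.φ.valueAt w • G' w) j i : 𝒱) = (m.φ.valueAt z * m.φ.valueAt w) •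
      tensorContraction ((G z).map (D : Derivation ℂ 𝒱 𝒱)) (G' w) U := by
    intro U
    rw [tensorContraction_apply]
    simp only [Finset.smul_sum, Matrix.smul_apply, Derivation.map_smul, smul_mul_smul_comm,
        Matrix.map_apply,
      smul_comm (m.φ.valueAt z * m.φ.valueAt w)]
  rw [e, map_add, tensorContraction_swap, map_smul, map_smul, smul_add, smul_smul, smul_smul,
    mul_assoc, mul_comm (m.φ.valueAt w) (m.φ.valueAt z)⁻¹, mul_inv_cancel_left₀ hz.φ_ne_zero,
    mul_assoc, mul_inv_cancel₀ hw.φ_ne_zero, mul_one, m.tensorContraction_R0_add hσ hG hz hzw]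

end TwistModel

/-! ## Calculus of Taylor expansions -/

section TaylorCalculus

/-- The Taylor coefficients at `0` of a scalar function. -/
def scalarTaylor (g : ℂ → ℂ) (r : ℕ) : ℂ := iteratedDeriv r g 0 / (r.factorial : ℂ)

theorem scalarTaylor_mul {f g : ℂ → ℂ} (hf : AnalyticAt ℂ f 0) (hg : AnalyticAt ℂ g 0) (r : ℕ) :
    scalarTaylor (fun z => f z * g z) r =
      ∑ p ∈ Finset.HasAntidiagonal.antidiagonal r, scalarTaylor f p.1 * scalarTaylor g p.2 := by
  rw [scalarTaylor, iteratedDeriv_fun_mul hf.contDiffAt hg.contDiffAt,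
    Finset.Nat.sum_antidiagonal_eq_sum_range_succ_mk, Finset.sum_div]
  refine Finset.sum_congr rfl fun i hi => ?_
  have hi' : i ≤ r := Nat.lt_succ_iff.1 (Finset.mem_range.1 hi)
  have h := Nat.choose_mul_factorial_mul_factorial hi'
  have h' : (r.factorial : ℂ) = r.choose i * i.factorial * (r - i).factorial := by
    rw [← h]; push_cast; ring
  have h1 : (i.factorial : ℂ) ≠ 0 := Nat.cast_ne_zero.2 i.factorial_ne_zero
  have h2 : ((r - i).factorial : ℂ) ≠ 0 := Nat.cast_ne_zero.2 (r - i).factorial_ne_zero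
  have h3 : (r.choose i : ℂ) ≠ 0 := Nat.cast_ne_zero.2 (Nat.choose_pos hi').ne'
  rw [scalarTaylor, scalarTaylor, h']
  field_simp

theorem scalarTaylor_comp_mul (g : ℂ → ℂ) (c : ℂ) (r : ℕ) :
    scalarTaylor (fun z => g (c * z)) r = c ^ r * scalarTaylor g r := by
  have : iteratedDeriv r (fun z => g (c * z)) = fun z => c ^ r * iteratedDeriv r g (c * z) := by
    induction r with
    | zero => simp
    | succ r ih =>
      rw [iteratedDeriv_succ, ih]
      funext z
      rw [deriv_const_mul_field, deriv_comp_mul_left c (iteratedDeriv r g) z, iteratedDeriv_succ,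
        smul_eq_mul, pow_succ, mul_assoc]
  rw [scalarTaylor, this, scalarTaylor, ← mul_div_assoc]
  simp only [mul_zero]

theorem scalarTaylor_const (c : ℂ) (r : ℕ) :
    scalarTaylor (fun _ => c) r = if r = 0 then c else 0 := by
  rw [scalarTaylor, iteratedDeriv_const]
  split_ifs with h
  · simp [h]
  · simp

theorem scalarTaylor_id (r : ℕ) : scalarTaylor (fun z => z) r = if r = 1 then 1 else 0 := by
  rw [scalarTaylor, iteratedDeriv_fun_id]
  rcases r with _ | _ | r <;> simp

theorem scalarTaylor_id_mul {g : ℂ → ℂ} (hg : AnalyticAt ℂ g 0) (r : ℕ) :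
    scalarTaylor (fun z => z * g z) (r + 1) = scalarTaylor g r := by
  rw [scalarTaylor_mul (f := fun z => z) analyticAt_id hg, Finset.sum_eq_single (1, r)]
  · simp [scalarTaylor_id]
  · rintro ⟨i, j⟩ hij hne
    have hij' : i + j = r + 1 := by simpa using hij
    have : i ≠ 1 := by
      rintro rfl
      exact hne (by rw [show j = r by omega])
    rw [scalarTaylor_id, if_neg this, zero_mul]
  · intro h
    exact absurd (by simp [add_comm]) h

variable {M N P : Type*} [AddCommGroup M] [Module ℂ M] [AddCommGroup N] [Module ℂ N]
  [AddCommGroup P] [Module ℂ P]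

theorem HasTaylorAtZero.of_fintype {α : Type*} [Fintype α] {F : ℂ → M} {A : ℕ → M}
    (g : α → ℂ → ℂ) (v : α → M) (hg : ∀ i, AnalyticAt ℂ (g i) 0)
    (hF : ∀ᶠ z in 𝓝[≠] (0 : ℂ), F z = ∑ i, g i z • v i)
    (hA : ∀ r, A r = ∑ i, scalarTaylor (g i) r • v i) : HasTaylorAtZero F A := by
  let e := (Fintype.equivFin α).symm
  refine ⟨Fintype.card α, fun i => g (e i), fun i => v (e i), fun i => hg _, ?_, fun r => ?_⟩
  · filter_upwards [hF] with z hz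
    rw [hz, ← e.sum_comp]
  · rw [hA, ← e.sum_comp]
    rfl

theorem AnalyticAt.hasTaylorAtZero {g : ℂ → ℂ} (hg : AnalyticAt ℂ g 0) :
    HasTaylorAtZero g (scalarTaylor g) :=
  .of_fintype (α := Unit) (fun _ => g) (fun _ => 1) (fun _ => hg) (by simp) (by simp)

namespace HasTaylorAtZero

variable {F F' : ℂ → M} {A A' : ℕ → M}

theorem congr (h : HasTaylorAtZero F A) (h' : ∀ᶠ z in 𝓝[≠] (0 : ℂ), F z = F' z) :
    HasTaylorAtZero F' A := by
  obtain ⟨k, g, v, hg, hF, hA⟩ := h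
  refine ⟨k, g, v, hg, ?_, hA⟩
  filter_upwards [hF, h'] with z hz hz'
  rw [← hz', hz]

theorem map (h : HasTaylorAtZero F A) (f : M →ₗ[ℂ] N) :
    HasTaylorAtZero (fun z => f (F z)) fun r => f (A r) := by
  obtain ⟨k, g, v, hg, hF, hA⟩ := h
  refine ⟨k, g, fun i => f (v i), hg, ?_, fun r => ?_⟩
  · filter_upwards [hF] with z hz
    simp [hz, map_sum]
  · simp [hA, map_sum]

theorem add (h : HasTaylorAtZero F A) (h' : HasTaylorAtZero F' A') :
    HasTaylorAtZero (fun z => F z + F' z) fun r => A r + A' r := by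
  obtain ⟨k, g, v, hg, hF, hA⟩ := h
  obtain ⟨k', g', v', hg', hF', hA'⟩ := h'
  refine of_fintype (α := Fin k ⊕ Fin k') (Sum.elim g g') (Sum.elim v v') ?_ ?_ fun r => ?_
  · rintro (i | i)
    exacts [hg i, hg' i]
  · filter_upwards [hF, hF'] with z hz hz'
    simp [hz, hz']
  · rw [hA, hA', Fintype.sum_sum_type]
    rfl

theorem const (v : M) : HasTaylorAtZero (fun _ => v) fun r => if r = 0 then v else 0 :=
  of_fintype (α := Unit) (fun _ _ => 1) (fun _ => v) (fun _ => analyticAt_const) (by simp)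
    (fun r => by simp [scalarTaylor_const])

theorem zero : HasTaylorAtZero (fun _ => (0 : M)) fun _ => 0 := by
  simpa using const (0 : M)

theorem sum {α : Type*} (s : Finset α) {F : α → ℂ → M} {A : α → ℕ → M}
    (h : ∀ a ∈ s, HasTaylorAtZero (F a) (A a)) :
    HasTaylorAtZero (fun z => ∑ a ∈ s, F a z) fun r => ∑ a ∈ s, A a r := by
  classical
  induction s using Finset.induction_on with
  | empty => simpa using zero
  | insert a s ha ih =>
    simp only [Finset.sum_insert ha]
    exact (h a (Finset.mem_insert_self a s)).add
      (ih fun b hb => h b (Finset.mem_insert_of_mem hb))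

theorem bilin (β : M →ₗ[ℂ] N →ₗ[ℂ] P) {G : ℂ → N} {B : ℕ → N} (h : HasTaylorAtZero F A)
    (h' : HasTaylorAtZero G B) : HasTaylorAtZero (fun z => β (F z) (G z))
      fun r => ∑ p ∈ Finset.HasAntidiagonal.antidiagonal r, β (A p.1) (B p.2) := by
  obtain ⟨k, g, v, hg, hF, hA⟩ := h
  obtain ⟨k', g', v', hg', hF', hA'⟩ := h'
  refine of_fintype (α := Fin k × Fin k') (fun p z => g p.1 z * g' p.2 z)
    (fun p => β (v p.1) (v' p.2)) (fun p => (hg _).mul (hg' _)) ?_ fun r => ?_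
  · filter_upwards [hF, hF'] with z hz hz'
    simp only [hz, hz', map_sum, map_smul, LinearMap.sum_apply, LinearMap.smul_apply,
      Fintype.sum_prod_type, Finset.smul_sum, smul_smul]
    rw [Finset.sum_comm]
    simp only [mul_comm]
  · simp only [scalarTaylor_mul (hg _) (hg' _), Finset.sum_smul]
    rw [Finset.sum_comm]
    refine Finset.sum_congr rfl fun q _ => ?_
    rw [hA, hA']
    simp only [scalarTaylor, map_sum, map_smul, LinearMap.sum_apply, LinearMap.smul_apply,
      Fintype.sum_prod_type, Finset.smul_sum, smul_smul]
    rw [Finset.sum_comm]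
    simp only [mul_comm]

theorem comp_mul (h : HasTaylorAtZero F A) {c : ℂ} (hc : c ≠ 0) :
    HasTaylorAtZero (fun z => F (c * z)) fun r => c ^ r • A r := by
  obtain ⟨k, g, v, hg, hF, hA⟩ := h
  refine ⟨k, fun i z => g i (c * z), v, fun i => ?_, ?_, fun r => ?_⟩
  · exact AnalyticAt.comp_of_eq (hg i) (analyticAt_const.mul analyticAt_id) (by simp)
  · have ht : Filter.Tendsto (fun z : ℂ => c * z) (𝓝[≠] 0) (𝓝[≠] 0) := by
      refine tendsto_nhdsWithin_of_tendsto_nhds_of_eventually_within _ ?_ ?_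
      · have : Filter.Tendsto (fun z : ℂ => c * z) (𝓝 0) (𝓝 (c * 0)) :=
          (continuous_const.mul continuous_id).tendsto 0
        rw [mul_zero] at this
        exact this.mono_left nhdsWithin_le_nhds
      · filter_upwards [self_mem_nhdsWithin] with z hz
        exact mul_ne_zero hc hz
    exact ht.eventually hF
  · change c ^ r • A r = ∑ i, scalarTaylor (fun z => g i (c * z)) r • v i
    rw [hA, Finset.smul_sum]
    refine Finset.sum_congr rfl fun i _ => ?_
    rw [scalarTaylor_comp_mul, smul_smul]
    rfl

/-- The coordinate functions need not vanish at 0, since the vectors may be dependent. Each is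
replaced by its difference quotient, and the discarded constants add up to A 0 = 0. -/
theorem inv_smul (h : HasTaylorAtZero F A) (h0 : A 0 = 0) :
    HasTaylorAtZero (fun z => z⁻¹ • F z) fun r => A (r + 1) := by
  obtain ⟨k, g, v, hg, hF, hA⟩ := h
  have hd : ∀ i, AnalyticAt ℂ (dslope (g i) 0) 0 := by
    intro i
    obtain ⟨p, hp⟩ := hg i
    exact ⟨_, hp.has_fpower_series_dslope_fslope⟩
  have hg0 : ∑ i, g i 0 • v i = 0 := by
    rw [← h0, hA]
    simp
  have hgd : ∀ i, (fun z => z * dslope (g i) 0 z + g i 0) = g i := by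
    intro i
    funext z
    have := sub_smul_dslope (g i) 0 z
    rw [sub_zero, smul_eq_mul] at this
    rw [this, sub_add_cancel]
  refine ⟨k, fun i => dslope (g i) 0, v, hd, ?_, fun r => ?_⟩
  · filter_upwards [hF, self_mem_nhdsWithin] with z hz hz0
    have hz0' : z ≠ 0 := hz0
    rw [hz, inv_smul_eq_iff₀ hz0', Finset.smul_sum, ← sub_eq_zero, ← Finset.sum_sub_distrib,
      ← hg0]
    refine Finset.sum_congr rfl fun i _ => ?_
    have := congrFun (hgd i) z
    rw [← this, smul_smul, add_smul]
    simp
  · change A (r + 1) = _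
    rw [hA]
    refine Finset.sum_congr rfl fun i _ => ?_
    congr 1
    change scalarTaylor (g i) (r + 1) = scalarTaylor (dslope (g i) 0) r
    rw [← scalarTaylor_id_mul (hd i)]
    conv_lhs => rw [← hgd i]
    have han : AnalyticAt ℂ (fun z => z * dslope (g i) 0 z) 0 :=
      (analyticAt_id (𝕜 := ℂ) (z := (0 : ℂ))).mul (hd i)
    rw [scalarTaylor, scalarTaylor, iteratedDeriv_fun_add han.contDiffAt
      (analyticAt_const (v := g i 0)).contDiffAt, iteratedDeriv_const]
    simp

theorem eq_of_eventuallyEq (h : HasTaylorAtZero F A) (h' : HasTaylorAtZero F' A')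
    (he : ∀ᶠ z in 𝓝[≠] (0 : ℂ), F z = F' z) (r : ℕ) : A r = A' r :=
  congrFun ((h.congr he).unique h') r

end HasTaylorAtZero

/-- The Taylor coefficients in `w` of the difference quotient `(φ z - φ w) / (z - w)`. -/
def quotientTaylor (φ : ℂ → ℂ) : ℕ → ℂ → ℂ
  | 0 => fun z => z⁻¹ * (φ z - scalarTaylor φ 0)
  | r + 1 => fun z => z⁻¹ * (quotientTaylor φ r z - scalarTaylor φ (r + 1))

theorem hasTaylorAtZero_quotientTaylor {φ : ℂ → ℂ} (hφ : AnalyticAt ℂ φ 0) (r : ℕ) :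
    HasTaylorAtZero (quotientTaylor φ r) fun s => scalarTaylor φ (r + s + 1) := by
  have key : ∀ {F : ℂ → ℂ} {A : ℕ → ℂ}, HasTaylorAtZero F A →
      HasTaylorAtZero (fun z => z⁻¹ * (F z - A 0)) fun s => A (s + 1) := by
    intro F A h
    have h1 := h.add (HasTaylorAtZero.const (-A 0))
    have h2 := h1.inv_smul (by simp)
    simpa [sub_eq_add_neg] using h2
  induction r with
  | zero => simpa [quotientTaylor] using key hφ.hasTaylorAtZero
  | succ r ih =>
    have := key ih
    simp only [add_zero] at this
    refine (show (fun s => scalarTaylor φ (r + 1 + s + 1)) = _ from ?_) ▸ this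
    funext s
    congr 1
    ring

theorem analyticAt_quotient {φ : ℂ → ℂ} (hφ : AnalyticAt ℂ φ 0) {z : ℂ} (hz : z ≠ 0) :
    AnalyticAt ℂ (fun w => (φ z - φ w) * (w - z)⁻¹) 0 :=
  (analyticAt_const.sub hφ).mul ((analyticAt_id.sub analyticAt_const).inv (by simpa using hz))

/-- Comparing coefficients in (w - z)h(w) = φ(z) - φ(w) gives -z h₀ = φ(z) - φ₀ and hᵣ - z hᵣ₊₁ =
-φᵣ₊₁, the recursion of `quotientTaylor` up to sign. -/
theorem scalarTaylor_quotient {φ : ℂ → ℂ} (hφ : AnalyticAt ℂ φ 0) {z : ℂ} (hz : z ≠ 0) (r : ℕ) :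
    scalarTaylor (fun w => (φ z - φ w) * (w - z)⁻¹) r = -quotientTaylor φ r z := by
  set h := fun w => (φ z - φ w) * (w - z)⁻¹ with hdef
  have hh : AnalyticAt ℂ h 0 := analyticAt_quotient hφ hz
  have e1 : HasTaylorAtZero (fun w => w * h w + -z * h w) _ :=
    ((analyticAt_id (𝕜 := ℂ) (z := (0 : ℂ))).mul hh).hasTaylorAtZero.add
      (hh.hasTaylorAtZero.map (LinearMap.mulLeft ℂ (-z)))
  have e2 : HasTaylorAtZero (fun w => φ z + (-1) * φ w) _ :=
    (HasTaylorAtZero.const (φ z)).add (hφ.hasTaylorAtZero.map (LinearMap.mulLeft ℂ (-1)))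
  have hne : ∀ᶠ w in 𝓝[≠] (0 : ℂ), w ≠ z :=
    nhdsWithin_le_nhds (isOpen_ne.mem_nhds hz.symm)
  have e := e1.eq_of_eventuallyEq e2 (by
    filter_upwards [hne] with w hw
    have : w - z ≠ 0 := sub_ne_zero.2 hw
    rw [hdef]
    field_simp
    ring)
  simp only [LinearMap.mulLeft_apply] at e
  induction r with
  | zero =>
    have e0 := e 0
    have : scalarTaylor (id * h) 0 = 0 := by simp [scalarTaylor]
    rw [this, if_pos rfl] at e0
    rw [quotientTaylor, eq_neg_iff_add_eq_zero]
    field_simp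
    linear_combination -e0
  | succ r ih =>
    have e0 := e (r + 1)
    have : scalarTaylor (id * h) (r + 1) = scalarTaylor h r := scalarTaylor_id_mul hh r
    rw [this, if_neg r.succ_ne_zero, ih] at e0
    rw [quotientTaylor, eq_neg_iff_add_eq_zero]
    field_simp
    linear_combination -e0

/-- The coefficients in `w` of `(φ z - φ w) / (w - z) • β (F z) (G w)`. -/
theorem hasTaylorAtZero_kernel {φ : ℂ → ℂ} (hφ : AnalyticAt ℂ φ 0) (β : M →ₗ[ℂ] N →ₗ[ℂ] P) (u : M)
    {G : ℂ → N} {B : ℕ → N} (hG : HasTaylorAtZero G B) {z : ℂ} (hz : z ≠ 0) :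
    HasTaylorAtZero (fun w => ((φ z - φ w) * (w - z)⁻¹) • β u (G w)) fun r =>
      ∑ p ∈ Finset.HasAntidiagonal.antidiagonal r, (-quotientTaylor φ p.1 z) • β u (B p.2) := by
  have := (analyticAt_quotient hφ hz).hasTaylorAtZero.bilin (LinearMap.lsmul ℂ P) (hG.map (β u))
  simpa only [scalarTaylor_quotient hφ hz, LinearMap.lsmul_apply] using this

/-- The coefficients in `z` of the coefficients in `w` of
`(φ z - φ w) / (w - z) • β (F z) (G w)`. -/
theorem hasTaylorAtZero_kernel_coeff {φ : ℂ → ℂ} (hφ : AnalyticAt ℂ φ 0)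
    (β : M →ₗ[ℂ] N →ₗ[ℂ] P) {F : ℂ → M} {A : ℕ → M} (hF : HasTaylorAtZero F A) (B : ℕ → N) (r : ℕ) :
    HasTaylorAtZero
      (fun z => ∑ p ∈ Finset.HasAntidiagonal.antidiagonal r,
        (-quotientTaylor φ p.1 z) • β (F z) (B p.2)) fun s =>
      ∑ p ∈ Finset.HasAntidiagonal.antidiagonal r, ∑ q ∈ Finset.HasAntidiagonal.antidiagonal s,
        (-scalarTaylor φ (p.1 + q.1 + 1)) • β (A q.2) (B p.2) := by
  refine HasTaylorAtZero.sum _ fun p _ => ?_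
  have h := (hasTaylorAtZero_quotientTaylor hφ p.1).bilin (-LinearMap.lsmul ℂ P)
    (hF.map (β.flip (B p.2)))
  simpa using h

end TaylorCalculus

/-! ## The bracket of the densities extracted at the origin -/

namespace TwistModel

open PoissonVertexAlgebra

variable {t : ClassicalType} {𝒱 : Type*} [CommRing 𝒱] [Algebra ℂ 𝒱] [PoissonVertexAlgebra 𝒱]
  (m : TwistModel t 𝒱)

theorem denom_eval_zero_ne_zero (h0 : m.φ.num.IsRoot 0) : m.φ.denom.eval 0 ≠ 0 := by
  intro h
  obtain ⟨a, b, hab⟩ := m.φ.isCoprime_num_denom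
  have := congrArg (Polynomial.eval 0) hab
  rw [Polynomial.eval_add, Polynomial.eval_mul, Polynomial.eval_mul, h, h0.eq_zero, mul_zero,
    mul_zero, add_zero, Polynomial.eval_one] at this
  exact zero_ne_one this

theorem analyticAt_φ (h0 : m.φ.num.IsRoot 0) : AnalyticAt ℂ m.φ.valueAt 0 := by
  have hpoly : ∀ p : ℂ[X], AnalyticAt ℂ (fun z => p.eval z) 0 := fun p =>
    p.differentiable.analyticAt 0
  exact (hpoly _).div (hpoly _) (m.denom_eval_zero_ne_zero h0)

/-- Equivariance gives ωʳφᵣ = ω⁻¹φᵣ. -/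
theorem scalarTaylor_φ_eq_zero (h0 : m.φ.num.IsRoot 0) {r : ℕ} (hr : ¬ m.T ∣ r + 1) :
    scalarTaylor m.φ.valueAt r = 0 := by
  have hφ := m.analyticAt_φ h0
  have h1 := scalarTaylor_comp_mul m.φ.valueAt m.ω r
  have h2 := (hφ.hasTaylorAtZero.map (LinearMap.mulLeft ℂ m.ω⁻¹)).unique
    ((hφ.hasTaylorAtZero.comp_mul m.ω_ne_zero).congr
      (Filter.Eventually.of_forall fun z => m.φ_equivariant z))
  have h3 := congrFun h2 r
  simp only [LinearMap.mulLeft_apply, smul_eq_mul] at h3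
  have hω := m.ω_ne_zero
  have h4 : (m.ω ^ (r + 1) - 1) * scalarTaylor m.φ.valueAt r = 0 := by
    rw [pow_succ, sub_mul, one_mul, mul_right_comm, ← h3]
    field_simp
    ring
  refine (mul_eq_zero.1 h4).resolve_left fun h => hr ?_
  exact (m.isPrimitiveRoot.pow_eq_one_iff_dvd _).1 (sub_eq_zero.1 h)

theorem tendsto_mul_punctured {c : ℂ} (hc : c ≠ 0) :
    Filter.Tendsto (fun z : ℂ => c * z) (𝓝[≠] 0) (𝓝[≠] 0) := by
  refine tendsto_nhdsWithin_of_tendsto_nhds_of_eventually_within _ ?_ ?_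
  · have : Filter.Tendsto (fun z : ℂ => c * z) (𝓝 0) (𝓝 (c * 0)) :=
      (continuous_const.mul continuous_id).tendsto 0
    rw [mul_zero] at this
    exact this.mono_left nhdsWithin_le_nhds
  · filter_upwards [self_mem_nhdsWithin] with z hz
    exact mul_ne_zero hc hz

theorem eventually_isGood : ∀ᶠ z in 𝓝[≠] (0 : ℂ), m.IsGood z := by
  have hpoly : ∀ p : ℂ[X], p ≠ 0 → ∀ᶠ z in 𝓝[≠] (0 : ℂ), p.eval z ≠ 0 := by
    intro p hp
    have h : AnalyticAt ℂ (fun z => p.eval z) 0 := p.differentiable.analyticAt 0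
    refine h.eventually_eq_zero_or_eventually_ne_zero.resolve_left fun h' => hp ?_
    have hfin := Polynomial.finite_setOfPred_isRoot hp
    exact absurd hfin (infinite_of_mem_nhds (0 : ℂ) h')
  have hpoles : ∀ k < m.T, ∀ᶠ z in 𝓝[≠] (0 : ℂ), m.ω ^ k * z ∉ m.poles := fun k _ =>
    (tendsto_mul_punctured (pow_ne_zero k m.ω_ne_zero)).eventually (m.isolated_poles 0)
  filter_upwards [self_mem_nhdsWithin, hpoly _ (RatFunc.num_ne_zero m.φ_ne_zero),
    hpoly _ m.φ.denom_ne_zero, (Filter.eventually_all_finite (Set.finite_lt_nat m.T)).2 hpoles]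
    with z hz h1 h2 h3
  refine ⟨hz, div_ne_zero h1 h2, fun k => ?_⟩
  have h := h3 (k % m.T) (Nat.mod_lt _ m.T_pos)
  rwa [← pow_eq_pow_mod k m.isPrimitiveRoot.pow_eq_one] at h

theorem dvd_r_add (n : ℕ) : m.T ∣ n * m.kappa + m.r n := by
  have hT : (m.T : ℤ) ≠ 0 := by exact_mod_cast m.T_pos.ne'
  have h1 : ((m.r n : ℕ) : ℤ) = (-((n : ℤ) * (m.kappa : ℤ))) % (m.T : ℤ) :=
    Int.toNat_of_nonneg (Int.emod_nonneg _ hT)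
  have h2 : (m.T : ℤ) ∣ (n * m.kappa : ℤ) + m.r n := by
    rw [h1]
    have := Int.emod_add_mul_ediv (-((n : ℤ) * (m.kappa : ℤ))) (m.T : ℤ)
    refine ⟨-(-((n : ℤ) * (m.kappa : ℤ)) / (m.T : ℤ)), ?_⟩
    linarith
  exact_mod_cast h2

theorem r_lt (n : ℕ) : m.r n < m.T := by
  have hT : (0 : ℤ) < (m.T : ℤ) := by exact_mod_cast m.T_pos
  have h1 : ((m.r n : ℕ) : ℤ) = (-((n : ℤ) * (m.kappa : ℤ))) % (m.T : ℤ) :=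
    Int.toNat_of_nonneg (Int.emod_nonneg _ hT.ne')
  have h2 := Int.emod_lt_of_pos (-((n : ℤ) * (m.kappa : ℤ))) hT
  rw [← h1] at h2
  exact_mod_cast h2

theorem r_add_two_le {n : ℕ} (hn : n ∈ m.E0) : m.r n + 2 ≤ m.T := by
  have := m.r_lt n
  have := hn.2
  omega

theorem K0_eq {n : ℕ} {A : ℕ → 𝒱} (h : HasTaylorAtZero (m.W n) A) : m.K0 n = A (m.r n) :=
  h.taylorCoeff_eq _

/-- The bracket of the two densities as a double sum over the coefficients. -/
theorem integratedBr_K0_eq_sum (h0 : m.φ.num.IsRoot 0) (hσ : PreservesTraceForm m.σ) {n k : ℕ}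
    (hWn : HolomorphicAtZero (m.W n)) (hWk : HolomorphicAtZero (m.W k))
    {G G' : ℂ → Matrix t.Index t.Index 𝒱} (hG : m.IsGradient n G) (hG' : m.IsGradient k G')
    {A B : ℕ → Matrix t.Index t.Index 𝒱} (hA : HasTaylorAtZero G A) (hB : HasTaylorAtZero G' B) :
    integratedBr (m.K0 n) (m.K0 k) =
      ∑ p ∈ Finset.HasAntidiagonal.antidiagonal (m.r k),
        ∑ q ∈ Finset.HasAntidiagonal.antidiagonal (m.r n),
          (-scalarTaylor m.φ.valueAt (p.1 + q.1 + 1)) • m.derivPairing (A q.2) (B p.2) := by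
  obtain ⟨An, hAn⟩ := hWn
  obtain ⟨Ak, hAk⟩ := hWk
  have hφ := m.analyticAt_φ h0
  have hω : ∀ j : ℕ, (m.ω ^ j)⁻¹ ≠ 0 := fun j => inv_ne_zero (pow_ne_zero j m.ω_ne_zero)
  rw [m.K0_eq hAn, m.K0_eq hAk]
  -- The coefficient of wʳ in a single kernel. The expansion is done in w at fixed z ≠ 0 and only
  -- afterwards in z, so one-variable Taylor calculus suffices.
  let E : ℕ → ℂ → 𝒱 := fun r z => ∑ p ∈ Finset.HasAntidiagonal.antidiagonal r,
    (-quotientTaylor m.φ.valueAt p.1 z) • m.derivPairing (G z) (B p.2)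
  let R : ℂ → ℂ → 𝒱 := fun z w =>
    (m.T : ℂ)⁻¹ • ∑ j ∈ Finset.range m.T, (m.ω⁻¹) ^ (j * (n * m.kappa)) •
      ((m.φ.valueAt ((m.ω ^ j)⁻¹ * z) - m.φ.valueAt w) * (w - (m.ω ^ j)⁻¹ * z)⁻¹) •
        m.derivPairing (G ((m.ω ^ j)⁻¹ * z)) (G' w)
  have step1 : ∀ z, m.IsGood z → ∀ r, integratedBr (m.W n z) (Ak r) =
      (m.T : ℂ)⁻¹ • ∑ j ∈ Finset.range m.T, (m.ω⁻¹) ^ (j * (n * m.kappa)) •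
        E r ((m.ω ^ j)⁻¹ * z) := by
    intro z hz
    have hR : HasTaylorAtZero (R z) fun r =>
        (m.T : ℂ)⁻¹ • ∑ j ∈ Finset.range m.T, (m.ω⁻¹) ^ (j * (n * m.kappa)) •
          E r ((m.ω ^ j)⁻¹ * z) :=
      (HasTaylorAtZero.sum _ fun j _ => (hasTaylorAtZero_kernel hφ m.derivPairing
        (G ((m.ω ^ j)⁻¹ * z)) hB (mul_ne_zero (hω j) hz.ne_zero)).map
          (LinearMap.lsmul ℂ 𝒱 ((m.ω⁻¹) ^ (j * (n * m.kappa))))).map (LinearMap.lsmul ℂ 𝒱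
            (m.T : ℂ)⁻¹)
    refine (hAk.map (integratedBr (m.W n z))).eq_of_eventuallyEq hR ?_
    have hne : ∀ᶠ w in 𝓝[≠] (0 : ℂ), z ^ m.T ≠ w ^ m.T := by
      refine nhdsWithin_le_nhds ?_
      have hcont : Continuous fun w : ℂ => w ^ m.T := continuous_pow _
      refine (isOpen_ne_fun continuous_const hcont).mem_nhds ?_
      change z ^ m.T ≠ 0 ^ m.T
      rw [zero_pow m.T_pos.ne']
      exact pow_ne_zero _ hz.ne_zero
    filter_upwards [m.eventually_isGood, hne] with w hw hzw
    exact m.integratedBr_W hσ hG hG' hz hw hzw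
  have hE := fun r => hasTaylorAtZero_kernel_coeff hφ m.derivPairing hA B r
  have h1 := hAn.map (integratedBr.flip (Ak (m.r k)))
  have h2 := (HasTaylorAtZero.sum (Finset.range m.T) fun j _ => ((hE (m.r k)).comp_mul (hω j)).map
    (LinearMap.lsmul ℂ 𝒱 ((m.ω⁻¹) ^ (j * (n * m.kappa))))).map (LinearMap.lsmul ℂ 𝒱 (m.T : ℂ)⁻¹)
  have h3 := h1.eq_of_eventuallyEq h2 (by
    filter_upwards [m.eventually_isGood] with z hz
    exact step1 z hz _) (m.r n)
  rw [LinearMap.flip_apply] at h3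
  rw [h3]
  -- This is what the choice of rₙ achieves: the T orbit terms are equal and the prefactor 1/T
  -- averages them.
  have hone : ∀ j : ℕ, (m.ω⁻¹) ^ (j * (n * m.kappa)) * ((m.ω ^ j)⁻¹) ^ m.r n = 1 := by
    intro j
    obtain ⟨c, hc⟩ := m.dvd_r_add n
    rw [← inv_pow, ← pow_mul, ← pow_add, ← mul_add, hc, mul_left_comm, pow_mul, inv_pow,
      m.isPrimitiveRoot.pow_eq_one, inv_one, one_pow]
  simp only [LinearMap.lsmul_apply, smul_smul _ _ (Finset.sum _ _), hone, one_smul,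
    Finset.sum_const, Finset.card_range]
  rw [← Nat.cast_smul_eq_nsmul ℂ, smul_smul, inv_mul_cancel₀ (Nat.cast_ne_zero.2 m.T_pos.ne'),
    one_smul]

/-- In the double sum only one coefficient of `φ` survives. -/
theorem integratedBr_K0_mem (h0 : m.φ.num.IsRoot 0) (hσ : PreservesTraceForm m.σ) {n k : ℕ}
    (hn : n ∈ m.E0) (hk : k ∈ m.E0)
    (hWn : HolomorphicAtZero (m.W n)) (hWk : HolomorphicAtZero (m.W k))
    {G G' : ℂ → Matrix t.Index t.Index 𝒱} (hG : m.IsGradient n G) (hG' : m.IsGradient k G')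
    {A : ℕ → 𝒱} (hA : HasTaylorAtZero (fun z => m.derivPairing (G z) (G' z)) A)
    (hmem : ∀ s ≤ m.r n, A s ∈ totalDerivatives 𝒱) :
    integratedBr (m.K0 n) (m.K0 k) ∈ totalDerivatives 𝒱 := by
  obtain ⟨a, ha⟩ := hG.holomorphic
  obtain ⟨b, hb⟩ := hG'.holomorphic
  have hs : ∀ s, A s = ∑ p ∈ Finset.HasAntidiagonal.antidiagonal s,
      m.derivPairing (a p.1) (b p.2) :=
    fun s => congrFun (hA.unique (ha.bilin m.derivPairing hb)) s
  rw [m.integratedBr_K0_eq_sum h0 hσ hWn hWk hG hG' ha hb, ← Finset.sum_product']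
  have hrn := m.r_add_two_le hn
  have hrk := m.r_add_two_le hk
  -- A nonzero coefficient of φ requires T to divide i + i' + 2, and 0 < i + i' + 2 ≤ rₙ + rₖ + 2 <
  -- 2T leaves T as the only multiple.
  have hzero : ∀ x ∈ Finset.HasAntidiagonal.antidiagonal (m.r k) ×ˢ
      Finset.HasAntidiagonal.antidiagonal (m.r n), x.1.1 + x.2.1 + 2 ≠ m.T →
      (-scalarTaylor m.φ.valueAt (x.1.1 + x.2.1 + 1)) • m.derivPairing (a x.2.2) (b x.1.2) = 0 := by
    rintro ⟨⟨i, j⟩, ⟨i', j'⟩⟩ hx hne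
    simp only [Finset.mem_product, Finset.HasAntidiagonal.mem_antidiagonal] at hx
    rw [m.scalarTaylor_φ_eq_zero h0, neg_zero, zero_smul]
    rintro ⟨c, hc⟩
    have hc1 : c < 2 := by
      by_contra h2
      have : m.T * 2 ≤ m.T * c := Nat.mul_le_mul_left _ (not_lt.1 h2)
      simp only at hc
      omega
    interval_cases c
    · omega
    · apply hne
      simp only at hc ⊢
      omega
  by_cases hle : m.T ≤ m.r n + m.r k + 2
  · have hval : ∑ x ∈ Finset.HasAntidiagonal.antidiagonal (m.r k) ×ˢ
        Finset.HasAntidiagonal.antidiagonal (m.r n),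
        (-scalarTaylor m.φ.valueAt (x.1.1 + x.2.1 + 1)) • m.derivPairing (a x.2.2) (b x.1.2) =
        (-scalarTaylor m.φ.valueAt (m.T - 1)) • A (m.r n + m.r k + 2 - m.T) := by
      rw [hs, Finset.smul_sum, ← Finset.sum_filter_of_ne (p := fun x => x.1.1 + x.2.1 + 2 = m.T)
        (fun x hx hne => by_contra fun h => hne (hzero x hx h))]
      -- With i + i' = T - 2 fixed, the indices j' and j of the gradients determine everything and
      -- have the constant sum rₙ + rₖ + 2 - T.
      refine Finset.sum_bij' (fun x _ => (x.2.2, x.1.2))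
        (fun p _ => ((m.r k - p.2, p.2), (m.r n - p.1, p.1))) ?_ ?_ ?_ ?_ ?_
      · rintro ⟨⟨i, j⟩, ⟨i', j'⟩⟩ hx
        simp only [Finset.mem_filter, Finset.mem_product,
            Finset.HasAntidiagonal.mem_antidiagonal] at hx ⊢
        omega
      · rintro ⟨i, j⟩ hx
        simp only [Finset.mem_filter, Finset.mem_product,
            Finset.HasAntidiagonal.mem_antidiagonal] at hx ⊢
        omega
      · rintro ⟨⟨i, j⟩, ⟨i', j'⟩⟩ hx
        simp only [Finset.mem_filter, Finset.mem_product,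
            Finset.HasAntidiagonal.mem_antidiagonal] at hx
        refine Prod.ext (Prod.ext ?_ rfl) (Prod.ext ?_ rfl) <;> dsimp only <;> omega
      · rintro ⟨i, j⟩ _
        rfl
      · rintro ⟨⟨i, j⟩, ⟨i', j'⟩⟩ hx
        simp only [Finset.mem_filter, Finset.mem_product,
            Finset.HasAntidiagonal.mem_antidiagonal] at hx
        rw [show i + i' + 1 = m.T - 1 by omega]
    rw [hval]
    -- The order is at most rₙ because rₖ + 2 ≤ T.
    exact Submodule.smul_mem _ _ (hmem _ (by omega))
  · rw [Finset.sum_eq_zero fun x hx => hzero x hx ?_]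
    · exact Submodule.zero_mem _
    · intro hx'
      simp only [Finset.mem_product, Finset.HasAntidiagonal.mem_antidiagonal] at hx
      omega

end TwistModel

/-! ## Derivations and traces of powers of a matrix -/

section MatrixDerivation

variable {ι : Type*} {𝒱 : Type*} [CommRing 𝒱] [Algebra ℂ 𝒱] (δ : Derivation ℂ 𝒱 𝒱)

theorem Matrix.map_derivation_mul [Fintype ι] (A B : Matrix ι ι 𝒱) :
    (A * B).map δ = A.map δ * B + A * B.map δ := by
  ext i j
  simp only [Matrix.map_apply, Matrix.mul_apply, Matrix.add_apply, map_sum, Derivation.leibniz,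
    smul_eq_mul, Finset.sum_add_distrib]
  rw [add_comm]
  simp only [mul_comm]

theorem Matrix.map_derivation_smul (c : 𝒱) (A : Matrix ι ι 𝒱) :
    (c • A).map δ = δ c • A + c • A.map δ := by
  ext i j
  simp only [Matrix.map_apply, Matrix.smul_apply, Matrix.add_apply, Derivation.leibniz,
    smul_eq_mul]
  ring

theorem Matrix.map_derivation_smul' (c : ℂ) (A : Matrix ι ι 𝒱) :
    (c • A).map δ = c • A.map δ := by
  ext i j
  simp

theorem Matrix.trace_map_derivation [Fintype ι] (A : Matrix ι ι 𝒱) : (A.map δ).trace = δ A.trace := by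
  simp [Matrix.trace, map_sum]

theorem Matrix.map_derivation_one [DecidableEq ι] : (1 : Matrix ι ι 𝒱).map δ = 0 := by
  ext i j
  rw [Matrix.map_apply, Matrix.one_apply]
  split_ifs <;> simp

variable [Fintype ι] [DecidableEq ι]

theorem Matrix.trace_map_derivation_pow_mul (X : Matrix ι ι 𝒱) (n k : ℕ) :
    ((X ^ n).map δ * X ^ k).trace = (n : 𝒱) * (X ^ (n - 1 + k) * X.map δ).trace := by
  induction n generalizing k with
  | zero => simp [Matrix.map_derivation_one]
  | succ n ih =>
    rw [pow_succ, Matrix.map_derivation_mul, add_mul, Matrix.trace_add, mul_assoc, ← pow_succ', ih,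
      mul_assoc, ← mul_assoc, Matrix.trace_mul_comm (X ^ n * _), ← mul_assoc, ← pow_add,
      Nat.add_sub_cancel, add_comm k n]
    rcases n with _ | n
    · simp
    · rw [Nat.add_sub_cancel, show n + (k + 1) = n + 1 + k by ring]
      push_cast
      ring

theorem Matrix.derivation_trace_pow (X : Matrix ι ι 𝒱) (n : ℕ) :
    δ (X ^ n).trace = (n : 𝒱) * (X ^ (n - 1) * X.map δ).trace := by
  have := Matrix.trace_map_derivation_pow_mul δ X n 0
  rwa [pow_zero, mul_one, Matrix.trace_map_derivation, add_zero] at this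

end MatrixDerivation

/-! ## The generating series of the densities in the twisted case -/

section GeneratingSeries

open Finset.HasAntidiagonal (antidiagonal)

variable {𝒱 : Type*} [CommRing 𝒱] [Algebra ℂ 𝒱]

/-- The coefficients of `exp (- p ∑_{k ≥ 2} μᵏ / k * tₖ)`. -/
def expCoeff (p : ℂ) (t : ℕ → 𝒱) (j : ℕ) : 𝒱 :=
  PowerSeries.coeff j (PowerSeries.subst
    (PowerSeries.mk fun k => if 2 ≤ k then (-p / (k : ℂ)) • t k else 0)
    (PowerSeries.exp ℂ) : PowerSeries 𝒱)

theorem natCast_smul_cancel {k : ℕ} {a b : 𝒱} (h : (k + 1) • a = (k + 1) • b) : a = b := by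
  rw [← Nat.cast_smul_eq_nsmul ℂ, ← Nat.cast_smul_eq_nsmul ℂ] at h
  have hk : ((k + 1 : ℕ) : ℂ) ≠ 0 := Nat.cast_ne_zero.2 k.succ_ne_zero
  exact (smul_right_injective 𝒱 hk h :)

/-- Coefficients of the differential equation F' = (logarithmic derivative) · F of the exponential.
With t₁ = 0, omitting k = 1 from the exponent is harmless. -/
theorem expCoeff_zero_and_succ (p : ℂ) (t : ℕ → 𝒱) (ht : t 1 = 0) :
    expCoeff p t 0 = 1 ∧ ∀ j, (j + 1) • expCoeff p t (j + 1) =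
      -p • ∑ q ∈ Finset.HasAntidiagonal.antidiagonal j, t (q.1 + 1) * expCoeff p t q.2 := by
  let _ : Algebra ℚ 𝒱 := ((algebraMap ℂ 𝒱).comp (algebraMap ℚ ℂ)).toAlgebra
  set F : PowerSeries 𝒱 := PowerSeries.mk fun k => if 2 ≤ k then (-p / (k : ℂ)) • t k else 0
    with hF
  have hF0 : PowerSeries.constantCoeff F = 0 := by
    rw [← PowerSeries.coeff_zero_eq_constantCoeff_apply, hF, PowerSeries.coeff_mk]
    simp
  have hsub : PowerSeries.HasSubst F := PowerSeries.HasSubst.of_constantCoeff_zero' hF0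
  have he : PowerSeries.subst F (PowerSeries.exp ℂ) = PowerSeries.subst F (PowerSeries.exp 𝒱) := by
    ext j
    rw [PowerSeries.coeff_subst' hsub, PowerSeries.coeff_subst' hsub]
    congr 1
    funext k
    rw [PowerSeries.coeff_exp, PowerSeries.coeff_exp, Algebra.smul_def]
    rfl
  have hc : ∀ j, expCoeff p t j = PowerSeries.coeff j (PowerSeries.subst F (PowerSeries.exp 𝒱)) :=
    fun j => by rw [expCoeff, ← hF, he]
  have hF' : ∀ j, PowerSeries.coeff j (PowerSeries.derivative 𝒱 F) = -p • t (j + 1) := by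
    intro j
    rw [PowerSeries.coeff_derivative, hF, PowerSeries.coeff_mk]
    rcases j with _ | j
    · simp [ht]
    · rw [if_pos (by omega)]
      have hj : ((j + 1 + 1 : ℕ) : ℂ) ≠ 0 := Nat.cast_ne_zero.2 (j + 1).succ_ne_zero
      have : (((j + 1 : ℕ) : 𝒱) + 1) = algebraMap ℂ 𝒱 ((j + 1 + 1 : ℕ) : ℂ) := by simp
      rw [this, mul_comm, ← Algebra.smul_def, smul_smul, mul_div_cancel₀ _ hj]
  refine ⟨?_, fun j => ?_⟩
  · rw [hc, PowerSeries.coeff_subst' hsub, finsum_eq_single _ 0]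
    · simp
    · intro k hk
      rw [PowerSeries.coeff_zero_eq_constantCoeff_apply, map_pow, hF0, zero_pow hk, smul_zero]
  · have h := congrArg (PowerSeries.coeff j)
      (PowerSeries.derivative_subst (f := PowerSeries.exp 𝒱) hsub)
    rw [PowerSeries.derivative_exp, mul_comm, PowerSeries.coeff_mul,
      PowerSeries.coeff_derivative, ← hc] at h
    rw [nsmul_eq_mul, Nat.cast_add, Nat.cast_one, mul_comm, h, Finset.smul_sum]
    refine Finset.sum_congr rfl fun q _ => ?_
    rw [hF', ← hc, smul_mul_assoc]

theorem expCoeff_zero (p : ℂ) (t : ℕ → 𝒱) (ht : t 1 = 0) : expCoeff p t 0 = 1 :=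
  (expCoeff_zero_and_succ p t ht).1

/-- The recurrence for the coefficients, with `t₀` arbitrary. -/
theorem sum_mul_expCoeff (p : ℂ) (t : ℕ → 𝒱) (ht : t 1 = 0) (j : ℕ) :
    p • ∑ x ∈ antidiagonal j, expCoeff p t x.1 * t x.2 =
      p • (expCoeff p t j * t 0) - (j : ℂ) • expCoeff p t j := by
  rcases j with _ | j
  · simp
  · have h := (expCoeff_zero_and_succ p t ht).2 j
    rw [← Nat.cast_smul_eq_nsmul ℂ] at h
    rw [h, Finset.Nat.sum_antidiagonal_succ', smul_add, neg_smul, sub_neg_eq_add,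
      ← Finset.Nat.sum_antidiagonal_swap]
    simp only [Prod.fst_swap, Prod.snd_swap, mul_comm]

/-- The j-th coefficient is homogeneous of weight j when tₖ has weight k. -/
theorem expCoeff_smul_index (p ζ : ℂ) (t t' : ℕ → 𝒱) (ht : t 1 = 0)
    (h : ∀ k, t' k = ζ ^ k • t k) (j : ℕ) : expCoeff p t' j = ζ ^ j • expCoeff p t j := by
  have ht' : t' 1 = 0 := by rw [h, ht, smul_zero]
  induction j using Nat.strong_induction_on with
  | _ j ih =>
    rcases j with _ | j
    · rw [expCoeff_zero p t ht, expCoeff_zero p t' ht', pow_zero, one_smul]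
    · refine natCast_smul_cancel (k := j) ?_
      rw [(expCoeff_zero_and_succ p t' ht').2, smul_comm, (expCoeff_zero_and_succ p t ht).2,
        smul_comm (ζ ^ (j + 1)), Finset.smul_sum (r := ζ ^ (j + 1))]
      refine congrArg _ (Finset.sum_congr rfl fun x hx => ?_)
      have hx' : x.1 + x.2 = j := Finset.HasAntidiagonal.mem_antidiagonal.1 hx
      rw [h, ih x.2 (by omega), smul_mul_smul_comm, ← pow_add,
        show x.1 + 1 + x.2 = j + 1 by omega]

theorem holomorphicAtZero_expCoeff (p : ℂ) (t : ℕ → ℂ → 𝒱) (ht : ∀ z, t 1 z = 0)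
    (hol : ∀ k, HolomorphicAtZero (t k)) (j : ℕ) :
    HolomorphicAtZero fun z => expCoeff p (fun k => t k z) j := by
  induction j using Nat.strong_induction_on with
  | _ j ih =>
    rcases j with _ | j
    · refine ⟨_, (HasTaylorAtZero.const 1).congr (Filter.Eventually.of_forall fun z => ?_)⟩
      exact (expCoeff_zero p (fun k => t k z) (ht z)).symm
    · have e : ∀ z, expCoeff p (fun k => t k z) (j + 1) = ((j + 1 : ℕ) : ℂ)⁻¹ • -p •
          ∑ q ∈ antidiagonal j, t (q.1 + 1) z * expCoeff p (fun k => t k z) q.2 := by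
        intro z
        rw [← (expCoeff_zero_and_succ p (fun k => t k z) (ht z)).2, ← Nat.cast_smul_eq_nsmul ℂ,
            inv_smul_smul₀]
        exact Nat.cast_ne_zero.2 j.succ_ne_zero
      simp only [e]
      choose a ha using hol
      have hb : ∀ q : antidiagonal j, ∃ B, HasTaylorAtZero
          (fun z => expCoeff p (fun k => t k z) q.1.2) B := fun q => ih _ (by
        have := Finset.HasAntidiagonal.mem_antidiagonal.1 q.2
        omega)
      choose b hb using hb
      have := ((HasTaylorAtZero.sum Finset.univ fun (q : antidiagonal j) _ =>
        (ha (q.1.1 + 1)).bilin (LinearMap.mul ℂ 𝒱) (hb q)).map (LinearMap.lsmul ℂ 𝒱 (-p))).map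
          (LinearMap.lsmul ℂ 𝒱 ((j + 1 : ℕ) : ℂ)⁻¹)
      refine ⟨_, this.congr (Filter.Eventually.of_forall fun z => ?_)⟩
      simp only [LinearMap.lsmul_apply, LinearMap.mul_apply']
      congr 2
      exact Finset.sum_coe_sort (antidiagonal j)
        fun q => t (q.1 + 1) z * expCoeff p (fun k => t k z) q.2

/-- The derivative of the coefficients. -/
theorem derivation_expCoeff (p : ℂ) (t τ : ℕ → 𝒱) (ht : t 1 = 0) (δ : Derivation ℂ 𝒱 𝒱)
    (hτ : ∀ k, δ (t k) = (k : 𝒱) * τ k) (hτ0 : τ 0 = 0) (j : ℕ) :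
    δ (expCoeff p t j) = -p • ∑ x ∈ antidiagonal j, τ x.1 * expCoeff p t x.2 := by
  let coeffwise : PowerSeries 𝒱 → PowerSeries 𝒱 := fun F =>
    PowerSeries.mk fun k => δ (PowerSeries.coeff k F)
  have hmul : ∀ F H, coeffwise (F * H) = coeffwise F * H + F * coeffwise H := by
    intro F H
    ext k
    simp only [coeffwise, map_add, PowerSeries.coeff_mk, PowerSeries.coeff_mul, map_sum,
      Derivation.leibniz, smul_eq_mul, ← Finset.sum_add_distrib]
    refine Finset.sum_congr rfl fun x _ => ?_
    ring
  have hsmul : ∀ (a : ℂ) F, coeffwise (a • F) = a • coeffwise F := by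
    intro a F
    ext k
    simp [coeffwise]
  have hcoeff : ∀ (a : ℂ) (F : PowerSeries 𝒱) k,
      PowerSeries.coeff k (a • F) = a • PowerSeries.coeff k F := fun _ _ _ => rfl
  have hder : ∀ F, coeffwise (PowerSeries.derivative 𝒱 F) =
      PowerSeries.derivative 𝒱 (coeffwise F) := by
    intro F
    ext k
    simp only [coeffwise, PowerSeries.coeff_mk, PowerSeries.coeff_derivative, Derivation.leibniz,
      smul_eq_mul, map_add, Derivation.map_natCast, Derivation.map_one_eq_zero]
    ring
  set c : PowerSeries 𝒱 := PowerSeries.mk (expCoeff p t) with hc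
  set s : PowerSeries 𝒱 := PowerSeries.mk fun k => t (k + 1) with hs
  set u : PowerSeries 𝒱 := PowerSeries.mk τ with hu
  have hc' : PowerSeries.derivative 𝒱 c = -p • (s * c) := by
    ext k
    have h := (expCoeff_zero_and_succ p t ht).2 k
    rw [nsmul_eq_mul] at h
    rw [PowerSeries.coeff_derivative, hcoeff, PowerSeries.coeff_mul, hc, hs]
    simp only [PowerSeries.coeff_mk]
    rw [← h]
    push_cast
    ring
  have hu' : PowerSeries.derivative 𝒱 u = coeffwise s := by
    ext k
    simp only [coeffwise, hs, hu, PowerSeries.coeff_derivative, PowerSeries.coeff_mk, hτ]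
    push_cast
    ring
  -- The defect δc + p u c solves the same linear equation as c, now with zero constant term, hence
  -- vanishes.
  have hY : PowerSeries.derivative 𝒱 (coeffwise c + p • (u * c)) =
      -p • (s * (coeffwise c + p • (u * c))) := by
    rw [map_add, ← hder, hc', hsmul, hmul, Derivation.map_smul_of_tower, Derivation.leibniz, hc',
        hu']
    simp only [smul_eq_mul, mul_add, smul_add, neg_smul, mul_smul_comm, mul_neg, smul_neg]
    rw [mul_comm c, mul_left_comm u s c]
    abel
  have hzero : ∀ k, PowerSeries.coeff k (coeffwise c + p • (u * c)) = 0 := by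
    intro k
    induction k using Nat.strong_induction_on with
    | _ k ih =>
      rcases k with _ | k
      · simp [coeffwise, hc, hu, expCoeff_zero p t ht, hτ0]
      · have h := congrArg (PowerSeries.coeff k) hY
        rw [PowerSeries.coeff_derivative, hcoeff, PowerSeries.coeff_mul, Finset.sum_eq_zero] at h
        · refine natCast_smul_cancel (k := k) ?_
          rw [nsmul_eq_mul, Nat.cast_add, Nat.cast_one, mul_comm, h, smul_zero, smul_zero]
        · intro x hx
          have := Finset.HasAntidiagonal.mem_antidiagonal.1 hx
          rw [ih x.2 (by omega), mul_zero]
  have := hzero j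
  rw [map_add, hcoeff, PowerSeries.coeff_mul] at this
  simp only [coeffwise, hc, hu, PowerSeries.coeff_mk] at this
  rw [neg_smul]
  exact eq_neg_of_add_eq_zero_left this

/-- Vanishing of an antisymmetric double convolution. -/
theorem sum_antisymm_convolution (c e t τ : ℕ → 𝒱) (N M : ℕ)
    (hc : ∑ x ∈ antidiagonal N, c x.1 * t x.2 = 0) (he : ∑ y ∈ antidiagonal M, e y.1 * t y.2 = 0) :
    ∑ x ∈ antidiagonal N, ∑ y ∈ antidiagonal M, c x.1 * e y.1 *
      ∑ w ∈ antidiagonal x.2, (t w.1 * τ (w.2 + y.2) - τ w.1 * t (w.2 + y.2)) =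
    ∑ x ∈ antidiagonal N, ∑ y ∈ antidiagonal M, c x.1 * e y.1 *
      ∑ w ∈ antidiagonal y.2, (t w.1 * τ (w.2 + x.2) - τ w.1 * t (w.2 + x.2)) := by
  -- With R = P + Q, the summand ψ is odd under r ↔ R - r and sums to zero over 0 ≤ r ≤ R. Hence its
  -- partial sums up to P and up to Q differ only by the boundary term ψ(P).
  have key : ∀ P Q : ℕ,
      ∑ w ∈ antidiagonal P, (t w.1 * τ (w.2 + Q) - τ w.1 * t (w.2 + Q)) =
        ∑ w ∈ antidiagonal Q, (t w.1 * τ (w.2 + P) - τ w.1 * t (w.2 + P)) +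
          (t P * τ Q - τ P * t Q) := by
    intro P Q
    let ψ : ℕ → 𝒱 := fun r => t r * τ (P + Q - r) - τ r * t (P + Q - r)
    have hψ : ∀ r ≤ P + Q, ψ (P + Q - r) = -ψ r := by
      intro r hr
      simp only [ψ, Nat.sub_sub_self hr]
      ring
    have hrefl : ∀ K ≤ P + Q + 1, ∑ r ∈ Finset.range (P + Q + 1), ψ r =
        ∑ r ∈ Finset.range K, ψ r - ∑ r ∈ Finset.range (P + Q + 1 - K), ψ r := by
      intro K hK
      obtain ⟨l, hl⟩ := Nat.exists_eq_add_of_le hK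
      rw [hl, Finset.sum_range_add, Nat.add_sub_cancel_left,
        ← Finset.sum_range_reflect (fun i => ψ (K + i)),
        sub_eq_add_neg, ← Finset.sum_neg_distrib]
      congr 1
      refine Finset.sum_congr rfl fun r hr => ?_
      have := Finset.mem_range.1 hr
      rw [← hψ r (by omega), show P + Q - r = K + (l - 1 - r) by omega]
    have htotal : ∑ r ∈ Finset.range (P + Q + 1), ψ r = 0 := by
      refine natCast_smul_cancel (k := 1) ?_
      have := hrefl 0 (Nat.zero_le _)
      rw [Finset.range_zero, Finset.sum_empty, zero_sub, Nat.sub_zero] at this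
      rw [smul_zero, two_nsmul]
      exact add_eq_zero_iff_eq_neg.2 this
    have e1 : ∀ P' Q', P' + Q' = P + Q →
        ∑ w ∈ antidiagonal P', (t w.1 * τ (w.2 + Q') - τ w.1 * t (w.2 + Q')) =
          ∑ r ∈ Finset.range (P' + 1), ψ r := by
      intro P' Q' h
      rw [Finset.Nat.sum_antidiagonal_eq_sum_range_succ_mk]
      refine Finset.sum_congr rfl fun r hr => ?_
      have := Finset.mem_range.1 hr
      simp only [ψ, show P' - r + Q' = P + Q - r by omega]
    have h2 := hrefl (P + 1) (by omega)
    rw [htotal, show P + Q + 1 - (P + 1) = Q by omega] at h2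
    have h3 := hψ P (by omega)
    rw [Nat.add_sub_cancel_left] at h3
    have h4 : t P * τ Q - τ P * t Q = ψ P := by simp only [ψ, Nat.add_sub_cancel_left]
    rw [e1 P Q rfl, e1 Q P (add_comm _ _), h4, Finset.sum_range_succ ψ Q, h3, neg_add_cancel_right]
    exact sub_eq_zero.1 h2.symm
  refine sub_eq_zero.1 ?_
  rw [← Finset.sum_sub_distrib]
  simp only [← Finset.sum_sub_distrib, ← mul_sub,
      fun x y : ℕ × ℕ => sub_eq_iff_eq_add'.2 (key x.2 y.2)]
  -- The boundary terms factorise, and each product contains one of the vanishing convolutions.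
  have h : ∀ x y : ℕ × ℕ, c x.1 * e y.1 * (t x.2 * τ y.2 - τ x.2 * t y.2) =
      (c x.1 * t x.2) * (e y.1 * τ y.2) - (c x.1 * τ x.2) * (e y.1 * t y.2) := fun x y => by ring
  simp only [h, Finset.sum_sub_distrib, ← Finset.mul_sum, ← Finset.sum_mul, hc, he, zero_mul,
    mul_zero, sub_zero]

end GeneratingSeries

/-! ## Gradients of the densities in the twisted case -/

section ExpGradient

open Finset.HasAntidiagonal (antidiagonal)

theorem sum_antidiagonal_assoc {M : Type*} [AddCommMonoid M] (F : ℕ → ℕ → ℕ → M) (N : ℕ) :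
    ∑ x ∈ antidiagonal N, ∑ w ∈ antidiagonal x.1, F w.1 w.2 x.2 =
      ∑ x ∈ antidiagonal N, ∑ w ∈ antidiagonal x.2, F x.1 w.1 w.2 := by
  rw [Finset.sum_sigma', Finset.sum_sigma']
  refine Finset.sum_bij' (fun x _ => ⟨(x.2.1, x.2.2 + x.1.2), (x.2.2, x.1.2)⟩)
    (fun x _ => ⟨(x.1.1 + x.2.1, x.2.2), (x.1.1, x.2.1)⟩) ?_ ?_ ?_ ?_ ?_
  · rintro ⟨⟨a, b⟩, ⟨c, d⟩⟩ h
    simp only [Finset.mem_sigma, Finset.HasAntidiagonal.mem_antidiagonal] at h ⊢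
    exact ⟨by omega, trivial⟩
  · rintro ⟨⟨a, b⟩, ⟨c, d⟩⟩ h
    simp only [Finset.mem_sigma, Finset.HasAntidiagonal.mem_antidiagonal] at h ⊢
    exact ⟨by omega, trivial⟩
  · rintro ⟨⟨a, b⟩, ⟨c, d⟩⟩ h
    simp only [Finset.mem_sigma, Finset.HasAntidiagonal.mem_antidiagonal] at h
    obtain ⟨-, rfl⟩ := h
    rfl
  · rintro ⟨⟨a, b⟩, ⟨c, d⟩⟩ h
    simp only [Finset.mem_sigma, Finset.HasAntidiagonal.mem_antidiagonal] at h
    obtain ⟨-, rfl⟩ := h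
    rfl
  · intros
    rfl

variable {𝒱 : Type*} [CommRing 𝒱] [Algebra ℂ 𝒱]

/-- Since pd = N, the recurrence turns the factor x₂ = N - x₁ in front of the x₁-th coefficient into
p times a convolution, so both terms become triple convolutions. -/
theorem sum_derivation_expCoeff (p : ℂ) (d : ℕ) (t τ : ℕ → 𝒱) (ht : t 1 = 0) (ht0 : t 0 = d)
    (δ : Derivation ℂ 𝒱 𝒱) (hτ : ∀ k, δ (t k) = (k : 𝒱) * τ k) (hτ0 : τ 0 = 0) {N : ℕ}
    (hp : p * d = N) (j : ℕ) :
    ∑ x ∈ antidiagonal N, (δ (expCoeff p t x.1) * t (x.2 + j) +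
        expCoeff p t x.1 * ((x.2 : 𝒱) * τ (x.2 + j))) =
      p • ∑ x ∈ antidiagonal N, expCoeff p t x.1 *
        ∑ w ∈ antidiagonal x.2, (t w.1 * τ (w.2 + j) - τ w.1 * t (w.2 + j)) := by
  have h1 : ∀ x ∈ antidiagonal N, expCoeff p t x.1 * ((x.2 : 𝒱) * τ (x.2 + j)) =
      p • ∑ w ∈ antidiagonal x.1, expCoeff p t w.1 * t w.2 * τ (x.2 + j) := by
    intro x hx
    have hx' : x.1 + x.2 = N := Finset.HasAntidiagonal.mem_antidiagonal.1 hx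
    rw [← Finset.sum_mul, ← smul_mul_assoc, sum_mul_expCoeff p t ht, ht0]
    have : p • (expCoeff p t x.1 * (d : 𝒱)) = (N : ℂ) • expCoeff p t x.1 := by
      rw [← hp, mul_smul, mul_comm, ← nsmul_eq_mul, Nat.cast_smul_eq_nsmul]
    rw [this, ← sub_smul, ← hx', Nat.cast_add, add_sub_cancel_left, Nat.cast_smul_eq_nsmul,
      nsmul_eq_mul]
    ring
  have h2 : ∀ x ∈ antidiagonal N, δ (expCoeff p t x.1) * t (x.2 + j) =
      p • ∑ w ∈ antidiagonal x.1, -(expCoeff p t w.1 * τ w.2 * t (x.2 + j)) := by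
    intro x _
    rw [derivation_expCoeff p t τ ht δ hτ hτ0, neg_smul, neg_mul, smul_mul_assoc, Finset.sum_mul,
      Finset.sum_neg_distrib, smul_neg, ← Finset.Nat.sum_antidiagonal_swap]
    simp only [Prod.fst_swap, Prod.snd_swap, mul_comm (τ _)]
  rw [Finset.sum_add_distrib, Finset.sum_congr rfl h1, Finset.sum_congr rfl h2, ← Finset.smul_sum,
    ← Finset.smul_sum, ← smul_add,
    sum_antidiagonal_assoc (fun a r i => -(expCoeff p t a * τ r * t (i + j))),
    sum_antidiagonal_assoc (fun a r i => expCoeff p t a * t r * τ (i + j)),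
    ← Finset.sum_add_distrib]
  congr 1
  refine Finset.sum_congr rfl fun x _ => ?_
  rw [← Finset.sum_add_distrib, Finset.mul_sum]
  refine Finset.sum_congr rfl fun w _ => ?_
  ring

variable {ι : Type*} [Fintype ι] [DecidableEq ι]

/-- Up to the factor `-p`, the gradient of the coefficient of degree `N + 1` of
`exp (-p ∑ₖ μᵏ / k * Tr Sᵏ)`. -/
def expGradient (p : ℂ) (S : Matrix ι ι 𝒱) (N : ℕ) : Matrix ι ι 𝒱 :=
  ∑ x ∈ antidiagonal N, expCoeff p (fun k => (S ^ k).trace) x.1 • S ^ x.2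

/-- The logarithmic derivatives of the traces of powers. -/
def traceDer (δ : Derivation ℂ 𝒱 𝒱) (S : Matrix ι ι 𝒱) (k : ℕ) : 𝒱 :=
  if k = 0 then 0 else (S ^ (k - 1) * S.map δ).trace

variable (S : Matrix ι ι 𝒱) (δ : Derivation ℂ 𝒱 𝒱)

theorem derivation_trace_pow_eq (k : ℕ) :
    δ ((S ^ k).trace) = (k : 𝒱) * traceDer δ S k := by
  rw [Matrix.derivation_trace_pow, traceDer]
  split_ifs with h
  · simp [h]
  · rfl

theorem trace_map_pow_mul_pow (i k : ℕ) :
    ((S ^ i).map δ * S ^ k).trace = (i : 𝒱) * traceDer δ S (i + k) := by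
  rw [Matrix.trace_map_derivation_pow_mul, traceDer]
  rcases i with _ | i
  · simp
  · rw [if_neg (by omega), show i + 1 + k - 1 = i + 1 - 1 + k by omega]

theorem commute_expGradient (p : ℂ) (N : ℕ) : Commute S (expGradient p S N) :=
  Commute.sum_right _ _ _ fun x _ => ((Commute.refl S).pow_right x.2).smul_right _

variable {S}

theorem derivation_expCoeff_trace (p : ℂ) (hS : S.trace = 0) (N : ℕ) :
    δ (expCoeff p (fun k => (S ^ k).trace) (N + 1)) =
      ((-p • expGradient p S N) * S.map δ).trace := by
  rw [derivation_expCoeff p _ (traceDer δ S) (by simpa using hS) δ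
    (fun k => derivation_trace_pow_eq S δ k) (if_pos rfl), smul_mul_assoc, Matrix.trace_smul,
    Finset.Nat.sum_antidiagonal_succ, expGradient, Finset.sum_mul, Matrix.trace_sum,
    ← Finset.Nat.sum_antidiagonal_swap]
  congr 1
  rw [show traceDer δ S 0 = 0 from if_pos rfl, zero_mul, zero_add]
  refine Finset.sum_congr rfl fun x _ => ?_
  rw [smul_mul_assoc, Matrix.trace_smul, smul_eq_mul, mul_comm]
  rfl

/-- Counting the term t₀ = Tr 1 = d, the recurrence has the factor pd - N, which the exponent p =
N/d makes zero. This gives tracelessness of the gradient. -/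
theorem sum_expCoeff_mul_trace {p : ℂ} (hS : S.trace = 0) {N : ℕ} (hp : p ≠ 0)
    (hN : p * Fintype.card ι = N) :
    ∑ x ∈ antidiagonal N, expCoeff p (fun k => (S ^ k).trace) x.1 * (S ^ x.2).trace = 0 := by
  have h := sum_mul_expCoeff p (fun k => (S ^ k).trace) (by simpa using hS) N
  rw [← hN, pow_zero, Matrix.trace_one, mul_comm _ (Fintype.card ι : 𝒱), ← nsmul_eq_mul,
    ← Nat.cast_smul_eq_nsmul ℂ, smul_smul, sub_self] at h
  exact (smul_eq_zero_iff_right hp).1 h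

theorem trace_expGradient {p : ℂ} (hS : S.trace = 0) {N : ℕ} (hp : p ≠ 0)
    (hN : p * Fintype.card ι = N) : (expGradient p S N).trace = 0 := by
  rw [expGradient, Matrix.trace_sum, ← sum_expCoeff_mul_trace hS hp hN]
  simp only [Matrix.trace_smul, smul_eq_mul]

theorem trace_map_expGradient_mul {p : ℂ} (q : ℂ) (hS : S.trace = 0) {N : ℕ} (M : ℕ)
    (hN : p * Fintype.card ι = N) :
    ((expGradient p S N).map δ * expGradient q S M).trace =
      p • ∑ x ∈ antidiagonal N, ∑ y ∈ antidiagonal M,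
        expCoeff p (fun k => (S ^ k).trace) x.1 * expCoeff q (fun k => (S ^ k).trace) y.1 *
          ∑ w ∈ antidiagonal x.2, ((S ^ w.1).trace * traceDer δ S (w.2 + y.2) -
            traceDer δ S w.1 * (S ^ (w.2 + y.2)).trace) := by
  have key := fun j => sum_derivation_expCoeff p (Fintype.card ι) (fun k => (S ^ k).trace)
    (traceDer δ S) (by simpa using hS) (by simp) δ (fun k => derivation_trace_pow_eq S δ k)
    (if_pos rfl) hN j
  have e1 : (expGradient p S N).map δ = ∑ x ∈ antidiagonal N,
      (δ (expCoeff p (fun k => (S ^ k).trace) x.1) • S ^ x.2 +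
        expCoeff p (fun k => (S ^ k).trace) x.1 • (S ^ x.2).map δ) := by
    rw [← Finset.sum_congr rfl fun x _ => Matrix.map_derivation_smul δ _ (S ^ x.2), expGradient]
    ext i j
    simp only [Matrix.map_apply, Matrix.sum_apply, map_sum]
  rw [e1, expGradient, Finset.sum_comm, Finset.smul_sum, Finset.mul_sum, Matrix.trace_sum]
  refine Finset.sum_congr rfl fun y _ => ?_
  simp only [mul_right_comm _ (expCoeff q _ _), ← Finset.sum_mul]
  rw [← smul_mul_assoc, ← key, Finset.sum_mul, Finset.sum_mul, Matrix.trace_sum]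
  refine Finset.sum_congr rfl fun x _ => ?_
  rw [mul_smul_comm, Matrix.trace_smul, add_mul, smul_mul_assoc, smul_mul_assoc, ← pow_add,
    Matrix.trace_add, Matrix.trace_smul, Matrix.trace_smul, trace_map_pow_mul_pow]
  simp only [smul_eq_mul]
  ring

/-- Apart from the prefactors p and q, the two sides are the convolutions exchanged by
`sum_antisymm_convolution`. The relation q Tr(δA B) = p Tr(A δB) then forces Tr(δA B) to be p/(p +
q) times δ Tr(AB). -/
theorem smul_trace_map_expGradient_mul {p q : ℂ} (hS : S.trace = 0) {N M : ℕ} (hp : p ≠ 0)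
    (hq : q ≠ 0) (hN : p * Fintype.card ι = N) (hM : q * Fintype.card ι = M) :
    q • ((expGradient p S N).map δ * expGradient q S M).trace =
      p • (expGradient p S N * (expGradient q S M).map δ).trace := by
  rw [Matrix.trace_mul_comm (expGradient p S N), trace_map_expGradient_mul δ q hS M hN,
    trace_map_expGradient_mul δ p hS N hM, smul_comm q p,
    sum_antisymm_convolution _ _ (fun k => (S ^ k).trace) (traceDer δ S) N M
      (sum_expCoeff_mul_trace hS hp hN) (sum_expCoeff_mul_trace hS hq hM), Finset.sum_comm]
  simp only [mul_comm (expCoeff p _ _)]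

/-- The contraction of the gradients is a total derivative. -/
theorem trace_map_expGradient_mul_mem {p q : ℂ} (hS : S.trace = 0) {N M : ℕ} (hp : p ≠ 0)
    (hq : q ≠ 0) (hpq : p + q ≠ 0) (hN : p * Fintype.card ι = N) (hM : q * Fintype.card ι = M) :
    ((expGradient p S N).map δ * expGradient q S M).trace =
      δ ((p / (p + q)) • (expGradient p S N * expGradient q S M).trace) := by
  have h := smul_trace_map_expGradient_mul δ hS hp hq hN hM
  rw [Derivation.map_smul, ← Matrix.trace_map_derivation, Matrix.map_derivation_mul,
    Matrix.trace_add, div_eq_inv_mul, mul_smul, smul_add, ← h, ← add_smul, smul_smul,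
    inv_mul_cancel₀ hpq, one_smul]

theorem HolomorphicAtZero.matrix_pow {F : ℂ → Matrix ι ι 𝒱} (h : HolomorphicAtZero F) (k : ℕ) :
    HolomorphicAtZero fun z => F z ^ k := by
  induction k with
  | zero => exact ⟨_, by simpa using HasTaylorAtZero.const (1 : Matrix ι ι 𝒱)⟩
  | succ k ih =>
    obtain ⟨A, hA⟩ := h
    obtain ⟨B, hB⟩ := ih
    exact ⟨_, (hB.bilin (LinearMap.mul ℂ (Matrix ι ι 𝒱)) hA).congr
      (Filter.Eventually.of_forall fun z => (pow_succ _ _).symm)⟩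

theorem HolomorphicAtZero.trace_pow {F : ℂ → Matrix ι ι 𝒱} (h : HolomorphicAtZero F) (k : ℕ) :
    HolomorphicAtZero fun z => (F z ^ k).trace := by
  obtain ⟨A, hA⟩ := h.matrix_pow k
  exact ⟨_, hA.map (Matrix.traceLinearMap ι ℂ 𝒱)⟩

theorem HolomorphicAtZero.expGradient (p : ℂ) {F : ℂ → Matrix ι ι 𝒱} (h : HolomorphicAtZero F)
    (hF : ∀ z, (F z).trace = 0) (N : ℕ) : HolomorphicAtZero fun z => expGradient p (F z) N := by
  have h1 := fun j => holomorphicAtZero_expCoeff p (fun k z => (F z ^ k).trace)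
    (fun z => by simpa using hF z) h.trace_pow j
  have h2 := h.matrix_pow
  choose a ha using h1
  choose b hb using h2
  exact ⟨_, HasTaylorAtZero.sum _ fun x _ => (ha x.1).bilin
    (LinearMap.restrictScalars₁₂ ℂ ℂ (LinearMap.lsmul 𝒱 (Matrix ι ι 𝒱))) (hb x.2)⟩

end ExpGradient

/-! ## Matrices of `𝔤`-valued fields -/

section ToMatrix

variable {t : ClassicalType} {𝒱 : Type*} [CommRing 𝒱] [Algebra ℂ 𝒱]

namespace ClassicalType

theorem toMatrix_tmul (a : 𝒱) (X : t.alg) : t.toMatrix 𝒱 (a ⊗ₜ X) =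
    a • (X : Matrix t.Index t.Index ℂ).map (algebraMap ℂ 𝒱) := by
  rw [toMatrix, TensorProduct.lift.tmul]
  rfl

theorem trace_toMatrix (h : ∀ X : t.alg, (X : Matrix t.Index t.Index ℂ).trace = 0)
    (y : 𝒱 ⊗[ℂ] t.alg) : (t.toMatrix 𝒱 y).trace = 0 := by
  induction y using TensorProduct.induction_on with
  | zero => rw [map_zero, Matrix.trace_zero]
  | tmul a X =>
    rw [toMatrix_tmul, Matrix.trace_smul, ← AddMonoidHom.map_trace (algebraMap ℂ 𝒱), h, map_zero,
      smul_zero]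
  | add y w hy hw => rw [map_add, Matrix.trace_add, hy, hw, add_zero]

theorem traceMul_smul_map (a : 𝒱) (X Y : Matrix t.Index t.Index ℂ) :
    traceMul (a • X.map (algebraMap ℂ 𝒱)) Y = (X * Y).trace • a := by
  rw [traceMul_apply, mul_smul_comm, Matrix.trace_smul, ← Matrix.map_mul,
    ← AddMonoidHom.map_trace (algebraMap ℂ 𝒱), Matrix.trace_mul_comm, smul_eq_mul, mul_comm,
    Algebra.smul_def]

theorem traceMul_toMatrix_lTensor {σ : t.alg →ₗ[ℂ] t.alg} (hσ : PreservesTraceForm σ)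
    (y : 𝒱 ⊗[ℂ] t.alg) (Y : t.alg) :
    traceMul (t.toMatrix 𝒱 (LinearMap.lTensor 𝒱 σ y)) (σ Y : t.alg) =
      traceMul (t.toMatrix 𝒱 y) (Y : Matrix t.Index t.Index ℂ) := by
  induction y using TensorProduct.induction_on with
  | zero => rw [map_zero, map_zero, traceMul_apply, traceMul_apply, mul_zero, mul_zero]
  | tmul a X =>
    rw [LinearMap.lTensor_tmul, toMatrix_tmul, toMatrix_tmul, traceMul_smul_map, traceMul_smul_map,
      hσ]
  | add y w hy hw => rw [map_add, map_add, map_add, traceMul_add, traceMul_add, hy, hw]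

theorem toMatrix_lTensor_conj {d : ℕ} {σ : (A d).alg →ₗ[ℂ] (A d).alg}
    {P Q : Matrix (Fin d) (Fin d) ℂ}
    (h : ∀ X : (A d).alg, (σ X : Matrix (Fin d) (Fin d) ℂ) =
      P * (X : Matrix (Fin d) (Fin d) ℂ) * Q) (y : 𝒱 ⊗[ℂ] (A d).alg) :
    (A d).toMatrix 𝒱 (LinearMap.lTensor 𝒱 σ y) =
      P.map (algebraMap ℂ 𝒱) * (A d).toMatrix 𝒱 y * Q.map (algebraMap ℂ 𝒱) := by
  induction y using TensorProduct.induction_on with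
  | zero => simp
  | tmul a X =>
    rw [LinearMap.lTensor_tmul, toMatrix_tmul, toMatrix_tmul]
    erw [h]
    rw [Matrix.map_mul, Matrix.map_mul, mul_smul_comm, smul_mul_assoc]
  | add y w hy hw => rw [map_add, map_add, map_add, hy, hw, mul_add, add_mul]

theorem toMatrix_lTensor_conj_transpose {d : ℕ} {σ : (A d).alg →ₗ[ℂ] (A d).alg}
    {P Q : Matrix (Fin d) (Fin d) ℂ}
    (h : ∀ X : (A d).alg, (σ X : Matrix (Fin d) (Fin d) ℂ) =
      -(P * (X : Matrix (Fin d) (Fin d) ℂ).transpose * Q)) (y : 𝒱 ⊗[ℂ] (A d).alg) :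
    (A d).toMatrix 𝒱 (LinearMap.lTensor 𝒱 σ y) =
      -(P.map (algebraMap ℂ 𝒱) * ((A d).toMatrix 𝒱 y).transpose * Q.map (algebraMap ℂ 𝒱)) := by
  induction y using TensorProduct.induction_on with
  | zero => simp
  | tmul a X =>
    rw [LinearMap.lTensor_tmul, toMatrix_tmul, toMatrix_tmul]
    erw [h]
    rw [Matrix.map_neg _ (map_neg _), Matrix.map_mul, Matrix.map_mul, Matrix.transpose_smul,
      mul_smul_comm, smul_mul_assoc, smul_neg, Matrix.transpose_map]
  | add y w hy hw =>
    rw [map_add, map_add, map_add, hy, hw, Matrix.transpose_add, mul_add, add_mul, neg_add]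

theorem exists_toMatrix_eq_sub_trace {d : ℕ} [Nonempty (A d).Index]
    (B : Matrix (A d).Index (A d).Index 𝒱) :
    ∃ y, (A d).toMatrix 𝒱 y =
      B - ((Fintype.card (A d).Index : ℂ)⁻¹ • B.trace) • (1 : Matrix (A d).Index (A d).Index 𝒱) := by
  let E : (A d).Index → (A d).Index → Matrix (A d).Index (A d).Index ℂ := fun i j =>
    Matrix.single i j 1
  let X : (A d).Index → (A d).Index → (A d).alg := fun i j =>
    SpecialLinearAut.proj (ι := (A d).Index) (E i j)
  have hX : ∀ i j, (X i j : Matrix (A d).Index (A d).Index ℂ) = E i j -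
      ((E i j).trace / (Fintype.card (A d).Index : ℂ)) • 1 := fun _ _ => rfl
  refine ⟨∑ i, ∑ j, B i j ⊗ₜ X i j, ?_⟩
  have e : ∀ i j, (A d).toMatrix 𝒱 (B i j ⊗ₜ X i j) =
      Matrix.single i j (B i j) - if i = j then
        ((Fintype.card (A d).Index : ℂ)⁻¹ • B i j) • (1 : Matrix (A d).Index (A d).Index 𝒱)
        else 0 := by
    intro i j
    rw [toMatrix_tmul, hX]
    have htr : (E i j).trace = if i = j then 1 else 0 := by
      split_ifs with hij
      · rw [hij]; exact Matrix.trace_single_eq_same _ _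
      · exact Matrix.trace_single_eq_of_ne _ _ _ hij
    rw [htr]
    ext a b
    simp only [E, Matrix.smul_apply, Matrix.map_apply, Matrix.sub_apply, Matrix.single_apply,
      Matrix.one_apply, smul_eq_mul, map_sub, mul_sub]
    split_ifs <;> simp_all [Algebra.smul_def, mul_comm]
  simp only [map_sum, e, Finset.sum_sub_distrib]
  congr 1
  · exact (Matrix.matrix_eq_sum_single B).symm
  · simp [Matrix.trace, Finset.smul_sum, Finset.sum_smul]

end ClassicalType

/-- The Casimir is the identity on 𝔤 but not on all matrices, so only one factor has to be 𝔤-valued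
and the other is arbitrary. -/
theorem TwistModel.pairing_zero_toMatrix [PoissonVertexAlgebra 𝒱] (m : TwistModel t 𝒱)
    (A : Matrix t.Index t.Index 𝒱) (y : 𝒱 ⊗[ℂ] t.alg) :
    m.pairing 0 A (t.toMatrix 𝒱 y) = (A * t.toMatrix 𝒱 y).trace := by
  induction y using TensorProduct.induction_on with
  | zero => simp [pairing, traceMul_apply]
  | tmul a X =>
    let f : t.alg →ₗ[ℂ] 𝒱 := traceMul A ∘ₗ (t.alg.incl : t.alg →ₗ[ℂ] Matrix t.Index t.Index ℂ)
    have h : (A * t.toMatrix 𝒱 (a ⊗ₜ X)).trace = f X * a := by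
      rw [ClassicalType.toMatrix_tmul, mul_smul_comm, Matrix.trace_smul, Matrix.trace_mul_comm,
        smul_eq_mul, mul_comm]
      rfl
    rw [h, ← m.sum_form_basisDown X, map_sum, Finset.sum_mul, m.sum_form_basisDown]
    refine Finset.sum_congr rfl fun b _ => ?_
    rw [ClassicalType.toMatrix_tmul, ClassicalType.traceMul_smul_map, mul_smul_comm, map_smul,
      smul_mul_assoc]
    rfl
  | add y w hy hw =>
    rw [map_add, mul_add, Matrix.trace_add, ← hy, ← hw]
    simp only [pairing, traceMul_add, mul_add, Finset.sum_add_distrib]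

theorem trace_map_pow_mul_pow_eq {ι : Type*} [Fintype ι] [DecidableEq ι]
    (δ : Derivation ℂ 𝒱 𝒱) (S : Matrix ι ι 𝒱) (a b : ℕ) :
    ((S ^ a).map δ * S ^ b).trace =
      δ (((a : ℂ) / ((a : ℂ) + b)) • (S ^ (a + b)).trace) := by
  rw [trace_map_pow_mul_pow, Derivation.map_smul, derivation_trace_pow_eq]
  rcases a with _ | a
  · simp
  · have h : ((a + 1 : ℕ) : ℂ) + b ≠ 0 := by
      rw [← Nat.cast_add]
      exact Nat.cast_ne_zero.2 (by omega)
    rw [← nsmul_eq_mul, ← nsmul_eq_mul, ← Nat.cast_smul_eq_nsmul ℂ, ← Nat.cast_smul_eq_nsmul ℂ,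
      smul_smul, Nat.cast_add (a + 1) b, div_mul_cancel₀ _ h]

theorem conj_pow_of_mul_eq_one {R : Type*} [Monoid R] {P Q : R} (h : P * Q = 1) (h' : Q * P = 1)
    (X : R) (k : ℕ) : (P * X * Q) ^ k = P * X ^ k * Q := by
  induction k with
  | zero => rw [pow_zero, pow_zero, mul_one, h]
  | succ k ih =>
    rw [pow_succ, ih, pow_succ]
    simp only [mul_assoc]
    rw [← mul_assoc Q P, h', one_mul]

section Conj

variable {ι : Type*} [Fintype ι] [DecidableEq ι] {P Q : Matrix ι ι ℂ}

theorem traceMul_conj (h : Q * P = 1) (G : Matrix ι ι 𝒱) (Y : Matrix ι ι ℂ) :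
    traceMul (P.map (algebraMap ℂ 𝒱) * G * Q.map (algebraMap ℂ 𝒱)) (P * Y * Q) = traceMul G Y := by
  have h' : Q.map (algebraMap ℂ 𝒱) * P.map (algebraMap ℂ 𝒱) = 1 := by
    rw [← Matrix.map_mul, h, Matrix.map_one _ (map_zero _) (map_one _)]
  rw [traceMul_apply, traceMul_apply, Matrix.map_mul, Matrix.map_mul, ← mul_assoc,
    Matrix.trace_mul_comm, ← mul_assoc, mul_assoc (P.map _), ← mul_assoc (Q.map _),
    h', one_mul, mul_assoc (Y.map _), ← mul_assoc (Q.map _), h', one_mul]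

/-- Transposition respects powers of a single matrix, and every term of the gradient has total
weight N in S. -/
theorem expGradient_conj_transpose {P Q : Matrix ι ι 𝒱} (h : P * Q = 1) (h' : Q * P = 1) (p ζ : ℂ)
    {S S' : Matrix ι ι 𝒱} (hS : S.trace = 0) (hS' : S' = ζ • (P * S.transpose * Q)) (N : ℕ) :
    expGradient p S' N = ζ ^ N • (P * (expGradient p S N).transpose * Q) := by
  have hpow : ∀ k, S' ^ k = ζ ^ k • (P * (S ^ k).transpose * Q) := by
    intro k
    rw [hS', smul_pow, conj_pow_of_mul_eq_one h h', Matrix.transpose_pow]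
  have htr : ∀ k, (S' ^ k).trace = ζ ^ k • (S ^ k).trace := by
    intro k
    rw [hpow, Matrix.trace_smul, Matrix.trace_mul_comm, ← mul_assoc, h', one_mul,
      Matrix.trace_transpose]
  rw [expGradient, expGradient, Matrix.transpose_sum, Finset.mul_sum, Finset.sum_mul,
    Finset.smul_sum]
  refine Finset.sum_congr rfl fun x hx => ?_
  rw [expCoeff_smul_index p ζ (fun k => (S ^ k).trace) _ (by simpa using hS) htr, hpow,
    Matrix.transpose_smul, mul_smul_comm, smul_mul_assoc,
    ← Finset.HasAntidiagonal.mem_antidiagonal.1 hx, smul_comm _ (ζ ^ x.2), smul_assoc, smul_smul,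
    ← pow_add, add_comm x.2]

end Conj

end ToMatrix

/-! ## Gradients expressed through the rescaled Lax matrix -/

namespace TwistModel

open PoissonVertexAlgebra

section Rescaled

variable {t : ClassicalType} {𝒱 : Type*} [CommRing 𝒱] [Algebra ℂ 𝒱] [PoissonVertexAlgebra 𝒱]
  (m : TwistModel t 𝒱)

/-- The matrix of `φ L`. -/
def rescaledLax (z : ℂ) : Matrix t.Index t.Index 𝒱 :=
  t.toMatrix 𝒱 (m.φ.valueAt z • m.L z)

theorem rescaledLax_eq (z : ℂ) :
    m.rescaledLax z = m.φ.valueAt z • t.toMatrix 𝒱 (m.L z) := map_smul _ _ _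

theorem traceDensity_eq (n : ℕ) (z : ℂ) : m.traceDensity n z = (m.rescaledLax z ^ n).trace := by
  rw [traceDensity, rescaledLax_eq, smul_pow]

theorem generatedDensity_eq (n : ℕ) (z : ℂ) : m.generatedDensity n z =
    expCoeff (((n : ℂ) - 1) / (Fintype.card t.Index : ℂ))
      (fun k => (m.rescaledLax z ^ k).trace) n := by
  simp only [generatedDensity, expCoeff, traceDensity_eq]

theorem holomorphicAtZero_rescaledLax (h0 : m.HasRegularZeroAtOrigin) :
    HolomorphicAtZero m.rescaledLax := by
  obtain ⟨A, hA⟩ := h0.2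
  exact ⟨_, hA.map (t.toMatrix 𝒱)⟩

variable {m}

theorem IsGood.rescaledLax_mul {z : ℂ} (hz : m.IsGood z) : m.rescaledLax (m.ω * z) =
    m.ω⁻¹ • t.toMatrix 𝒱 (LinearMap.lTensor 𝒱 (m.σ : t.alg →ₗ[ℂ] t.alg)
      (m.φ.valueAt z • m.L z)) := by
  have h1 : m.ω * z ∉ m.poles := by simpa using hz.notMem_poles 1
  rw [rescaledLax, m.φ_equivariant, ← m.L_equivariant z hz.notMem h1, mul_smul, map_smul, map_smul,
    map_smul, map_smul]

theorem IsGradient.of_rescaledLax {n : ℕ} {G : ℂ → Matrix t.Index t.Index 𝒱}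
    (gradient : ∀ z, HasMatrixGradient (m.W n z) (m.rescaledLax z) (G z))
    (commute : ∀ z, Commute (m.rescaledLax z) (G z))
    (equivariant : ∀ z, m.IsGood z → ∀ Y : t.alg,
      m.ω ^ (n * m.kappa) • traceMul (G (m.ω * z)) (m.σ Y : t.alg) =
        m.ω • traceMul (G z) (Y : Matrix t.Index t.Index ℂ))
    (holomorphic : HolomorphicAtZero G) : m.IsGradient n G where
  gradient z _ δ := by
    rw [gradient z δ, rescaledLax_eq, Matrix.map_derivation_smul', mul_smul_comm, smul_mul_assoc]
  commute z hz := by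
    have := (commute z).smul_left (m.φ.valueAt z)⁻¹
    rwa [rescaledLax_eq, inv_smul_smul₀ hz.φ_ne_zero] at this
  equivariant := equivariant
  holomorphic := holomorphic

variable (m)

/-- The gradient of `Tr Sⁿ`. -/
def powGradient (n : ℕ) (z : ℂ) : Matrix t.Index t.Index 𝒱 :=
  (n : ℂ) • m.rescaledLax z ^ (n - 1)

theorem W_eq_of_not_isTwisted (h : ¬ t.IsTwisted m.σ) (n : ℕ) (z : ℂ) :
    m.W n z = (m.rescaledLax z ^ n).trace := by
  rw [W, if_neg h, traceDensity_eq]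

theorem kappa_of_not_isTwisted (h : ¬ t.IsTwisted m.σ) : m.kappa = 1 := if_neg h

theorem hasMatrixGradient_trace_pow (n : ℕ) (z : ℂ) :
    HasMatrixGradient (m.rescaledLax z ^ n).trace (m.rescaledLax z) (m.powGradient n z) := by
  intro δ
  rw [Matrix.derivation_trace_pow, powGradient, smul_mul_assoc, Matrix.trace_smul, ← nsmul_eq_mul,
    Nat.cast_smul_eq_nsmul]

theorem commute_powGradient (n : ℕ) (z : ℂ) : Commute (m.rescaledLax z) (m.powGradient n z) :=
  ((Commute.refl _).pow_right _).smul_right _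

theorem holomorphicAtZero_powGradient (h0 : m.HasRegularZeroAtOrigin) (n : ℕ) :
    HolomorphicAtZero (m.powGradient n) := by
  obtain ⟨A, hA⟩ := (m.holomorphicAtZero_rescaledLax h0).matrix_pow (n - 1)
  exact ⟨_, hA.map (LinearMap.lsmul ℂ _ (n : ℂ))⟩

theorem trace_map_powGradient_mul (n k : ℕ) (z : ℂ) :
    ((m.powGradient n z).map (D : Derivation ℂ 𝒱 𝒱) * m.powGradient k z).trace =
      D (((n : ℂ) * k * (((n - 1 : ℕ) : ℂ) / ((n - 1 : ℕ) + (k - 1 : ℕ)))) •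
        (m.rescaledLax z ^ (n - 1 + (k - 1))).trace) := by
  rw [powGradient, powGradient, Matrix.map_derivation_smul', smul_mul_smul_comm, Matrix.trace_smul,
    trace_map_pow_mul_pow_eq, mul_smul _ (_ / _ : ℂ), Derivation.map_smul _ (_ * _ : ℂ)]

/-- The densities have gradients, with contractions which are total derivatives as far as they
contribute to the bracket of the charges. -/
def HasInvolutiveGradients : Prop :=
  ∃ G : ℕ → ℂ → Matrix t.Index t.Index 𝒱, (∀ n, 2 ≤ n → m.IsGradient n (G n)) ∧
    ∀ n ∈ m.E0, ∀ k ∈ m.E0, ∃ A : ℕ → 𝒱,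
      HasTaylorAtZero (fun z => m.derivPairing (G n z) (G k z)) A ∧
        ∀ s ≤ m.r n, A s ∈ totalDerivatives 𝒱

end Rescaled

/-! ## Type `A` -/

section TypeA

open ClassicalType

variable {d : ℕ} {𝒱 : Type*} [CommRing 𝒱] [Algebra ℂ 𝒱] [PoissonVertexAlgebra 𝒱]
  (m : TwistModel (A d) 𝒱)

/-- The Casimir of `sl` sees only the traceless part of B; the scalar part produces the correction
by a product of traces. -/
theorem pairing_zero_eq_sub (A' B : Matrix (A d).Index (A d).Index 𝒱) [Nonempty (A d).Index] :
    m.pairing 0 A' B = (A' * B).trace -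
      (Fintype.card (A d).Index : ℂ)⁻¹ • (A'.trace * B.trace) := by
  obtain ⟨y, hy⟩ := exists_toMatrix_eq_sub_trace B
  have h : m.pairing 0 A' B = m.pairing 0 A' ((A d).toMatrix 𝒱 y) := by
    refine Finset.sum_congr rfl fun a _ => ?_
    congr 1
    have h1 : ∀ Y : (A d).alg, traceMul (1 : Matrix (A d).Index (A d).Index 𝒱)
        (Y : Matrix (A d).Index (A d).Index ℂ) = 0 := by
      intro Y
      rw [traceMul_apply, mul_one, ← AddMonoidHom.map_trace (algebraMap ℂ 𝒱),
        show (Y : Matrix (A d).Index (A d).Index ℂ).trace = 0 from Y.2, map_zero]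
    have h2 := traceMul_add (((Fintype.card (A d).Index : ℂ)⁻¹ • B.trace) • 1) ((A d).toMatrix 𝒱 y)
      (m.basisDown a : Matrix (A d).Index (A d).Index ℂ)
    rw [hy, add_sub_cancel] at h2
    rw [h2, hy, traceMul_apply, mul_smul_comm, Matrix.trace_smul, ← traceMul_apply, h1, smul_zero,
      zero_add]
  rw [h, pairing_zero_toMatrix, hy, mul_sub, Matrix.trace_sub, mul_smul_comm, mul_one,
    Matrix.trace_smul]
  rw [smul_eq_mul, smul_mul_assoc, mul_comm B.trace]

end TypeA

end TwistModel

/-! ## Involutive gradients for each type -/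

namespace TwistModel

open PoissonVertexAlgebra ClassicalType

/-! ### Taylor coefficients which are total derivatives or vanish by equivariance -/

section TotalDerivative

variable {t : ClassicalType} {𝒱 : Type*} [CommRing 𝒱] [Algebra ℂ 𝒱] [PoissonVertexAlgebra 𝒱]
  (m : TwistModel t 𝒱)

theorem exists_hasTaylorAtZero_mem {F H : ℂ → 𝒱} (hH : HolomorphicAtZero H)
    (h : ∀ z, F z = D (H z)) :
    ∃ A, HasTaylorAtZero F A ∧ ∀ s, A s ∈ totalDerivatives 𝒱 := by
  obtain ⟨A, hA⟩ := hH
  exact ⟨_, (hA.map ((D : Derivation ℂ 𝒱 𝒱) : 𝒱 →ₗ[ℂ] 𝒱)).congr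
    (Filter.Eventually.of_forall fun z => (h z).symm), fun s => ⟨_, rfl⟩⟩

theorem taylor_eq_zero_of_equivariant {F : ℂ → 𝒱} {A : ℕ → 𝒱} (hA : HasTaylorAtZero F A) {k : ℕ}
    (h : ∀ z, m.IsGood z → F (m.ω * z) = (m.ω⁻¹) ^ k • F z) {i : ℕ} (hi : ¬ m.T ∣ i + k) :
    A i = 0 := by
  have h1 := (hA.comp_mul m.ω_ne_zero).eq_of_eventuallyEq
    (hA.map (LinearMap.lsmul ℂ 𝒱 ((m.ω⁻¹) ^ k)))
    (by filter_upwards [m.eventually_isGood] with z hz using h z hz) i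
  rw [LinearMap.lsmul_apply, ← sub_eq_zero, ← sub_smul] at h1
  refine (smul_eq_zero_iff_right (sub_ne_zero.2 fun h2 => hi ?_)).1 h1
  rw [← m.isPrimitiveRoot.pow_eq_one_iff_dvd, pow_add, h2, inv_pow,
    inv_mul_cancel₀ (pow_ne_zero _ m.ω_ne_zero)]

theorem trace_rescaledLax {m : TwistModel t 𝒱}
    (h : ∀ X : t.alg, (X : Matrix t.Index t.Index ℂ).trace = 0) (z : ℂ) :
    (m.rescaledLax z).trace = 0 := trace_toMatrix h _

end TotalDerivative

/-! ### Type A: involutive gradients for inner and non-inner automorphisms -/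

section TypeA

variable {d : ℕ} {𝒱 : Type*} [CommRing 𝒱] [Algebra ℂ 𝒱] [PoissonVertexAlgebra 𝒱]
  (m : TwistModel (A d) 𝒱)

theorem equivariant_rescaledLax_of_conj {P Q : Matrix (Fin d) (Fin d) ℂ}
    (hσ : ∀ X : (A d).alg, (m.σ X : Matrix (Fin d) (Fin d) ℂ) =
      P * (X : Matrix (Fin d) (Fin d) ℂ) * Q) {z : ℂ} (hz : m.IsGood z) :
    m.rescaledLax (m.ω * z) = m.ω⁻¹ •
      (P.map (algebraMap ℂ 𝒱) * m.rescaledLax z * Q.map (algebraMap ℂ 𝒱)) := by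
  rw [hz.rescaledLax_mul, toMatrix_lTensor_conj (σ := (m.σ : (A d).alg →ₗ[ℂ] (A d).alg)) hσ]
  rfl

/-- Ordinary power gradients suffice. Their trace correction is not shown to be a total derivative;
it contributes nothing up to order rₙ because the coefficients of Tr Sⁿ⁻¹ vanish there. -/
theorem hasInvolutiveGradients_of_isInner [Nonempty (A d).Index] (h0 : m.HasRegularZeroAtOrigin)
    (hσ : IsInner m.σ) : m.HasInvolutiveGradients := by
  have htw : ¬ (A d).IsTwisted m.σ := not_not.2 hσ
  obtain ⟨q, hq⟩ := hσ
  have hPQ : q.1 * (q⁻¹).1 = 1 := by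
    rw [← Matrix.SpecialLinearGroup.coe_mul, mul_inv_cancel, Matrix.SpecialLinearGroup.coe_one]
  have hQP : (q⁻¹).1 * q.1 = 1 := by
    rw [← Matrix.SpecialLinearGroup.coe_mul, inv_mul_cancel, Matrix.SpecialLinearGroup.coe_one]
  set P := q.1
  set Q := (q⁻¹).1
  have hPQ' : P.map (algebraMap ℂ 𝒱) * Q.map (algebraMap ℂ 𝒱) = 1 := by
    rw [← Matrix.map_mul, hPQ, Matrix.map_one _ (map_zero _) (map_one _)]
  have hQP' : Q.map (algebraMap ℂ 𝒱) * P.map (algebraMap ℂ 𝒱) = 1 := by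
    rw [← Matrix.map_mul, hQP, Matrix.map_one _ (map_zero _) (map_one _)]
  have hpow : ∀ z, m.IsGood z → ∀ k, m.rescaledLax (m.ω * z) ^ k = (m.ω⁻¹) ^ k •
      (P.map (algebraMap ℂ 𝒱) * m.rescaledLax z ^ k * Q.map (algebraMap ℂ 𝒱)) := by
    intro z hz k
    rw [m.equivariant_rescaledLax_of_conj hq hz, smul_pow]
    congr 1
    exact conj_pow_of_mul_eq_one hPQ' hQP' _ k
  have htrace : ∀ k z, m.IsGood z →
      (m.rescaledLax (m.ω * z) ^ k).trace = (m.ω⁻¹) ^ k • (m.rescaledLax z ^ k).trace := by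
    intro k z hz
    rw [hpow z hz, Matrix.trace_smul]
    congr 1
    refine (Matrix.trace_mul_comm _ _).trans ?_
    rw [← mul_assoc]
    erw [hQP']
    rw [one_mul]
  refine ⟨m.powGradient, fun n hn => .of_rescaledLax (fun z => ?_) (m.commute_powGradient n) ?_
    (m.holomorphicAtZero_powGradient h0 n), fun n hn k hk => ?_⟩
  · rw [m.W_eq_of_not_isTwisted htw]
    exact m.hasMatrixGradient_trace_pow n z
  · intro z hz Y
    obtain ⟨l, rfl⟩ : ∃ l, n = l + 1 := ⟨n - 1, by omega⟩
    rw [m.kappa_of_not_isTwisted htw, powGradient, powGradient, traceMul_smul, traceMul_smul,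
      Nat.add_sub_cancel, hpow z hz, traceMul_smul, mul_one, smul_comm m.ω, smul_comm (m.ω ^ _),
      smul_smul (m.ω ^ _), pow_succ', mul_assoc, ← mul_pow, mul_inv_cancel₀ m.ω_ne_zero, one_pow,
      mul_one]
    have := traceMul_conj hQP (m.rescaledLax z ^ l) (Y : Matrix (Fin d) (Fin d) ℂ)
    rw [← hq] at this
    exact congrArg _ (congrArg _ this)
  · obtain ⟨a, ha⟩ := (m.holomorphicAtZero_rescaledLax h0).trace_pow (n - 1)
    obtain ⟨b, hb⟩ := (m.holomorphicAtZero_rescaledLax h0).trace_pow (k - 1)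
    obtain ⟨h, hh⟩ := (m.holomorphicAtZero_rescaledLax h0).trace_pow (n - 1 + (k - 1))
    set c : ℂ := (n : ℂ) * k * (((n - 1 : ℕ) : ℂ) / ((n - 1 : ℕ) + (k - 1 : ℕ))) with hc
    set e : ℂ := -((Fintype.card (A d).Index : ℂ)⁻¹ * (n * k)) with he
    have h1 := (hh.map (LinearMap.lsmul ℂ 𝒱 c)).map ((D : Derivation ℂ 𝒱 𝒱) : 𝒱 →ₗ[ℂ] 𝒱)
    have h2 := ((ha.map ((D : Derivation ℂ 𝒱 𝒱) : 𝒱 →ₗ[ℂ] 𝒱)).bilin (LinearMap.mul ℂ 𝒱) hb).map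
      (LinearMap.lsmul ℂ 𝒱 e)
    refine ⟨_, (h1.add h2).congr (Filter.Eventually.of_forall fun z => ?_), fun s hs => ?_⟩
    · rw [derivPairing_apply, pairing_zero_eq_sub, trace_map_powGradient_mul, ← hc,
        Matrix.trace_map_derivation, powGradient, powGradient, Matrix.trace_smul, Matrix.trace_smul,
        Derivation.map_smul, Derivation.map_smul, smul_mul_smul_comm, smul_smul, sub_eq_add_neg,
        ← neg_smul]
      exact congrArg₂ _ (Derivation.map_smul D c _) rfl
    · refine Submodule.add_mem _ ⟨_, rfl⟩ ?_
      rw [Finset.sum_eq_zero, map_zero]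
      · exact Submodule.zero_mem _
      · intro p hp
        have hp' := Finset.HasAntidiagonal.mem_antidiagonal.1 hp
        have hr := m.r_add_two_le hn
        have hd := m.dvd_r_add n
        rw [m.kappa_of_not_isTwisted htw, mul_one] at hd
        have hn2 := hn.1
        rw [m.taylor_eq_zero_of_equivariant ha (htrace (n - 1)) (i := p.1) ?_, map_zero, map_zero,
          LinearMap.zero_apply]
        intro hdvd
        have h3 := Nat.dvd_sub hd hdvd
        -- A nonzero coefficient of order i ≤ rₙ would make T divide rₙ - i + 1, which lies between
        -- 1 and T - 1.
        rw [show n + m.r n - (p.1 + (n - 1)) = m.r n - p.1 + 1 by omega] at h3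
        have := Nat.le_of_dvd (Nat.succ_pos _) h3
        omega

/-- The shift by T/2 in κ supplies ω^{T/2} = -1, the sign in σ(X) = -PXᵀP⁻¹. -/
theorem pow_kappa_of_not_isInner (hσ : ¬ IsInner m.σ) (hT : 1 < m.T) (heven : Even m.T) :
    m.ω ^ m.kappa = -m.ω := by
  have hk : m.kappa = 1 + m.T / 2 := if_pos hσ
  obtain ⟨c, hc⟩ := heven
  have hc2 : m.T / 2 = c := by omega
  have hsq : (m.ω ^ c) ^ 2 = 1 := by
    rw [← pow_mul, mul_two, ← hc, m.isPrimitiveRoot.pow_eq_one]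
  have hne : m.ω ^ c ≠ 1 := by
    rw [Ne, m.isPrimitiveRoot.pow_eq_one_iff_dvd]
    intro h
    have := Nat.le_of_dvd (by omega) h
    omega
  rw [hk, hc2, pow_add, pow_one, (mul_self_eq_one_iff.1 ((sq _).symm.trans hsq)).resolve_left hne,
      mul_neg_one]

/-- The exponential gradients are traceless, so the correction in the contraction vanishes and the
whole contraction is a total derivative, at every order. -/
theorem hasInvolutiveGradients_of_not_isInner [NeZero d] (h0 : m.HasRegularZeroAtOrigin)
    (hT : 1 < m.T) (hσ : ¬ IsInner m.σ) : m.HasInvolutiveGradients := by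
  obtain ⟨⟨P, Q, hPQ, hq⟩, heven⟩ := exists_conj_transpose_of_not_isInner m.σ hσ
  have hκ := m.pow_kappa_of_not_isInner hσ hT (heven _ m.iterate_order)
  have hQP : Q * P = 1 := mul_eq_one_comm.1 hPQ
  have hPQ' : P.map (algebraMap ℂ 𝒱) * Q.map (algebraMap ℂ 𝒱) = 1 := by
    rw [← Matrix.map_mul, hPQ, Matrix.map_one _ (map_zero _) (map_one _)]
  have hQP' : Q.map (algebraMap ℂ 𝒱) * P.map (algebraMap ℂ 𝒱) = 1 := by
    rw [← Matrix.map_mul, hQP, Matrix.map_one _ (map_zero _) (map_one _)]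
  have htr : ∀ z, (m.rescaledLax z).trace = 0 := trace_rescaledLax fun X => X.2
  have hN : (Fintype.card (A d).Index : ℂ) ≠ 0 := by
    rw [show Fintype.card (A d).Index = d from Fintype.card_fin d]
    exact Nat.cast_ne_zero.2 (NeZero.ne d)
  let p : ℕ → ℂ := fun n => ((n : ℂ) - 1) / (Fintype.card (A d).Index : ℂ)
  have hp : ∀ n, 2 ≤ n → p n * Fintype.card (A d).Index = (n - 1 : ℕ) := by
    intro n hn
    rw [div_mul_cancel₀ _ hN, Nat.cast_sub (by omega), Nat.cast_one]
  have hp0 : ∀ n, 2 ≤ n → p n ≠ 0 := by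
    intro n hn h
    have := hp n hn
    rw [h, zero_mul] at this
    exact absurd (Nat.cast_eq_zero.1 this.symm) (by omega)
  have hp2 : ∀ n k, 2 ≤ n → 2 ≤ k → p n + p k ≠ 0 := by
    intro n k hn hk h
    have : (p n + p k) * Fintype.card (A d).Index = ((n - 1 + (k - 1) : ℕ) : ℂ) := by
      rw [add_mul, hp n hn, hp k hk, Nat.cast_add]
    rw [h, zero_mul] at this
    exact absurd (Nat.cast_eq_zero.1 this.symm) (by omega)
  let G : ℕ → ℂ → Matrix (A d).Index (A d).Index 𝒱 := fun n z =>
    -p n • expGradient (p n) (m.rescaledLax z) (n - 1)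
  have hhol : ∀ n, HolomorphicAtZero fun z => expGradient (p n) (m.rescaledLax z) (n - 1) :=
    fun n => (m.holomorphicAtZero_rescaledLax h0).expGradient (p n) htr (n - 1)
  refine ⟨G, fun n hn => .of_rescaledLax ?_ ?_ ?_ ?_, fun n hn k hk => ?_⟩
  · intro z δ
    obtain ⟨l, rfl⟩ : ∃ l, n = l + 1 := ⟨n - 1, by omega⟩
    rw [W, if_pos (show IsTwisted (A d) m.σ from hσ), generatedDensity_eq]
    exact derivation_expCoeff_trace δ _ (htr z) l
  · exact fun z => (commute_expGradient _ _ _).smul_right _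
  · intro z hz Y
    have hS : m.rescaledLax (m.ω * z) = (-m.ω⁻¹) • (P.map (algebraMap ℂ 𝒱) *
        (m.rescaledLax z).transpose * Q.map (algebraMap ℂ 𝒱)) := by
      rw [hz.rescaledLax_mul, toMatrix_lTensor_conj_transpose
        (σ := (m.σ : (A d).alg →ₗ[ℂ] (A d).alg)) hq, neg_smul, smul_neg]
      rfl
    have hg := expGradient_conj_transpose hPQ' hQP' (p n) (-m.ω⁻¹) (htr z) hS (n - 1)
    have hconj := traceMul_conj hQP (expGradient (p n) (m.rescaledLax z) (n - 1)).transpose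
      (Y : Matrix (Fin d) (Fin d) ℂ).transpose
    have htrans : ∀ (B : Matrix (Fin d) (Fin d) 𝒱) (Z : Matrix (Fin d) (Fin d) ℂ),
        traceMul B.transpose Z.transpose = traceMul B Z := by
      intro B Z
      rw [traceMul_apply, traceMul_apply, Matrix.transpose_map, ← Matrix.transpose_mul,
        Matrix.trace_transpose, Matrix.trace_mul_comm]
    -- The sign left over cancels the one from σ(Y) = -PYᵀQ in the test element.
    have hω : m.ω ^ (n * m.kappa) * (-m.ω⁻¹) ^ (n - 1) = -m.ω := by
      obtain ⟨l, rfl⟩ : ∃ l, n = l + 1 := ⟨n - 1, by omega⟩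
      rw [mul_comm _ m.kappa, pow_mul, hκ, Nat.add_sub_cancel, pow_succ, mul_right_comm, ← mul_pow,
        neg_mul_neg, mul_inv_cancel₀ m.ω_ne_zero, one_pow, one_mul]
    have hY : traceMul (expGradient (p n) (m.rescaledLax (m.ω * z)) (n - 1))
        (m.σ Y : Matrix (Fin d) (Fin d) ℂ) = (-(-m.ω⁻¹) ^ (n - 1)) •
          traceMul (expGradient (p n) (m.rescaledLax z) (n - 1))
            (Y : Matrix (Fin d) (Fin d) ℂ) := by
      rw [hg, traceMul_smul, hq, map_neg, hconj, htrans, neg_smul, smul_neg]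
    simp only [G, traceMul_smul]
    rw [hY, smul_smul, smul_smul, smul_smul]
    congr 1
    linear_combination p n * hω
  · obtain ⟨B, hB⟩ := hhol n
    exact ⟨_, hB.map (LinearMap.lsmul ℂ _ (-p n))⟩
  · obtain ⟨B, hB⟩ := hhol n
    obtain ⟨B', hB'⟩ := hhol k
    have hprod := ((hB.bilin (LinearMap.mul ℂ (Matrix (A d).Index (A d).Index 𝒱)) hB').map
      (Matrix.traceLinearMap (A d).Index ℂ 𝒱)).map
        (LinearMap.lsmul ℂ 𝒱 (p n * p k * (p n / (p n + p k))))
    have : Nonempty (A d).Index := ⟨(0 : Fin d)⟩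
    obtain ⟨A', hA', hmem⟩ := exists_hasTaylorAtZero_mem ⟨_, hprod⟩
      (F := fun z => m.derivPairing (G n z) (G k z)) (fun z => by
        have h1 := trace_map_expGradient_mul_mem (D : Derivation ℂ 𝒱 𝒱) (htr z) (hp0 n hn.1)
          (hp0 k hk.1) (hp2 n k hn.1 hk.1) (hp n hn.1) (hp k hk.1)
        have h2 : (G k z).trace = 0 := by
          rw [Matrix.trace_smul, trace_expGradient (htr z) (hp0 k hk.1) (hp k hk.1), smul_zero]
        rw [derivPairing_apply, pairing_zero_eq_sub, h2, mul_zero, smul_zero, sub_zero,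
          Matrix.map_derivation_smul', smul_mul_smul_comm, Matrix.trace_smul, h1, neg_mul_neg,
          ← Derivation.map_smul, smul_smul]
        rfl)
    exact ⟨A', hA', fun s _ => hmem s⟩

end TypeA

end TwistModel

/-! ## Odd powers in the orthogonal and symplectic types -/

section SymCube

/-- The polarisation of the cube. -/
def symCube {R : Type*} [Ring R] (x y z : R) : R :=
  x * y * z + x * z * y + y * x * z + y * z * x + z * x * y + z * y * x

theorem symCube_eq {R : Type*} [Ring R] (x y z : R) : symCube x y z =
    (x + y + z) ^ 3 - (x + y) ^ 3 - (x + z) ^ 3 - (y + z) ^ 3 + x ^ 3 + y ^ 3 + z ^ 3 := by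
  rw [symCube]
  noncomm_ring

theorem symCube_self_pow {R : Type*} [Ring R] (x : R) (k : ℕ) :
    symCube x x (x ^ k) = (6 : ℕ) • x ^ (k + 2) := by
  have h1 : x * x ^ k = x ^ (k + 1) := (pow_succ' x k).symm
  have h2 : x ^ k * x = x ^ (k + 1) := (pow_succ x k).symm
  have h3 : x * x ^ (k + 1) = x ^ (k + 2) := (pow_succ' x (k + 1)).symm
  have h4 : x ^ (k + 1) * x = x ^ (k + 2) := (pow_succ x (k + 1)).symm
  simp only [symCube, mul_assoc, h1, h2, h3]
  rw [h4]
  abel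

variable {t : ClassicalType} {σ : t.alg →ₗ[ℂ] t.alg}

theorem exists_coe_eq_symCube (hcube : ∀ X : t.alg, (X : Matrix t.Index t.Index ℂ) ^ 3 ∈ t.alg)
    (hσ : PreservesCubes σ) (X Y Z : t.alg) : ∃ U : t.alg,
      (U : Matrix t.Index t.Index ℂ) =
        symCube (X : Matrix t.Index t.Index ℂ) (Y : Matrix t.Index t.Index ℂ)
          (Z : Matrix t.Index t.Index ℂ) ∧
      (σ U : Matrix t.Index t.Index ℂ) =
        symCube (σ X : Matrix t.Index t.Index ℂ) (σ Y : Matrix t.Index t.Index ℂ)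
          (σ Z : Matrix t.Index t.Index ℂ) := by
  let c : t.alg → t.alg := fun X => ⟨_, hcube X⟩
  have hc : ∀ X : t.alg, (c X : Matrix t.Index t.Index ℂ) =
      (X : Matrix t.Index t.Index ℂ) ^ 3 := fun _ => rfl
  have hσc : ∀ X : t.alg, (σ (c X) : Matrix t.Index t.Index ℂ) =
      (σ X : Matrix t.Index t.Index ℂ) ^ 3 := fun X => hσ X (c X) (hc X)
  refine ⟨c (X + Y + Z) - c (X + Y) - c (X + Z) - c (Y + Z) + c X + c Y + c Z, ?_, ?_⟩
  · simp only [AddMemClass.coe_add, AddSubgroupClass.coe_sub, hc, symCube_eq]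
  · simp only [map_add, map_sub, AddMemClass.coe_add, AddSubgroupClass.coe_sub, hσc, symCube_eq]

variable {𝒱 : Type*} [CommRing 𝒱] [Algebra ℂ 𝒱]

theorem symCube_smul_map {ι : Type*} [Fintype ι] [DecidableEq ι] (a b c : 𝒱)
    (X Y Z : Matrix ι ι ℂ) :
    symCube (a • X.map (algebraMap ℂ 𝒱)) (b • Y.map (algebraMap ℂ 𝒱))
      (c • Z.map (algebraMap ℂ 𝒱)) = (a * b * c) • (symCube X Y Z).map (algebraMap ℂ 𝒱) := by
  have hadd := fun A B : Matrix ι ι ℂ => Matrix.map_add (algebraMap ℂ 𝒱) (map_add _) A B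
  simp only [symCube, hadd, Matrix.map_mul, smul_mul_smul_comm, smul_add]
  rw [show a * c * b = a * b * c by ring, show b * a * c = a * b * c by ring,
    show b * c * a = a * b * c by ring, show c * a * b = a * b * c by ring,
    show c * b * a = a * b * c by ring]

/-- Compatibility with cubes is known for complex matrices only. Its polarisation is trilinear and
so extends to coefficients in 𝒱; odd powers then follow from 6 Sᵏ⁺² = symCube(S, S, Sᵏ). -/
theorem exists_toMatrix_eq_symCube
    (hcube : ∀ X : t.alg, (X : Matrix t.Index t.Index ℂ) ^ 3 ∈ t.alg)
    (hσ : PreservesCubes σ) (x y w : 𝒱 ⊗[ℂ] t.alg) : ∃ u,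
      t.toMatrix 𝒱 u = symCube (t.toMatrix 𝒱 x) (t.toMatrix 𝒱 y) (t.toMatrix 𝒱 w) ∧
      t.toMatrix 𝒱 (σ.lTensor 𝒱 u) = symCube (t.toMatrix 𝒱 (σ.lTensor 𝒱 x))
        (t.toMatrix 𝒱 (σ.lTensor 𝒱 y)) (t.toMatrix 𝒱 (σ.lTensor 𝒱 w)) := by
  induction x using TensorProduct.induction_on with
  | zero => exact ⟨0, by simp [symCube], by simp [symCube]⟩
  | add x x' hx hx' =>
    obtain ⟨u, h, h'⟩ := hx
    obtain ⟨v, k, k'⟩ := hx'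
    refine ⟨u + v, ?_, ?_⟩ <;>
    · simp only [map_add, h, h', k, k', symCube, add_mul, mul_add]
      abel
  | tmul a X =>
    induction y using TensorProduct.induction_on with
    | zero => exact ⟨0, by simp [symCube], by simp [symCube]⟩
    | add y y' hy hy' =>
      obtain ⟨u, h, h'⟩ := hy
      obtain ⟨v, k, k'⟩ := hy'
      refine ⟨u + v, ?_, ?_⟩ <;>
      · simp only [map_add, h, h', k, k', symCube, add_mul, mul_add]
        abel
    | tmul b Y =>
      induction w using TensorProduct.induction_on with
      | zero => exact ⟨0, by simp [symCube], by simp [symCube]⟩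
      | add w w' hw hw' =>
        obtain ⟨u, h, h'⟩ := hw
        obtain ⟨v, k, k'⟩ := hw'
        refine ⟨u + v, ?_, ?_⟩ <;>
        · simp only [map_add, h, h', k, k', symCube, add_mul, mul_add]
          abel
      | tmul c Z =>
        obtain ⟨U, hU, hU'⟩ := exists_coe_eq_symCube hcube hσ X Y Z
        refine ⟨(a * b * c) ⊗ₜ U, ?_, ?_⟩
        · simp only [ClassicalType.toMatrix_tmul, symCube_smul_map, hU]
        · simp only [LinearMap.lTensor_tmul, ClassicalType.toMatrix_tmul, symCube_smul_map, hU']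

theorem exists_toMatrix_eq_odd_pow
    (hcube : ∀ X : t.alg, (X : Matrix t.Index t.Index ℂ) ^ 3 ∈ t.alg)
    (hσ : PreservesCubes σ) (x : 𝒱 ⊗[ℂ] t.alg) {k : ℕ} (hk : Odd k) : ∃ u,
      t.toMatrix 𝒱 u = t.toMatrix 𝒱 x ^ k ∧
      t.toMatrix 𝒱 (σ.lTensor 𝒱 u) = t.toMatrix 𝒱 (σ.lTensor 𝒱 x) ^ k := by
  obtain ⟨l, rfl⟩ := hk
  induction l with
  | zero => exact ⟨x, by simp, by simp⟩
  | succ l ih =>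
    obtain ⟨u, h, h'⟩ := ih
    obtain ⟨v, k, k'⟩ := exists_toMatrix_eq_symCube hcube hσ x x u
    have h6 : ∀ B : Matrix t.Index t.Index 𝒱, (6 : ℂ)⁻¹ • (6 : ℕ) • B = B := by
      intro B
      rw [← Nat.cast_smul_eq_nsmul ℂ, smul_smul]
      norm_num
    refine ⟨(6 : ℂ)⁻¹ • v, ?_, ?_⟩
    · rw [map_smul, k, h, symCube_self_pow, h6]
      congr 1
    · rw [map_smul, map_smul, k', h', symCube_self_pow, h6]
      congr 1

end SymCube

namespace TwistModel

open PoissonVertexAlgebra ClassicalType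

/-! ### Types B, C, D, and assembly of all the types -/

section SkewTypes

variable {t : ClassicalType} {𝒱 : Type*} [CommRing 𝒱] [Algebra ℂ 𝒱] [PoissonVertexAlgebra 𝒱]
  (m : TwistModel t 𝒱)

theorem hasInvolutiveGradients_of_preservesCubes (h0 : m.HasRegularZeroAtOrigin)
    (htw : ¬ t.IsTwisted m.σ) (htr : ∀ X : t.alg, (X : Matrix t.Index t.Index ℂ).trace = 0)
    (hcube : ∀ X : t.alg, (X : Matrix t.Index t.Index ℂ) ^ 3 ∈ t.alg)
    (h2 : PreservesTraceForm m.σ) (h3 : PreservesCubes m.σ) : m.HasInvolutiveGradients := by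
  have hodd : ∀ z k, Odd k → ∃ u, t.toMatrix 𝒱 u = m.rescaledLax z ^ k ∧
      (m.IsGood z → m.rescaledLax (m.ω * z) ^ k = (m.ω⁻¹) ^ k •
        t.toMatrix 𝒱 (LinearMap.lTensor 𝒱 (m.σ : t.alg →ₗ[ℂ] t.alg) u)) := by
    intro z k hk
    obtain ⟨u, h, h'⟩ := exists_toMatrix_eq_odd_pow (σ := (m.σ : t.alg →ₗ[ℂ] t.alg)) hcube h3
      (m.φ.valueAt z • m.L z) hk
    refine ⟨u, h, fun hz => ?_⟩
    rw [hz.rescaledLax_mul, smul_pow, h']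
  -- For odd n the density vanishes and 0 is a gradient. The even power Sⁿ⁻¹ is avoided, since only
  -- odd powers are 𝔤-valued and respected by σ.
  let G : ℕ → ℂ → Matrix t.Index t.Index 𝒱 := fun n z =>
    if Even n then m.powGradient n z else 0
  refine ⟨G, fun n hn => ?_, fun n hn k hk => ?_⟩
  · by_cases he : Even n
    · have hG : G n = m.powGradient n := funext fun z => if_pos he
      have hn1 : Odd (n - 1) := Nat.Even.sub_odd (by omega) he odd_one
      rw [hG]
      refine .of_rescaledLax (fun z => ?_) (m.commute_powGradient n) ?_
        (m.holomorphicAtZero_powGradient h0 n)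
      · rw [m.W_eq_of_not_isTwisted htw]
        exact m.hasMatrixGradient_trace_pow n z
      · intro z hz Y
        obtain ⟨u, h, h'⟩ := hodd z _ hn1
        have hform := traceMul_toMatrix_lTensor (σ := (m.σ : t.alg →ₗ[ℂ] t.alg)) h2 u Y
        rw [h] at hform
        rw [m.kappa_of_not_isTwisted htw, powGradient, powGradient, traceMul_smul, traceMul_smul,
          h' hz, traceMul_smul, mul_one, smul_comm m.ω, smul_comm (m.ω ^ _), smul_smul (m.ω ^ _)]
        congr 1
        rw [show m.ω ^ n * m.ω⁻¹ ^ (n - 1) = m.ω from ?_]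
        · exact congrArg _ hform
        · obtain ⟨l, rfl⟩ : ∃ l, n = l + 1 := ⟨n - 1, by omega⟩
          rw [Nat.add_sub_cancel, pow_succ', mul_assoc, ← mul_pow, mul_inv_cancel₀ m.ω_ne_zero,
            one_pow, mul_one]
    · have hG : G n = fun _ => 0 := funext fun z => if_neg he
      rw [hG]
      refine .of_rescaledLax (fun z δ => ?_) (fun z => Commute.zero_right _) (fun z hz Y => ?_)
        ⟨_, HasTaylorAtZero.zero⟩
      · obtain ⟨u, h, -⟩ := hodd z n (Nat.not_even_iff_odd.1 he)
        rw [m.W_eq_of_not_isTwisted htw, ← h, trace_toMatrix htr, map_zero, zero_mul,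
          Matrix.trace_zero]
      · rw [traceMul_apply, traceMul_apply, mul_zero, mul_zero, Matrix.trace_zero, smul_zero,
          smul_zero]
  · obtain ⟨a, ha⟩ := (m.holomorphicAtZero_rescaledLax h0).trace_pow (n - 1 + (k - 1))
    let c : ℂ := if Even n ∧ Even k then
      (n : ℂ) * k * (((n - 1 : ℕ) : ℂ) / ((n - 1 : ℕ) + (k - 1 : ℕ))) else 0
    obtain ⟨A', hA', hmem⟩ := exists_hasTaylorAtZero_mem ⟨_, ha.map (LinearMap.lsmul ℂ 𝒱 c)⟩
      (F := fun z => m.derivPairing (G n z) (G k z)) (fun z => by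
        rw [LinearMap.lsmul_apply]
        by_cases hen : Even n
        · by_cases hek : Even k
          · have hk1 : Odd (k - 1) := Nat.Even.sub_odd (by have := hk.1; omega) hek odd_one
            obtain ⟨u, h, -⟩ := hodd z _ hk1
            simp only [G, c, if_pos hen, if_pos hek, if_pos (And.intro hen hek)]
            rw [derivPairing_apply, ← trace_map_powGradient_mul, powGradient, powGradient, ← h,
              ← map_smul, pairing_zero_toMatrix]
          · simp only [G, c, if_neg hek, if_neg fun h : Even n ∧ Even k => hek h.2, map_zero,
              zero_smul]
        · simp only [G, c, if_neg hen, if_neg fun h : Even n ∧ Even k => hen h.1, map_zero,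
            zero_smul, LinearMap.zero_apply])
    exact ⟨A', hA', fun s _ => hmem s⟩

theorem skewAdjoint_trace_and_cube (hA : ∀ d, t ≠ .A d) (X : t.alg) :
    (X : Matrix t.Index t.Index ℂ).trace = 0 ∧ (X : Matrix t.Index t.Index ℂ) ^ 3 ∈ t.alg := by
  match t with
  | .A d => exact absurd rfl (hA d)
  | .BD d =>
    refine ⟨?_, odd_pow_mem_skewAdjoint X.2 (by decide)⟩
    have := isFormMatrix_one.trace_odd_pow X.2 odd_one
    rwa [pow_one] at this
  | .C l =>
    refine ⟨?_, odd_pow_mem_skewAdjoint X.2 (by decide)⟩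
    have := isFormMatrix_J.trace_odd_pow X.2 odd_one
    rwa [pow_one] at this

theorem preservesTraceForm_σ (ht : t.IsSimpleType) (hσ : t.NotSpecialD4 m.σ) :
    PreservesTraceForm m.σ := by
  match t with
  | .A d =>
    have h2 : 2 ≤ d := ht
    have : Nonempty (Fin d) := ⟨⟨0, by omega⟩⟩
    exact SpecialLinearAut.preservesTraceForm m.σ
  | .BD d => exact (preserves_of_skewAdjoint _ ht _ hσ (by simp)).1
  | .C l => exact (preserves_of_skewAdjoint _ ht _ hσ (by simp)).1

theorem hasInvolutiveGradients (ht : t.IsSimpleType) (hT : 1 < m.T) (hσ : t.NotSpecialD4 m.σ)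
    (h0 : m.HasRegularZeroAtOrigin) : m.HasInvolutiveGradients := by
  by_cases hA : ∀ d, t ≠ .A d
  · obtain ⟨h2, h3⟩ := preserves_of_skewAdjoint t ht m.σ hσ hA
    refine m.hasInvolutiveGradients_of_preservesCubes h0 ?_
      (fun X => (skewAdjoint_trace_and_cube hA X).1) (fun X => (skewAdjoint_trace_and_cube hA X).2)
      h2 h3
    match t with
    | .A d => exact absurd rfl (hA d)
    | .BD d => exact not_false
    | .C l => exact not_false
  · push Not at hA
    obtain ⟨d, rfl⟩ := hA
    have h2 : 2 ≤ d := ht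
    have : NeZero d := ⟨by omega⟩
    have : Nonempty (A d).Index := ⟨(0 : Fin d)⟩
    by_cases hin : IsInner m.σ
    · exact m.hasInvolutiveGradients_of_isInner h0 hin
    · exact m.hasInvolutiveGradients_of_not_isInner h0 hT hin

theorem holomorphicAtZero_W (ht : t.IsSimpleType) (h0 : m.HasRegularZeroAtOrigin) (n : ℕ) :
    HolomorphicAtZero (m.W n) := by
  have hS := m.holomorphicAtZero_rescaledLax h0
  by_cases htw : t.IsTwisted m.σ
  · have htr : ∀ X : t.alg, (X : Matrix t.Index t.Index ℂ).trace = 0 := by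
      match t with
      | .A d => exact fun X => X.2
      | .BD d => exact htw.elim
      | .C l => exact htw.elim
    have hW : m.W n = fun z => expCoeff (((n : ℂ) - 1) / (Fintype.card t.Index : ℂ))
        (fun k => (m.rescaledLax z ^ k).trace) n := by
      funext z
      rw [W, if_pos htw, generatedDensity_eq]
    rw [hW]
    exact holomorphicAtZero_expCoeff _ _ (fun z => by rw [pow_one]; exact trace_rescaledLax htr z)
      hS.trace_pow n
  · rw [show m.W n = fun z => (m.rescaledLax z ^ n).trace from
      funext fun z => m.W_eq_of_not_isTwisted htw n z]
    exact hS.trace_pow n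

theorem integratedBr_K0_mem_totalDerivatives (ht : t.IsSimpleType) (hT : 1 < m.T)
    (hσ : t.NotSpecialD4 m.σ) (h0 : m.HasRegularZeroAtOrigin) {n k : ℕ} (hn : n ∈ m.E0)
    (hk : k ∈ m.E0) : integratedBr (m.K0 n) (m.K0 k) ∈ totalDerivatives 𝒱 := by
  obtain ⟨G, hG, hinv⟩ := m.hasInvolutiveGradients ht hT hσ h0
  obtain ⟨A, hA, hmem⟩ := hinv n hn k hk
  exact m.integratedBr_K0_mem h0.1 (m.preservesTraceForm_σ ht hσ) hn hk
    (m.holomorphicAtZero_W ht h0 n) (m.holomorphicAtZero_W ht h0 k) (hG n hn.1) (hG k hk.1) hA hmem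

end SkewTypes

end TwistModel

/-! ## Integrals of total derivatives -/

namespace PoissonVertexAlgebra.FieldConfiguration

variable {𝒱 : Type*} [CommRing 𝒱] [Algebra ℂ 𝒱] [PoissonVertexAlgebra 𝒱] (u : FieldConfiguration 𝒱)

theorem integral_eval_D (q : 𝒱) (a b : ℝ) :
    ∫ x in a..b, u.eval (D q) x = u.eval q b - u.eval q a := by
  have hcont : Continuous (u.eval (D q)) :=
    continuous_iff_continuousAt.2 fun x => (u.hasDerivAt_eval (D q) x).continuousAt
  exact intervalIntegral.integral_eq_sub_of_hasDerivAt (fun x _ => u.hasDerivAt_eval q x)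
    (hcont.intervalIntegrable _ _)

theorem integral_eval_eq_zero_of_isPeriodic {ℓ : ℝ} (hu : u.IsPeriodic ℓ) {c : 𝒱}
    (hc : c ∈ totalDerivatives 𝒱) : ∫ x in (0 : ℝ)..ℓ, u.eval c x = 0 := by
  obtain ⟨q, rfl⟩ := hc
  refine (u.integral_eval_D q 0 ℓ).trans ?_
  have := hu q 0
  rw [zero_add] at this
  rw [this, sub_self]

theorem tendsto_integral_eval_of_decaysAtInfinity (hu : u.DecaysAtInfinity) {c : 𝒱}
    (hc : c ∈ totalDerivatives 𝒱) :
    Filter.Tendsto (fun ρ : ℝ => ∫ x in (-ρ)..ρ, u.eval c x) Filter.atTop (𝓝 0) := by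
  obtain ⟨q, rfl⟩ := hc
  obtain ⟨v, hv⟩ := hu q
  have h1 : Filter.Tendsto (u.eval q) Filter.atTop (𝓝 v) := hv.mono_left atTop_le_cocompact
  have h2 : Filter.Tendsto (fun ρ : ℝ => u.eval q (-ρ)) Filter.atTop (𝓝 v) :=
    (hv.mono_left atBot_le_cocompact).comp Filter.tendsto_neg_atTop_atBot
  have h3 := h1.sub h2
  rw [sub_self] at h3
  exact h3.congr fun ρ => (u.integral_eval_D q (-ρ) ρ).symm

end PoissonVertexAlgebra.FieldConfiguration

end

/-! ### Involution of the charges -/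

theorem mainTheorem2 (t : ClassicalType) (ht : t.IsSimpleType)
    (𝒱 : Type*) [CommRing 𝒱] [Algebra ℂ 𝒱] [PoissonVertexAlgebra 𝒱]
    (m : TwistModel t 𝒱) (hT : 1 < m.T) (hσ : t.NotSpecialD4 m.σ)
    (h0 : m.HasRegularZeroAtOrigin) :
    (∀ n, 2 ≤ n → HolomorphicAtZero (m.W n)) ∧
    ∀ n ∈ m.E0, ∀ k ∈ m.E0,
      PoissonVertexAlgebra.chargeBracket (m.Q0 n) (m.Q0 k) = 0 ∧
      (∀ (u : PoissonVertexAlgebra.FieldConfiguration 𝒱) (ℓ : ℝ), u.IsPeriodic ℓ →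
        ∫ x in (0 : ℝ)..ℓ,
          u.eval (PoissonVertexAlgebra.integratedBr (m.K0 n) (m.K0 k)) x = 0) ∧
      (∀ u : PoissonVertexAlgebra.FieldConfiguration 𝒱, u.DecaysAtInfinity →
        Filter.Tendsto (fun ρ : ℝ => ∫ x in (-ρ)..ρ,
          u.eval (PoissonVertexAlgebra.integratedBr (m.K0 n) (m.K0 k)) x)
          Filter.atTop (nhds 0)) := by
  refine ⟨fun n _ => m.holomorphicAtZero_W ht h0 n, fun n hn k hk => ?_⟩
  have hmem := m.integratedBr_K0_mem_totalDerivatives ht hT hσ h0 hn hk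
  refine ⟨?_, fun u ℓ hu => u.integral_eval_eq_zero_of_isPeriodic hu hmem,
    fun u hu => u.tendsto_integral_eval_of_decaysAtInfinity hu hmem⟩
  rw [TwistModel.Q0, TwistModel.Q0, PoissonVertexAlgebra.chargeBracket_integral]
  exact (Submodule.Quotient.mk_eq_zero _).2 hmem
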